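/- **Theorem (Positive mass theorem for graphs).** Let $n\ge 5$, $m\ge 0$, $\tau>\frac{n-4}{3}$, and let $f=(f^1,\dots,f^m):\mathbb R^n\to\mathbb R^m$ be a smooth map that is asymptotically flat of order $\tau$, i.e. for all $i,j,k,\alpha$ $$|f^\alpha_i(x)|+|f^\alpha_{ij}(x)||x|+|f^\alpha_{ijk}(x)||x|^2=O(|x|^{-\tau/2})\quad (|x|\to\infty),$$ where lower indices on $f^\alpha$ denote partial derivatives. Repeated indices are summed, Latin ones over $1,\dots,n$ and Greek ones over $1,\dots,m$. Let $M=\{(x,f(x))\}\subset\mathbb R^{n+m}$ be its graph with the induced metric $g_{ij}=\delta_{ij}+f^\alpha_if^\alpha_j$ in the global chart $x\in\mathbb R^n$, $G=\det(g_{ij})$ and $d\mu_M=\sqrt G\,dx$. Let $R_{ijkl}=\langle R(\partial_i,\partial_j)\partial_l,\partial_k\rangle$, where $R(X,Y)=[\nabla_X,\nabla_Y]-\nabla_{[X,Y]}$ for the Levi-Civita connection $\nabla$ of $g$; let $R_{jl}=g^{ik}R_{ijkl}$ and $R=g^{jl}R_{jl}$ be the Ricci and scalar curvatures, and put $$P^{ijkl}=R^{ijkl}+R^{jk}g^{il}-R^{jl}g^{ik}-R^{ik}g^{jl}+R^{il}g^{jk}+\tfrac12R(g^{ik}g^{jl}-g^{il}g^{jk}),\qquad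 L_2=P^{ijkl}R_{ijkl}.$$ Assume that $L_2$ is integrable on $(M,\mu_M)$. The second Gauss–Bonnet–Chern mass of $M$ is $$m_2(g)=c_2(n)\lim_{r\to\infty}\int_{S_r}P^{ijkl}\,\partial_l g_{jk}\,\nu_i\,dS,\qquad c_2(n)=\frac{1}{2(n-1)(n-2)(n-3)\,\omega_{n-1}},$$ where $S_r=\{|x|=r\}$, $\nu=x/r$, $dS$ is the Euclidean area element and $\omega_{n-1}$ is the area of the unit sphere in $\mathbb R^n$. Write $\partial_i=(e_i,f^\alpha_ie_\alpha)$ for the tangent frame of $M$, $\eta^\alpha=(-Df^\alpha,e_\alpha)$ for the normal frame, $(U^{\alpha\beta})$ for the inverse of the matrix $U_{\alpha\beta}=\langle\eta^\alpha,\eta^\beta\rangle$, $A^\alpha\partial_i=-(D_{\partial_i}\eta^\alpha)^\top$ for the shape operators, $\nabla f^\alpha=g^{jk}f^\alpha_k\partial_j$, $Rc$ for the Ricci operator, $R^\perp_{\alpha\beta}=A^\beta A^\alpha-A^\alpha A^\beta$, and $$T^\perp_\alpha=U^{\mu\nu}\big((\mathrm{Tr}A^\mu)R^\perp_{\nu\alpha}+R^\perp_{\alpha\mu}A^\nu+A^\mu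 R^\perp_{\alpha\nu}\big).$$ Define $L_2^\perp$ by $$\begin{aligned}\tfrac12L_2^\perp={}&U^{\mu\nu}\big\langle\big(A^\mu(A^\nu R^\perp_{\alpha\gamma}+R^\perp_{\nu\gamma}A^\alpha-R^\perp_{\nu\alpha}A^\gamma)+\mathrm{Tr}(A^\alpha A^\mu)R^\perp_{\gamma\nu}\big)\nabla f^\alpha,\nabla f^\gamma\big\rangle\\&-\big\langle\big(2Rc\,R^\perp_{\alpha\gamma}+T^\perp_\gamma A^\alpha+A^\alpha T^\perp_\gamma\big)\nabla f^\alpha,\nabla f^\gamma\big\rangle\\&+\big\langle(\mathrm{Tr}A^\alpha)T^\perp_\gamma\nabla f^\alpha,\nabla f^\gamma\big\rangle+\tfrac12R\,\big\langle R^\perp_{\alpha\gamma}\nabla f^\alpha,\nabla f^\gamma\big\rangle.\end{aligned}$$ Then the limit defining $m_2(g)$ exists, $(L_2+L_2^\perp)\frac1{\sqrt G}$ is integrable on $(M,\mu_M)$, and $$m_2(g)=\frac12c_2(n)\int_M(L_2+L_2^\perp)\frac{1}{\sqrt G}\,d\mu_M.$$ If the normal bundle of $M$ is flat (the normal connection has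 zero curvature), then $L_2^\perp=0$ on $M$. In particular, if $M$ has flat normal bundle and $L_2\ge0$ on $M$, then $m_2(g)\ge0$. -/

import Mathlib

open MeasureTheory Filter Topology
open scoped ContDiff Matrix

noncomputable section

namespace GBC

/-- Euclidean space `ℝⁿ`. -/
abbrev Euc (n : ℕ) : Type := EuclideanSpace ℝ (Fin n)

/-- The ambient Euclidean space `ℝⁿ⁺ᵐ = ℝⁿ × ℝᵐ`. -/
abbrev Amb (n m : ℕ) : Type := EuclideanSpace ℝ (Fin n ⊕ Fin m)

/-- The partial derivative `∂ᵢ h` of a (possibly vector-valued) function on `ℝⁿ`. -/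
def pd {n : ℕ} {F : Type*} [NormedAddCommGroup F] [NormedSpace ℝ F]
    (i : Fin n) (h : Euc n → F) (x : Euc n) : F :=
  fderiv ℝ h x (EuclideanSpace.single i 1)

/-! ### Riemannian geometry of a metric `g` on `ℝⁿ`, in the standard global chart -/

section Intrinsic

variable {n : ℕ}

/-- The inverse metric `g^{ij}`. -/
def ginv (g : Euc n → Matrix (Fin n) (Fin n) ℝ) (x : Euc n) : Matrix (Fin n) (Fin n) ℝ :=
  (g x)⁻¹

/-- The Christoffel symbol `Γ^k_{ij}` of the Levi-Civita connection. -/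
def christoffel (g : Euc n → Matrix (Fin n) (Fin n) ℝ) (k i j : Fin n) (x : Euc n) : ℝ :=
  (1 / 2) * ∑ l, ginv g x k l *
    (pd i (fun y => g y j l) x + pd j (fun y => g y i l) x - pd l (fun y => g y i j) x)

/-- The coefficient of `∂_p` in `R(∂_i, ∂_j) ∂_l = ∇_i ∇_j ∂_l - ∇_j ∇_i ∂_l`. -/
def curvOp (g : Euc n → Matrix (Fin n) (Fin n) ℝ) (i j l p : Fin n) (x : Euc n) : ℝ :=
  pd i (christoffel g p j l) x - pd j (christoffel g p i l) x
    + ∑ q, (christoffel g p i q x * christoffel g q j l x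
      - christoffel g p j q x * christoffel g q i l x)

/-- The curvature tensor `R_{ijkl} = ⟨R(∂_i, ∂_j) ∂_l, ∂_k⟩`; with this convention `R_{ijij} > 0`
(for `i ≠ j`) on round spheres. -/
def riem (g : Euc n → Matrix (Fin n) (Fin n) ℝ) (i j k l : Fin n) (x : Euc n) : ℝ :=
  ∑ p, g x k p * curvOp g i j l p x

/-- The Ricci tensor `R_{jl} = g^{ik} R_{ijkl}`. -/
def ric (g : Euc n → Matrix (Fin n) (Fin n) ℝ) (j l : Fin n) (x : Euc n) : ℝ :=
  ∑ i, ∑ k, ginv g x i k * riem g i j k l x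

/-- The scalar curvature `R = g^{jl} R_{jl}`. -/
def scal (g : Euc n → Matrix (Fin n) (Fin n) ℝ) (x : Euc n) : ℝ :=
  ∑ j, ∑ l, ginv g x j l * ric g j l x

/-- The curvature tensor `R^{ijkl}` with all indices raised. -/
def riemUp (g : Euc n → Matrix (Fin n) (Fin n) ℝ) (i j k l : Fin n) (x : Euc n) : ℝ :=
  ∑ a, ∑ b, ∑ c, ∑ d, ginv g x i a * ginv g x j b * ginv g x k c * ginv g x l d *
    riem g a b c d x

/-- The Ricci tensor `R^{ij}` with both indices raised. -/
def ricUp (g : Euc n → Matrix (Fin n) (Fin n) ℝ) (i j : Fin n) (x : Euc n) : ℝ :=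
  ∑ a, ∑ b, ginv g x i a * ginv g x j b * ric g a b x

/-- The tensor `P^{ijkl}`. -/
def tensorP (g : Euc n → Matrix (Fin n) (Fin n) ℝ) (i j k l : Fin n) (x : Euc n) : ℝ :=
  riemUp g i j k l x
    + ricUp g j k x * ginv g x i l - ricUp g j l x * ginv g x i k
    - ricUp g i k x * ginv g x j l + ricUp g i l x * ginv g x j k
    + (1 / 2) * scal g x * (ginv g x i k * ginv g x j l - ginv g x i l * ginv g x j k)

/-- The second Gauss-Bonnet curvature `L₂ = P^{ijkl} R_{ijkl}`. -/
def L2 (g : Euc n → Matrix (Fin n) (Fin n) ℝ) (x : Euc n) : ℝ :=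
  ∑ i, ∑ j, ∑ k, ∑ l, tensorP g i j k l x * riem g i j k l x

/-- The Riemannian volume measure `√(det g) dx` of `g`. -/
def riemVol (g : Euc n → Matrix (Fin n) (Fin n) ℝ) : Measure (Euc n) :=
  volume.withDensity fun x => ENNReal.ofReal (Real.sqrt (g x).det)

/-- The area `ω_{n-1}` of the unit sphere in `ℝⁿ`. -/
def sphereArea (n : ℕ) : ℝ := (volume : Measure (Euc n)).toSphere.real Set.univ

/-- The integral `∫_{S_r} h dS` over the Euclidean sphere of radius `r` centred at the origin
of `ℝⁿ`, with respect to its Euclidean area element. -/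
def sphereIntegral (r : ℝ) (h : Euc n → ℝ) : ℝ :=
  r ^ (n - 1) * ∫ w : Metric.sphere (0 : Euc n) 1, h (r • (w : Euc n))
    ∂((volume : Measure (Euc n)).toSphere)

/-- The constant `c₂(n) = 1 / (2 (n-1) (n-2) (n-3) ω_{n-1})`. -/
def c2 (n : ℕ) : ℝ :=
  1 / (2 * ((n : ℝ) - 1) * ((n : ℝ) - 2) * ((n : ℝ) - 3) * sphereArea n)

/-- `c₂(n) ∫_{S_r} P^{ijkl} ∂_l g_{jk} ν_i dS`, where `ν = x / r`. -/
def massFlux (g : Euc n → Matrix (Fin n) (Fin n) ℝ) (r : ℝ) : ℝ :=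
  c2 n * sphereIntegral r fun x =>
    ∑ i, ∑ j, ∑ k, ∑ l, tensorP g i j k l x * pd l (fun y => g y j k) x * (r⁻¹ * x i)

/-- The second Gauss-Bonnet-Chern mass `m₂(g)`: the limit of `massFlux g r` as `r → ∞`. -/
def gbcMass (g : Euc n → Matrix (Fin n) (Fin n) ℝ) : ℝ :=
  limUnder atTop (massFlux g)

end Intrinsic

/-! ### Graphs of maps `f : ℝⁿ → ℝᵐ` -/

section Graph

variable {n m : ℕ}

/-- `f : ℝⁿ → ℝᵐ` is a smooth asymptotically flat map of order `τ`. -/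
structure IsAsymptoticallyFlatMap (f : Euc n → Euc m) (τ : ℝ) : Prop where
  smooth : ContDiff ℝ ∞ f
  order : ((n : ℝ) - 4) / 3 < τ
  decay : ∀ (i j k : Fin n) (α : Fin m),
    (fun x : Euc n => |pd i (fun y => f y α) x|
        + |pd j (pd i (fun y => f y α)) x| * ‖x‖
        + |pd k (pd j (pd i (fun y => f y α))) x| * ‖x‖ ^ 2)
      =O[Bornology.cobounded (Euc n)] fun x => ‖x‖ ^ (-τ / 2)

/-- The parametrization `x ↦ (x, f x)` of the graph `M`, identifying `M` with `ℝⁿ`. -/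
def graphMap (f : Euc n → Euc m) (x : Euc n) : Amb n m :=
  WithLp.toLp 2 (Sum.elim (fun i => x i) (fun α => f x α))

/-- The coordinate tangent vector `∂_i = (e_i, ∂_i f)` of the graph. -/
def tang (f : Euc n → Euc m) (i : Fin n) (x : Euc n) : Amb n m := pd i (graphMap f) x

/-- The normal vector `η^α = (-Df^α, e_α)` of the graph. -/
def normalVec (f : Euc n → Euc m) (α : Fin m) (x : Euc n) : Amb n m :=
  WithLp.toLp 2 (Sum.elim (fun i => -pd i (fun y => f y α) x) (Pi.single α 1))

/-- The induced metric `g_{ij} = ⟨∂_i, ∂_j⟩` on the graph. -/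
def graphMetric (f : Euc n → Euc m) (x : Euc n) : Matrix (Fin n) (Fin n) ℝ :=
  Matrix.of fun i j => inner ℝ (tang f i x) (tang f j x)

/-- The matrix `U_{αβ} = ⟨η^α, η^β⟩`. -/
def matU (f : Euc n → Euc m) (x : Euc n) : Matrix (Fin m) (Fin m) ℝ :=
  Matrix.of fun α β => inner ℝ (normalVec f α x) (normalVec f β x)

/-- The inverse matrix `U^{αβ}`. -/
def matUinv (f : Euc n → Euc m) (x : Euc n) : Matrix (Fin m) (Fin m) ℝ := (matU f x)⁻¹

/-- The shape operator `A^α`, `A^α ∂_i = -(D_{∂_i} η^α)^⊤`, as a matrix in the basis `∂_1, …, ∂_n`: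
the entry `(j, i)` is the coefficient of `∂_j` in `A^α ∂_i`. -/
def shape (f : Euc n → Euc m) (α : Fin m) (x : Euc n) : Matrix (Fin n) (Fin n) ℝ :=
  Matrix.of fun j i =>
    ∑ k, ginv (graphMetric f) x j k * (-inner ℝ (pd i (normalVec f α) x) (tang f k x))

/-- The normal curvature operator `R^⊥_{αβ} = A^β A^α - A^α A^β` on tangent vectors. -/
def normalCurv (f : Euc n → Euc m) (α β : Fin m) (x : Euc n) : Matrix (Fin n) (Fin n) ℝ :=
  shape f β x * shape f α x - shape f α x * shape f β x

/-- The Ricci operator `Rc`, `⟨Rc X, Y⟩ = Ric(X, Y)`, as a matrix in the basis `∂_1, …, ∂_n`. -/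
def ricOp (g : Euc n → Matrix (Fin n) (Fin n) ℝ) (x : Euc n) : Matrix (Fin n) (Fin n) ℝ :=
  Matrix.of fun i j => ∑ k, ginv g x i k * ric g k j x

/-- The operator `T^⊥_α = U^{μν} ((Tr A^μ) R^⊥_{να} + R^⊥_{αμ} A^ν + A^μ R^⊥_{αν})`. -/
def opT (f : Euc n → Euc m) (α : Fin m) (x : Euc n) : Matrix (Fin n) (Fin n) ℝ :=
  ∑ μ, ∑ ν, matUinv f x μ ν •
    ((shape f μ x).trace • normalCurv f ν α x + normalCurv f α μ x * shape f ν x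
      + shape f μ x * normalCurv f α ν x)

/-- The components `g^{jk} ∂_k f^α` of the gradient `∇f^α` of `f^α` on the graph. -/
def gradf (f : Euc n → Euc m) (α : Fin m) (x : Euc n) : Fin n → ℝ :=
  fun j => ∑ k, ginv (graphMetric f) x j k * pd k (fun y => f y α) x

/-- The inner product `⟨X, Y⟩ = g_{ij} X^i Y^j` of tangent vectors given by components. -/
def gInner (f : Euc n → Euc m) (x : Euc n) (X Y : Fin n → ℝ) : ℝ :=
  ∑ i, ∑ j, graphMetric f x i j * X i * Y j

/-- The normal curvature expression `L₂^⊥`. -/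
def L2perp (f : Euc n → Euc m) (x : Euc n) : ℝ :=
  2 * ((∑ μ, ∑ ν, ∑ α, ∑ γ, matUinv f x μ ν * gInner f x
          ((shape f μ x * (shape f ν x * normalCurv f α γ x + normalCurv f ν γ x * shape f α x
              - normalCurv f ν α x * shape f γ x)
            + (shape f α x * shape f μ x).trace • normalCurv f γ ν x) *ᵥ gradf f α x)
          (gradf f γ x))
    - (∑ α, ∑ γ, gInner f x
          (((2 : ℝ) • (ricOp (graphMetric f) x * normalCurv f α γ x) + opT f γ x * shape f α x
            + shape f α x * opT f γ x) *ᵥ gradf f α x)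
          (gradf f γ x))
    + (∑ α, ∑ γ, gInner f x (((shape f α x).trace • opT f γ x) *ᵥ gradf f α x) (gradf f γ x))
    + (1 / 2) * scal (graphMetric f) x *
        ∑ α, ∑ γ, gInner f x (normalCurv f α γ x *ᵥ gradf f α x) (gradf f γ x))

/-- The tangent space of the graph at `(x, f x)`. -/
def tangentSp (f : Euc n → Euc m) (x : Euc n) : Submodule ℝ (Amb n m) :=
  Submodule.span ℝ (Set.range fun i => tang f i x)

/-- A smooth section of the normal bundle of the graph. -/
def IsNormalField (f : Euc n → Euc m) (ξ : Euc n → Amb n m) : Prop :=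
  ContDiff ℝ ∞ ξ ∧ ∀ x, ξ x ∈ (tangentSp f x)ᗮ

/-- The normal connection `∇^⊥_{∂_i} ξ = (D_{∂_i} ξ)^⊥`. -/
def normalConn (f : Euc n → Euc m) (i : Fin n) (ξ : Euc n → Amb n m) (x : Euc n) : Amb n m :=
  (tangentSp f x)ᗮ.starProjection (pd i ξ x)

/-- The normal bundle of the graph is flat: the curvature of the normal connection vanishes
(the coordinate vector fields commute, so it suffices to commute the derivatives). -/
def FlatNormalBundle (f : Euc n → Euc m) : Prop :=
  ∀ ξ, IsNormalField f ξ → ∀ (i j : Fin n) (x : Euc n),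
    normalConn f i (normalConn f j ξ) x = normalConn f j (normalConn f i ξ) x

end Graph

end GBC

end

/-! The field `V^i = P^{ijkl} ∂_l g_{jk}` whose flux defines the mass has Euclidean divergence `½
(L₂ + L₂^⊥)`. The divergence theorem therefore turns `massFlux` at radius `r` into an integral over
the ball of radius `r`, and integrability of `L₂ + L₂^⊥` with respect to `dx` gives existence and
value of the limit. The weight `1/√G` is what converts `dμ_M` into `dx`.

The divergence is computed with the generalized Kronecker delta of order four. By the Gauss equation
(`riem_eq`), the curvature is quadratic in the second fundamental forms, and `P` is an alternating
contraction of two of them. Hence `V^i` is half the alternating contraction of `∇f^α ⊗ A^α ⊗ A^μ ⊗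
A^ν U^{μν}` with one lower index free (`fluxField_eq`). In its divergence (`alt_divergence`,
`sum_pd_fluxField`) third derivatives drop out by symmetry, and the terms with the covectors `⟨A^α
∇f^β, ∂_i⟩` cancel in pairs. The part `U^{αβ} A^β` of the derivative of `∇f^α` produces `½ L₂`
(`L2_eq`). What is left contains the antisymmetric part of `⟨A^α ∂_i, A^β ∂_j⟩`, that is, the normal
curvature. Expanding it into words in the shape operators and symmetrizing, with self-adjointness
reversing words, gives `½ L₂^⊥` (`perp_symmetrized`, `sum_divSummand_eq`, `L2perp_eq`).

For integrability, `L₂^⊥` is quartic in second derivatives and quadratic in gradients, hence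
`O(|x|^{-(3τ+4)})`, and `3τ+4 > n` is exactly the assumption on `τ`. For `L₂` it is assumed on
`μ_M`, and `1/√G` is bounded. If the normal bundle is flat, the Ricci equation makes all `R^⊥_{αβ}`
vanish (`normalCurv_eq_zero`), so `L₂^⊥ = 0` and the sign of the mass is read off the formula. -/

noncomputable section

namespace GBC

/-! ### Alternating contractions over four pairs of indices -/

section Alt

set_option linter.unusedSectionVars false

variable {ι : Type*} [Fintype ι] [DecidableEq ι]

/-- The generalized Kronecker delta with four upper and four lower indices. -/
def kdelta (K I : Fin 4 → ι) : ℝ :=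
  (Matrix.of fun s t : Fin 4 => if K s = I t then (1 : ℝ) else 0).det

/-- The complete contraction of `T` with the generalized Kronecker delta. -/
def alt (T : (Fin 4 → ι) → (Fin 4 → ι) → ℝ) : ℝ := ∑ K, ∑ I, kdelta K I * T K I

lemma kdelta_perm_right (σ : Equiv.Perm (Fin 4)) (K I : Fin 4 → ι) :
    kdelta K (I ∘ σ) = (Equiv.Perm.sign σ : ℝ) * kdelta K I :=
  Matrix.det_permute' σ (Matrix.of fun s t : Fin 4 => if K s = I t then (1 : ℝ) else 0)

lemma kdelta_perm_left (σ : Equiv.Perm (Fin 4)) (K I : Fin 4 → ι) :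
    kdelta (K ∘ σ) I = (Equiv.Perm.sign σ : ℝ) * kdelta K I :=
  Matrix.det_permute σ (Matrix.of fun s t : Fin 4 => if K s = I t then (1 : ℝ) else 0)

lemma sum_comp_perm (σ : Equiv.Perm (Fin 4)) (f : (Fin 4 → ι) → ℝ) :
    ∑ I, f (I ∘ σ) = ∑ I, f I :=
  Equiv.sum_comp (Equiv.arrowCongr σ.symm (Equiv.refl ι)) f

lemma alt_perm_right (σ : Equiv.Perm (Fin 4)) (T : (Fin 4 → ι) → (Fin 4 → ι) → ℝ) :
    alt (fun K I => T K (I ∘ σ)) = (Equiv.Perm.sign σ : ℝ) * alt T := by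
  have hs : ((Equiv.Perm.sign σ : ℤ) : ℝ) * ((Equiv.Perm.sign σ : ℤ) : ℝ) = 1 := by
    rcases Int.units_eq_one_or (Equiv.Perm.sign σ) with h | h <;> simp [h]
  unfold alt
  rw [Finset.mul_sum]
  refine Finset.sum_congr rfl fun K _ => ?_
  rw [← sum_comp_perm σ (fun I => kdelta K I * T K I), Finset.mul_sum]
  refine Finset.sum_congr rfl fun I _ => ?_
  rw [kdelta_perm_right, ← mul_assoc, ← mul_assoc, hs, one_mul]

lemma alt_perm_left (σ : Equiv.Perm (Fin 4)) (T : (Fin 4 → ι) → (Fin 4 → ι) → ℝ) :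
    alt (fun K I => T (K ∘ σ) I) = (Equiv.Perm.sign σ : ℝ) * alt T := by
  have hs : ((Equiv.Perm.sign σ : ℤ) : ℝ) * ((Equiv.Perm.sign σ : ℤ) : ℝ) = 1 := by
    rcases Int.units_eq_one_or (Equiv.Perm.sign σ) with h | h <;> simp [h]
  unfold alt
  rw [← sum_comp_perm σ (fun K => ∑ I, kdelta K I * T K I), Finset.mul_sum]
  refine Finset.sum_congr rfl fun K _ => ?_
  rw [Finset.mul_sum]
  refine Finset.sum_congr rfl fun I _ => ?_
  rw [kdelta_perm_left, ← mul_assoc, ← mul_assoc, hs, one_mul]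

lemma alt_swap_right {s t : Fin 4} (h : s ≠ t) (T : (Fin 4 → ι) → (Fin 4 → ι) → ℝ) :
    alt (fun K I => T K (I ∘ Equiv.swap s t)) = - alt T := by
  rw [alt_perm_right, Equiv.Perm.sign_swap h]; simp

lemma alt_swap (s t : Fin 4) (T : (Fin 4 → ι) → (Fin 4 → ι) → ℝ) :
    alt (fun K I => T (K ∘ Equiv.swap s t) (I ∘ Equiv.swap s t)) = alt T := by
  rw [alt_perm_right (Equiv.swap s t) (fun K I => T (K ∘ Equiv.swap s t) I), alt_perm_left,
    ← mul_assoc]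
  rcases Int.units_eq_one_or (Equiv.Perm.sign (Equiv.swap s t)) with h | h <;> simp [h]

lemma alt_add (T T' : (Fin 4 → ι) → (Fin 4 → ι) → ℝ) :
    alt (fun K I => T K I + T' K I) = alt T + alt T' := by
  simp [alt, mul_add, Finset.sum_add_distrib]

lemma alt_sub (T T' : (Fin 4 → ι) → (Fin 4 → ι) → ℝ) :
    alt (fun K I => T K I - T' K I) = alt T - alt T' := by
  simp [alt, mul_sub, Finset.sum_sub_distrib]

lemma alt_const_mul (c : ℝ) (T : (Fin 4 → ι) → (Fin 4 → ι) → ℝ) :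
    alt (fun K I => c * T K I) = c * alt T := by
  simp only [alt, Finset.mul_sum]
  exact Finset.sum_congr rfl fun K _ => Finset.sum_congr rfl fun I _ => by ring

lemma alt_sum {κ : Type*} (s : Finset κ) (T : κ → (Fin 4 → ι) → (Fin 4 → ι) → ℝ) :
    alt (fun K I => ∑ a ∈ s, T a K I) = ∑ a ∈ s, alt (T a) := by
  simp only [alt, Finset.mul_sum]
  rw [Finset.sum_comm]
  rw [Finset.sum_comm]
  conv_rhs => rw [Finset.sum_comm]
  refine Finset.sum_congr rfl fun K _ => ?_
  rw [Finset.sum_comm]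

lemma sum_fin_four (f : (Fin 4 → ι) → ℝ) :
    ∑ I, f I = ∑ i, ∑ j, ∑ a, ∑ b, f ![i, j, a, b] := by
  let e : ι × ι × ι × ι ≃ (Fin 4 → ι) :=
    { toFun := fun p => ![p.1, p.2.1, p.2.2.1, p.2.2.2]
      invFun := fun I => (I 0, I 1, I 2, I 3)
      left_inv := fun p => rfl
      right_inv := fun I => by ext k; fin_cases k <;> rfl }
  rw [← e.sum_comp]
  simp only [Fintype.sum_prod_type]
  rfl

/-- The contraction of the first `k` index pairs, weighted by `S` in the first two lower
indices, here for `k = 2`. -/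
def alt2 (S X A : Matrix ι ι ℝ) : ℝ := ∑ i, ∑ j, S i j * (X i i * A j j - X j i * A i j)

/-- See `alt2`. -/
def alt3 (S X A M : Matrix ι ι ℝ) : ℝ :=
  M.trace * alt2 S X A - alt2 S (M * X) A - alt2 S X (M * A)

/-- See `alt2`. -/
def alt4 (S X A M N : Matrix ι ι ℝ) : ℝ :=
  N.trace * alt3 S X A M - alt3 S (N * X) A M - alt3 S X (N * A) M - alt3 S X A (N * M)

/-- Writing the delta as a signed sum over permutations `σ` leaves only `K = I ∘ σ`, and the
remaining sum over `σ` is the Leibniz formula. -/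
lemma alt_eq_sum_det (P : Fin 4 → Matrix ι ι ℝ) (S : (Fin 4 → ι) → ℝ) :
    alt (fun K I => S I * ∏ t, P t (K t) (I t)) =
      ∑ I, S I * (Matrix.of fun s t => P t (I s) (I t)).det := by
  unfold alt
  rw [Finset.sum_comm]
  refine Finset.sum_congr rfl fun I _ => ?_
  have hk : ∀ K : Fin 4 → ι, kdelta K I =
      ∑ σ : Equiv.Perm (Fin 4), (Equiv.Perm.sign σ : ℝ) * if K = I ∘ σ then 1 else 0 := by
    intro K
    rw [kdelta, ← Matrix.det_transpose, Matrix.det_apply']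
    refine Finset.sum_congr rfl fun σ _ => ?_
    congr 1
    simp only [Matrix.transpose_apply, Matrix.of_apply]
    rw [Fintype.prod_ite_zero]
    simp [funext_iff]
  simp only [hk, Matrix.det_apply', Finset.sum_mul, Finset.mul_sum]
  rw [Finset.sum_comm]
  refine Finset.sum_congr rfl fun σ _ => ?_
  rw [Finset.sum_eq_single (I ∘ σ)]
  · simp only [Matrix.of_apply, Function.comp, if_true]
    ring
  · intro K _ hK
    simp [hK]
  · simp

/-- The determinant of the `3 × 3` matrix with columns `p`, `q`, `r`, evaluated at `i`, `j`, `a`. -/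
def det3 (p q r : ι → ℝ) (i j a : ι) : ℝ :=
  p i * q j * r a - p i * q a * r j - p j * q i * r a + p j * q a * r i
    + p a * q i * r j - p a * q j * r i

/-- Summation over the last index `a` either closes up a trace of `M` or composes `M` with one of
the other matrices. This is the recursion defining `alt3`; `sum_det_eq_alt4` is the same argument
with one more index pair. -/
lemma alt3_eq (S X A M : Matrix ι ι ℝ) :
    ∑ i, ∑ j, S i j * ∑ a, det3 (X · i) (A · j) (M · a) i j a = alt3 S X A M := by
  unfold alt3 alt2
  simp only [Finset.mul_sum, ← Finset.sum_sub_distrib]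
  refine Finset.sum_congr rfl fun i _ => Finset.sum_congr rfl fun j _ => ?_
  simp only [Matrix.mul_apply, Matrix.trace, Matrix.diag, Finset.sum_mul, Finset.mul_sum,
    ← Finset.sum_sub_distrib]
  refine Finset.sum_congr rfl fun a _ => ?_
  simp only [det3]
  ring

lemma sum_det_eq_alt4 (S X A M N : Matrix ι ι ℝ) :
    ∑ i, ∑ j, ∑ a, ∑ b, S i j *
      (X b i * (- det3 (N · b) (A · j) (M · a) i j a)
        + A b j * (- det3 (X · i) (N · b) (M · a) i j a)
        + M b a * (- det3 (X · i) (A · j) (N · b) i j a)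
        + N b b * det3 (X · i) (A · j) (M · a) i j a) = alt4 S X A M N := by
  unfold alt4
  simp only [← alt3_eq, Finset.mul_sum, ← Finset.sum_sub_distrib]
  refine Finset.sum_congr rfl fun i _ => Finset.sum_congr rfl fun j _ =>
    Finset.sum_congr rfl fun a _ => ?_
  simp only [det3, Matrix.mul_apply, Matrix.trace, Matrix.diag, Finset.sum_mul, Finset.mul_sum,
    ← Finset.sum_sub_distrib, ← Finset.sum_add_distrib]
  refine Finset.sum_congr rfl fun b _ => ?_
  ring

/-- Laplace expansion along the last row. In each minor the last column is written in the slot of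
the deleted one, so the three off-diagonal terms all carry a minus sign, as in the recursion for
`alt4`. -/
lemma det_fin_four_last (D : Matrix (Fin 4) (Fin 4) ℝ) : D.det =
    D 3 0 * -(D 0 3 * D 1 1 * D 2 2 - D 0 3 * D 2 1 * D 1 2 - D 1 3 * D 0 1 * D 2 2
        + D 1 3 * D 2 1 * D 0 2 + D 2 3 * D 0 1 * D 1 2 - D 2 3 * D 1 1 * D 0 2)
      + D 3 1 * -(D 0 0 * D 1 3 * D 2 2 - D 0 0 * D 2 3 * D 1 2 - D 1 0 * D 0 3 * D 2 2
        + D 1 0 * D 2 3 * D 0 2 + D 2 0 * D 0 3 * D 1 2 - D 2 0 * D 1 3 * D 0 2)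
      + D 3 2 * -(D 0 0 * D 1 1 * D 2 3 - D 0 0 * D 2 1 * D 1 3 - D 1 0 * D 0 1 * D 2 3
        + D 1 0 * D 2 1 * D 0 3 + D 2 0 * D 0 1 * D 1 3 - D 2 0 * D 1 1 * D 0 3)
      + D 3 3 * (D 0 0 * D 1 1 * D 2 2 - D 0 0 * D 2 1 * D 1 2 - D 1 0 * D 0 1 * D 2 2
        + D 1 0 * D 2 1 * D 0 2 + D 2 0 * D 0 1 * D 1 2 - D 2 0 * D 1 1 * D 0 2) := by
  rw [Matrix.det_succ_row _ 3]
  simp only [Fin.sum_univ_four, Matrix.det_fin_three, Matrix.submatrix_apply]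
  have e00 : (0 : Fin 4).succAbove (0 : Fin 3) = 1 := rfl
  have e01 : (0 : Fin 4).succAbove (1 : Fin 3) = 2 := rfl
  have e02 : (0 : Fin 4).succAbove (2 : Fin 3) = 3 := rfl
  have e10 : (1 : Fin 4).succAbove (0 : Fin 3) = 0 := rfl
  have e11 : (1 : Fin 4).succAbove (1 : Fin 3) = 2 := rfl
  have e12 : (1 : Fin 4).succAbove (2 : Fin 3) = 3 := rfl
  have e20 : (2 : Fin 4).succAbove (0 : Fin 3) = 0 := rfl
  have e21 : (2 : Fin 4).succAbove (1 : Fin 3) = 1 := rfl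
  have e22 : (2 : Fin 4).succAbove (2 : Fin 3) = 3 := rfl
  have e30 : (3 : Fin 4).succAbove (0 : Fin 3) = 0 := rfl
  have e31 : (3 : Fin 4).succAbove (1 : Fin 3) = 1 := rfl
  have e32 : (3 : Fin 4).succAbove (2 : Fin 3) = 2 := rfl
  have v0 : ((0 : Fin 4) : ℕ) = 0 := rfl
  have v1 : ((1 : Fin 4) : ℕ) = 1 := rfl
  have v2 : ((2 : Fin 4) : ℕ) = 2 := rfl
  have v3 : ((3 : Fin 4) : ℕ) = 3 := rfl
  rw [e00, e01, e02, e10, e11, e12, e20, e21, e22, e30, e31, e32, v0, v1, v2, v3]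
  ring

/-- The bridge between tensor contractions, which are convenient to differentiate, and polynomials
in matrices and traces, which can be compared by `ring`. -/
lemma alt_eq_alt4 (S X A M N : Matrix ι ι ℝ) :
    alt (fun K I => S (I 0) (I 1) * (X (K 0) (I 0) * A (K 1) (I 1) * M (K 2) (I 2)
      * N (K 3) (I 3))) = alt4 S X A M N := by
  have h := alt_eq_sum_det ![X, A, M, N] (fun I : Fin 4 → ι => S (I 0) (I 1))
  simp only [Fin.prod_univ_four] at h
  refine h.trans ?_
  rw [sum_fin_four, ← sum_det_eq_alt4]
  refine Finset.sum_congr rfl fun i _ => Finset.sum_congr rfl fun j _ =>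
    Finset.sum_congr rfl fun a _ => Finset.sum_congr rfl fun b _ => ?_
  rw [det_fin_four_last]
  simp only [Matrix.of_apply, Matrix.cons_val, det3]

end Alt

/-! ### The tensor `P` as an alternating contraction -/

section Contraction

set_option linter.unusedSectionVars false

variable {ι κ : Type*} [Fintype ι] [DecidableEq ι] [Fintype κ]

/-- The unweighted contraction `alt4` with all weights equal to one. -/
abbrev ones : Matrix ι ι ℝ := Matrix.of fun _ _ => 1

lemma alt2_ones (X A : Matrix ι ι ℝ) : alt2 ones X A = X.trace * A.trace - (X * A).trace := by
  simp only [alt2, ones, Matrix.of_apply, one_mul, Finset.sum_sub_distrib, Matrix.trace,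
    Matrix.diag, Matrix.mul_apply, Finset.sum_mul_sum]
  congr 1
  rw [Finset.sum_comm]

/-- With constant weight the contraction is a signed sum over the 24 permutations, each cycle
contributing a trace. The terms are sorted by cycle type: 1 + 6 + 3 + 8 + 6. -/
lemma alt4_ones (X A M N : Matrix ι ι ℝ) : alt4 ones X A M N =
    X.trace * A.trace * M.trace * N.trace
      - (X * A).trace * M.trace * N.trace - (X * M).trace * A.trace * N.trace
      - (X * N).trace * A.trace * M.trace - (A * M).trace * X.trace * N.trace
      - (A * N).trace * X.trace * M.trace - (M * N).trace * X.trace * A.trace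
      + (X * A).trace * (M * N).trace + (X * M).trace * (A * N).trace
      + (X * N).trace * (A * M).trace
      + (X * A * M).trace * N.trace + (X * M * A).trace * N.trace
      + (X * A * N).trace * M.trace + (X * N * A).trace * M.trace
      + (X * M * N).trace * A.trace + (X * N * M).trace * A.trace
      + (A * M * N).trace * X.trace + (A * N * M).trace * X.trace
      - (X * A * M * N).trace - (X * A * N * M).trace - (X * M * A * N).trace
      - (X * M * N * A).trace - (X * N * A * M).trace - (X * N * M * A).trace := by
  simp only [alt4, alt3, alt2_ones, ← Matrix.mul_assoc]
  have c2 : ∀ P Q : Matrix ι ι ℝ, (P * Q).trace = (Q * P).trace := Matrix.trace_mul_comm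
  have c3 : ∀ P Q R : Matrix ι ι ℝ, (P * Q * R).trace = (Q * R * P).trace := fun P Q R => by
    rw [Matrix.mul_assoc, c2]
  have c4 : ∀ P Q R S : Matrix ι ι ℝ, (P * Q * R * S).trace = (Q * R * S * P).trace :=
    fun P Q R S => by rw [Matrix.mul_assoc, Matrix.mul_assoc, c2, ← Matrix.mul_assoc]
  -- Cyclic rotations bring equal traces to one common form, so that `ring` can treat them as atoms.
  rw [c2 M X, c2 M A, c2 N X, c2 N A, c2 N M, c3 M X A, c3 N X A, c3 M N X, c3 N X M, c3 M N A,
    c3 X N A, c3 N M X, c3 N M A, c4 M N X A, c4 N X M A, c4 N M X A, c4 M X N A, c3 N A M,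
    c4 N X A M]
  rw [c3 M A N, c3 M X N, c4 M X A N]
  ring

lemma contract_direct (Y Z C X : Matrix ι ι ℝ) :
    ∑ i, ∑ j, ∑ k, ∑ l, Y i k * Z j l * (C j l * X k i) =
      (Y * X).trace * (Z * Cᵀ).trace := by
  simp only [Matrix.trace, Matrix.diag, Matrix.mul_apply, Finset.sum_mul_sum,
    Matrix.transpose_apply]
  refine Finset.sum_congr rfl fun i _ => Finset.sum_congr rfl fun j _ =>
    Finset.sum_congr rfl fun k _ => Finset.sum_congr rfl fun l _ => by ring

lemma contract_cross (Y Z C X : Matrix ι ι ℝ) :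
    ∑ i, ∑ j, ∑ k, ∑ l, Y i l * Z j k * (C j l * X k i) =
      (X * Y * Cᵀ * Z).trace := by
  have : X * Y * Cᵀ * Z = X * (Y * Cᵀ * Z) := by simp only [Matrix.mul_assoc]
  rw [this, Matrix.trace_mul_comm]
  simp only [Matrix.trace, Matrix.diag, Matrix.mul_apply, Finset.sum_mul, Matrix.transpose_apply]
  refine Finset.sum_congr rfl fun i _ => ?_
  rw [Finset.sum_comm]
  refine Finset.sum_congr rfl fun k _ => ?_
  refine Finset.sum_congr rfl fun j _ => Finset.sum_congr rfl fun l _ => by ring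

/-- The raised Ricci tensor of a graph in terms of second fundamental forms. -/
def ricRaised (H : Matrix ι ι ℝ) (B : κ → Matrix ι ι ℝ) (V : Matrix κ κ ℝ) : Matrix ι ι ℝ :=
  ∑ μ, ∑ ν, V μ ν • ((H * B μ).trace • (H * B ν * H) - H * B μ * H * B ν * H)

/-- The scalar curvature of a graph in terms of second fundamental forms. -/
def scalAlg (H : Matrix ι ι ℝ) (B : κ → Matrix ι ι ℝ) (V : Matrix κ κ ℝ) : ℝ :=
  ∑ μ, ∑ ν, V μ ν * ((H * B μ).trace * (H * B ν).trace - (H * B μ * (H * B ν)).trace)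

/-- The tensor `P` of a graph in terms of second fundamental forms. -/
def tensorPAlg (H : Matrix ι ι ℝ) (B : κ → Matrix ι ι ℝ) (V : Matrix κ κ ℝ) (i j k l : ι) : ℝ :=
  ∑ μ, ∑ ν, V μ ν * ((H * B μ * H) i k * (H * B ν * H) j l
      - (H * B μ * H) i l * (H * B ν * H) j k)
    + ricRaised H B V j k * H i l - ricRaised H B V j l * H i k
    - ricRaised H B V i k * H j l + ricRaised H B V i l * H j k
    + (1 / 2) * scalAlg H B V * (H i k * H j l - H i l * H j k)

/-- The contribution of one pair of normal directions to `tensorPAlg`. -/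
def tensorPSummand (H M N : Matrix ι ι ℝ) (i j k l : ι) : ℝ :=
  (H * M * H) i k * (H * N * H) j l - (H * M * H) i l * (H * N * H) j k
    + H i l * ((H * M).trace • (H * N * H) - H * M * H * N * H) j k
    - H i k * ((H * M).trace • (H * N * H) - H * M * H * N * H) j l
    - ((H * M).trace • (H * N * H) - H * M * H * N * H) i k * H j l
    + ((H * M).trace • (H * N * H) - H * M * H * N * H) i l * H j k
    + (1 / 2) * ((H * M).trace * (H * N).trace - (H * M * (H * N)).trace)
      * (H i k * H j l - H i l * H j k)

lemma tensorPAlg_eq_sum (H : Matrix ι ι ℝ) (B : κ → Matrix ι ι ℝ) (V : Matrix κ κ ℝ)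
    (i j k l : ι) :
    tensorPAlg H B V i j k l = ∑ μ, ∑ ν, V μ ν * tensorPSummand H (B μ) (B ν) i j k l := by
  simp only [tensorPAlg, ricRaised, scalAlg, Matrix.sum_apply, Matrix.smul_apply, smul_eq_mul,
    Finset.sum_mul, Finset.mul_sum, ← Finset.sum_add_distrib, ← Finset.sum_sub_distrib,
    tensorPSummand]
  refine Finset.sum_congr rfl fun μ _ => Finset.sum_congr rfl fun ν _ => by ring

lemma tensorPAlg_swap_right (H : Matrix ι ι ℝ) (B : κ → Matrix ι ι ℝ) (V : Matrix κ κ ℝ)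
    (i j k l : ι) : tensorPAlg H B V i j l k = - tensorPAlg H B V i j k l := by
  have h : ∑ μ, ∑ ν, V μ ν * ((H * B μ * H) i l * (H * B ν * H) j k
      - (H * B μ * H) i k * (H * B ν * H) j l) = - ∑ μ, ∑ ν, V μ ν * ((H * B μ * H) i k *
        (H * B ν * H) j l - (H * B μ * H) i l * (H * B ν * H) j k) := by
    simp only [← Finset.sum_neg_distrib]
    refine Finset.sum_congr rfl fun μ _ => Finset.sum_congr rfl fun ν _ => by ring
  unfold tensorPAlg
  rw [h]
  ring

lemma sum_tensorPSummand (H M N C X : Matrix ι ι ℝ) (hC : Cᵀ = C) :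
    ∑ i, ∑ j, ∑ k, ∑ l, tensorPSummand H M N i j k l * (C j l * X k i) =
      (H * X * (H * M)).trace * (H * C * (H * N)).trace
      - (H * X * (H * M) * (H * C) * (H * N)).trace
      + (H * M).trace * (H * X * (H * C) * (H * N)).trace
      - (H * X * (H * C) * (H * M) * (H * N)).trace
      - (H * X).trace * ((H * M).trace * (H * C * (H * N)).trace
          - (H * C * (H * M) * (H * N)).trace)
      - (H * C).trace * ((H * M).trace * (H * X * (H * N)).trace
          - (H * X * (H * M) * (H * N)).trace)
      + (H * M).trace * (H * X * (H * N) * (H * C)).trace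
      - (H * X * (H * M) * (H * N) * (H * C)).trace
      + (1 / 2) * ((H * M).trace * (H * N).trace - (H * M * (H * N)).trace)
        * ((H * X).trace * (H * C).trace - (H * X * (H * C)).trace) := by
  set W := (H * M).trace • (H * N * H) - H * M * H * N * H with hW
  set s := (1 / 2) * ((H * M).trace * (H * N).trace - (H * M * (H * N)).trace) with hs
  have e : ∀ i j k l, tensorPSummand H M N i j k l * (C j l * X k i) =
      (H * M * H) i k * (H * N * H) j l * (C j l * X k i)
      - (H * M * H) i l * (H * N * H) j k * (C j l * X k i)
      + H i l * W j k * (C j l * X k i) - H i k * W j l * (C j l * X k i)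
      - W i k * H j l * (C j l * X k i) + W i l * H j k * (C j l * X k i)
      + s * (H i k * H j l * (C j l * X k i)) - s * (H i l * H j k * (C j l * X k i)) := by
    intro i j k l
    simp only [tensorPSummand, ← hW, ← hs]
    ring
  simp only [e, Finset.sum_add_distrib, Finset.sum_sub_distrib, contract_direct, contract_cross,
    ← Finset.mul_sum, hC]
  have c2 : ∀ P Q : Matrix ι ι ℝ, (P * Q).trace = (Q * P).trace := Matrix.trace_mul_comm
  simp only [hW, Matrix.mul_sub, Matrix.sub_mul, Matrix.trace_sub, Matrix.mul_smul,
    Matrix.smul_mul, Matrix.trace_smul, smul_eq_mul, ← Matrix.mul_assoc]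
  have p2 : ∀ P Q : Matrix ι ι ℝ, (H * P * H * Q).trace = (H * Q * H * P).trace := fun P Q => by
    rw [Matrix.mul_assoc, c2, ← Matrix.mul_assoc]
  have p3 : ∀ P Q R : Matrix ι ι ℝ,
      (H * P * H * Q * H * R).trace = (H * R * H * P * H * Q).trace := fun P Q R => by
    rw [Matrix.mul_assoc, c2]
    simp only [← Matrix.mul_assoc]
  have q2 : ∀ P : Matrix ι ι ℝ, (X * H * P * H).trace = (H * X * H * P).trace := fun P => by
    rw [c2]
    simp only [← Matrix.mul_assoc]
  have q3 : ∀ P Q : Matrix ι ι ℝ, (X * H * P * H * Q * H).trace = (H * X * H * P * H * Q).trace :=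
    fun P Q => by
      rw [c2]
      simp only [← Matrix.mul_assoc]
  have q4 : ∀ P Q R : Matrix ι ι ℝ,
      (X * H * P * H * Q * H * R * H).trace = (H * X * H * P * H * Q * H * R).trace :=
    fun P Q R => by
      rw [c2]
      simp only [← Matrix.mul_assoc]
  rw [p2 M X, p2 N C, p2 N X, p3 M N X, p3 M N C, q2, q3, q3, q4, q4, q4]
  ring

/-- A symmetric weight sees only the symmetric part in `(μ, ν)`. It is needed because the summands
compared below are not equal pair by pair. -/
lemma sum_symm_congr {V : Matrix κ κ ℝ} (hV : Vᵀ = V) {p q : κ → κ → ℝ}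
    (h : ∀ μ ν, p μ ν + p ν μ = q μ ν + q ν μ) :
    ∑ μ, ∑ ν, V μ ν * p μ ν = ∑ μ, ∑ ν, V μ ν * q μ ν := by
  have hs : ∀ r : κ → κ → ℝ, 2 * ∑ μ, ∑ ν, V μ ν * r μ ν =
      ∑ μ, ∑ ν, V μ ν * (r μ ν + r ν μ) := by
    intro r
    have : ∑ μ, ∑ ν, V μ ν * r μ ν = ∑ μ, ∑ ν, V μ ν * r ν μ := by
      rw [Finset.sum_comm]
      refine Finset.sum_congr rfl fun μ _ => Finset.sum_congr rfl fun ν _ => ?_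
      rw [← Matrix.transpose_apply V, hV]
    rw [two_mul]
    nth_rewrite 2 [this]
    simp only [← Finset.sum_add_distrib, mul_add]
  have := hs p
  simp only [h, ← hs q] at this
  linarith

/-- Up to a constant, `P` is the order-four delta contracted with one curvature tensor, and the
Gauss equation splits that curvature into two second fundamental forms. Filling the two free slots
with `X` and `C` gives an alternating contraction of four matrices. The proof compares both sides as
polynomials in traces. -/
lemma sum_tensorPAlg (H : Matrix ι ι ℝ) (B : κ → Matrix ι ι ℝ) (V : Matrix κ κ ℝ)
    (hV : Vᵀ = V) (C X : Matrix ι ι ℝ) (hC : Cᵀ = C) :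
    ∑ i, ∑ j, ∑ k, ∑ l, tensorPAlg H B V i j k l * (C j l * X k i) =
      ∑ μ, ∑ ν, V μ ν * ((1 / 2) * alt4 ones (H * X) (H * C) (H * B μ) (H * B ν)) := by
  have e : ∑ i, ∑ j, ∑ k, ∑ l, tensorPAlg H B V i j k l * (C j l * X k i) =
      ∑ μ, ∑ ν, V μ ν * ∑ i, ∑ j, ∑ k, ∑ l,
        tensorPSummand H (B μ) (B ν) i j k l * (C j l * X k i) := by
    simp only [tensorPAlg_eq_sum, Finset.sum_mul, Finset.mul_sum]
    simp only [Finset.sum_comm (s := (Finset.univ : Finset ι)) (t := (Finset.univ : Finset κ))]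
    refine Finset.sum_congr rfl fun μ _ => Finset.sum_congr rfl fun ν _ =>
      Finset.sum_congr rfl fun i _ => Finset.sum_congr rfl fun j _ =>
      Finset.sum_congr rfl fun k _ => Finset.sum_congr rfl fun l _ => by ring
  rw [e]
  refine sum_symm_congr hV fun μ ν => ?_
  rw [sum_tensorPSummand _ _ _ _ _ hC, sum_tensorPSummand _ _ _ _ _ hC, alt4_ones, alt4_ones,
    Matrix.trace_mul_comm (H * B ν) (H * B μ)]
  ring

end Contraction

/-! ### Normal curvature terms: two forms and their equality after symmetrization -/

section Perp

set_option linter.unusedSectionVars false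

variable {ι κ : Type*} [Fintype ι] [DecidableEq ι] [Fintype κ]

/-- The expansion of `alt4` for two rank one arguments, `k X Y` standing for the value of `alt2`
on the vectors moved by `X` and by the adjoint of `Y`. -/
def rankOneExpansion (k : Matrix ι ι ℝ → Matrix ι ι ℝ → ℝ) (M N : Matrix ι ι ℝ) : ℝ :=
  N.trace * (M.trace * k 1 1 - k M 1 - k 1 M) - (M.trace * k N 1 - k (M * N) 1 - k N M)
    - (M.trace * k 1 N - k M N - k 1 (N * M))
    - ((N * M).trace * k 1 1 - k (N * M) 1 - k 1 (M * N))

/-- The contribution of `A = A^α`, `C = A^γ`, `M = A^μ`, `N = A^ν` to the divergence of the flux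
field. -/
def divSummand (p : Matrix ι ι ℝ → ℝ) (A C M N : Matrix ι ι ℝ) : ℝ :=
  -(1 / 2) * (rankOneExpansion (fun X Y => p (Y * (A * C - C * A) * X)) M N
    + 2 * rankOneExpansion (fun X Y => p (Y * (M * C - C * M) * X)) A N)

/-- The summand of the operator `T^⊥_γ`. -/
def opTSummand (C M N : Matrix ι ι ℝ) : Matrix ι ι ℝ :=
  M.trace • (C * N - N * C) + (M * C - C * M) * N + M * (N * C - C * N)

/-- The contribution of `A = A^α`, `C = A^γ`, `M = A^μ`, `N = A^ν` to half of `L₂^⊥`. -/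
def perpSummand (p : Matrix ι ι ℝ → ℝ) (A C M N : Matrix ι ι ℝ) : ℝ :=
  p (M * (N * (C * A - A * C) + (C * N - N * C) * A - (A * N - N * A) * C)
      + (A * M).trace • (N * C - C * N))
    - p ((2 : ℝ) • ((M.trace • N - M * N) * (C * A - A * C)) + opTSummand C M N * A
      + A * opTSummand C M N)
    + p (A.trace • opTSummand C M N)
    + (1 / 2) * (M.trace * N.trace - (M * N).trace) * p (C * A - A * C)

/-- The comparison is made after summing over both orders of `M`, `N` and over the exchange of `(p,
A, C)` with `(q, C, A)`. The model is `p W = ⟨W u, v⟩` and `q W = ⟨W v, u⟩`: for self-adjoint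
letters, `q` is `p` on the reversed word. Once every word is evaluated by `p`, a finite linear
identity remains. -/
lemma perp_symmetrized (p q : Matrix ι ι ℝ →ₗ[ℝ] ℝ) (s : Matrix ι ι ℝ → Prop)
    (h2 : ∀ X Y, s X → s Y → q (X * Y) = p (Y * X))
    (h3 : ∀ X Y Z, s X → s Y → s Z → q (X * Y * Z) = p (Z * Y * X))
    (h4 : ∀ X Y Z T, s X → s Y → s Z → s T → q (X * Y * Z * T) = p (T * Z * Y * X))
    (A C M N : Matrix ι ι ℝ) (hA : s A) (hC : s C) (hM : s M) (hN : s N) :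
    divSummand p A C M N + divSummand p A C N M + divSummand q C A M N + divSummand q C A N M =
    perpSummand p A C M N + perpSummand p A C N M + perpSummand q C A M N
      + perpSummand q C A N M := by
  simp only [divSummand, perpSummand, rankOneExpansion, opTSummand, Matrix.one_mul, Matrix.mul_one,
    Matrix.mul_add, Matrix.mul_sub, Matrix.add_mul, Matrix.sub_mul, smul_add, smul_sub,
    Matrix.smul_mul, Matrix.mul_smul, map_add, map_sub, map_smul, smul_eq_mul, ← Matrix.mul_assoc]
  simp only [h2, h3, h4, hA, hC, hM, hN]
  rw [Matrix.trace_mul_comm N M, Matrix.trace_mul_comm N A, Matrix.trace_mul_comm N C,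
    Matrix.trace_mul_comm M A, Matrix.trace_mul_comm M C]
  ring

/-- The linear form `W ↦ ⟨W u, v⟩` on matrices, for the inner product given by `g`. -/
def pairing (g : Matrix ι ι ℝ) (u v : ι → ℝ) : Matrix ι ι ℝ →ₗ[ℝ] ℝ where
  toFun W := ∑ i, ∑ j, g i j * (W *ᵥ u) i * v j
  map_add' W W' := by
    simp only [Matrix.add_mulVec, Pi.add_apply, mul_add, add_mul, Finset.sum_add_distrib]
  map_smul' c W := by
    simp only [Matrix.smul_mulVec, Pi.smul_apply, smul_eq_mul, RingHom.id_apply, Finset.mul_sum]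
    refine Finset.sum_congr rfl fun i _ => Finset.sum_congr rfl fun j _ => by ring

lemma pairing_apply (g : Matrix ι ι ℝ) (u v : ι → ℝ) (W : Matrix ι ι ℝ) :
    pairing g u v W = ∑ i, ∑ j, g i j * (W *ᵥ u) i * v j := rfl

lemma pairing_eq_dotProduct {g : Matrix ι ι ℝ} (hg : gᵀ = g) (u v : ι → ℝ) (W : Matrix ι ι ℝ) :
    pairing g u v W = v ⬝ᵥ ((g * W) *ᵥ u) := by
  rw [← Matrix.mulVec_mulVec, pairing_apply, Finset.sum_comm]
  simp only [dotProduct, Matrix.mulVec, Finset.mul_sum]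
  refine Finset.sum_congr rfl fun j _ => Finset.sum_congr rfl fun i _ => ?_
  rw [← Matrix.transpose_apply g, hg]
  simp only [Finset.sum_mul]
  refine Finset.sum_congr rfl fun k _ => by ring

/-- For symmetric `g`, the hypothesis `h` says that `W'` is the `g`-adjoint of `W`. -/
lemma pairing_adjoint {g : Matrix ι ι ℝ} (hg : gᵀ = g) (u v : ι → ℝ) {W W' : Matrix ι ι ℝ}
    (h : (g * W)ᵀ = g * W') : pairing g v u W = pairing g u v W' := by
  rw [pairing_eq_dotProduct hg, pairing_eq_dotProduct hg, ← h, Matrix.mulVec_transpose,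
    Matrix.dotProduct_mulVec, dotProduct_comm]

lemma sum_divSummand_eq (g : Matrix ι ι ℝ) (hg : gᵀ = g) (A : κ → Matrix ι ι ℝ)
    (hA : ∀ μ, (A μ)ᵀ * g = g * A μ) (V : Matrix κ κ ℝ) (hV : Vᵀ = V) (w : κ → ι → ℝ) :
    ∑ μ, ∑ ν, V μ ν * ∑ α, ∑ γ, divSummand (pairing g (w α) (w γ)) (A α) (A γ) (A μ) (A ν) =
    ∑ μ, ∑ ν, V μ ν * ∑ α, ∑ γ, perpSummand (pairing g (w α) (w γ)) (A α) (A γ) (A μ) (A ν) := by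
  refine sum_symm_congr hV fun μ ν => ?_
  have key : ∀ α γ, _ := fun α γ => perp_symmetrized (pairing g (w α) (w γ))
    (pairing g (w γ) (w α)) (fun X => Xᵀ * g = g * X)
    (fun X Y hX hY => pairing_adjoint hg _ _ (by
      simp only [Matrix.transpose_mul, hg]
      rw [Matrix.mul_assoc, hX, ← Matrix.mul_assoc, hY]
      simp only [Matrix.mul_assoc]))
    (fun X Y Z hX hY hZ => pairing_adjoint hg _ _ (by
      simp only [Matrix.transpose_mul, hg, Matrix.mul_assoc]
      rw [hX, ← Matrix.mul_assoc Yᵀ, hY, ← Matrix.mul_assoc Zᵀ, ← Matrix.mul_assoc Zᵀ, hZ]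
      simp only [Matrix.mul_assoc]))
    (fun X Y Z T hX hY hZ hT => pairing_adjoint hg _ _ (by
      simp only [Matrix.transpose_mul, hg, Matrix.mul_assoc]
      rw [hX, ← Matrix.mul_assoc Yᵀ, hY, ← Matrix.mul_assoc Zᵀ, ← Matrix.mul_assoc Zᵀ, hZ]
      simp only [← Matrix.mul_assoc]
      rw [hT]))
    (A α) (A γ) (A μ) (A ν) (hA α) (hA γ) (hA μ) (hA ν)
  have sw : ∀ F : κ → κ → ℝ, ∑ α, ∑ γ, F α γ = (1 / 2) * ∑ α, ∑ γ, (F α γ + F γ α) := by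
    intro F
    have : ∑ α, ∑ γ, F γ α = ∑ α, ∑ γ, F α γ := Finset.sum_comm
    simp only [Finset.sum_add_distrib, this]
    ring
  rw [← Finset.sum_add_distrib, ← Finset.sum_add_distrib]
  simp only [← Finset.sum_add_distrib]
  rw [sw, sw (fun α γ => perpSummand _ _ _ _ _ + _)]
  congr 1
  refine Finset.sum_congr rfl fun α _ => Finset.sum_congr rfl fun γ _ => ?_
  linarith [key α γ]

/-- The matrix all of whose columns are `w`. -/
abbrev colMat (w : ι → ℝ) : Matrix ι ι ℝ := Matrix.of fun k _ => w k

lemma mul_colMat (M : Matrix ι ι ℝ) (w : ι → ℝ) : M * colMat w = colMat (M *ᵥ w) := by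
  ext i j
  simp [Matrix.mul_apply, Matrix.mulVec, dotProduct]

/-- The two vectors have no lower index of their own; `S` carries both. Alternation therefore keeps
only the antisymmetric part of `S`, and this is how the normal curvature enters. -/
lemma alt2_colMat (S : Matrix ι ι ℝ) (w z : ι → ℝ) :
    alt2 S (colMat w) (colMat z) = w ⬝ᵥ ((S - Sᵀ) *ᵥ z) := by
  rw [Matrix.sub_mulVec, dotProduct_sub]
  simp only [alt2, colMat, Matrix.of_apply, mul_sub, Finset.sum_sub_distrib,
    dotProduct, Matrix.mulVec, Finset.mul_sum, Matrix.transpose_apply]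
  congr 1
  · refine Finset.sum_congr rfl fun i _ => Finset.sum_congr rfl fun j _ => by ring
  · rw [Finset.sum_comm]
    refine Finset.sum_congr rfl fun i _ => Finset.sum_congr rfl fun j _ => by ring

/-- The recursion for `alt4` lets `M` and `N` act on `w` or on `z`. What acts on `z` is moved across
the pairing as an adjoint, which fixes `M` and `N` but reverses their products. -/
lemma alt4_colMat (S M N : Matrix ι ι ℝ) (w z : ι → ℝ) (k : Matrix ι ι ℝ → Matrix ι ι ℝ → ℝ)
    (adj : Matrix ι ι ℝ → Matrix ι ι ℝ)
    (hk : ∀ X Y, alt2 S (colMat (X *ᵥ w)) (colMat (Y *ᵥ z)) = k X (adj Y))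
    (h1 : adj 1 = 1) (hM : adj M = M) (hN : adj N = N) (hMN : adj (M * N) = N * M)
    (hNM : adj (N * M) = M * N) :
    alt4 S (colMat w) (colMat z) M N = rankOneExpansion k M N := by
  have e1 : ∀ X, alt2 S (colMat (X *ᵥ w)) (colMat z) = k X 1 := fun X => by
    rw [← h1, ← hk, Matrix.one_mulVec]
  have e2 : ∀ Y, alt2 S (colMat w) (colMat (Y *ᵥ z)) = k 1 (adj Y) := fun Y => by
    rw [← hk, Matrix.one_mulVec]
  have e3 : alt2 S (colMat w) (colMat z) = k 1 1 := by
    rw [← e1, Matrix.one_mulVec]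
  simp only [alt4, alt3, mul_colMat, Matrix.mulVec_mulVec, hk, e1, e2, e3, hM, hN, hMN, hNM,
    rankOneExpansion]

lemma alt4_rankOne {g H : Matrix ι ι ℝ} (hg : gᵀ = g) (hH : Hᵀ = H) (hgH : g * H = 1)
    (D E M N : Matrix ι ι ℝ) (hD : Dᵀ = D) (hE : Eᵀ = E)
    (hM : Mᵀ * g = g * M) (hN : Nᵀ * g = g * N) (w z : ι → ℝ) :
    alt4 (E * H * D) (colMat w) (colMat z) M N =
      rankOneExpansion (fun X Y => pairing g w z (Y * ((H * D) * (H * E) - (H * E) * (H * D)) * X))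
        M N := by
  have hHg : H * g = 1 := mul_eq_one_comm.mp hgH
  -- Since `H` is inverse to `g`, this is the adjoint of `Y` for the inner product `g`.
  refine alt4_colMat _ _ _ _ _ _ (fun Y => H * Yᵀ * g) (fun X Y => ?_) ?_ ?_ ?_ ?_ ?_
  · have e : g * (H * Yᵀ * g * (H * D * (H * E) - H * E * (H * D)) * X) =
        Yᵀ * (D * H * E - E * H * D) * X := by
      calc _ = (g * H) * Yᵀ * ((g * H) * D * H * E - (g * H) * E * H * D) * X := by
            simp only [Matrix.mul_sub, Matrix.sub_mul, Matrix.mul_assoc]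
        _ = _ := by simp only [hgH, Matrix.one_mul]
    have t : E * H * D - (E * H * D)ᵀ = (D * H * E - E * H * D)ᵀ := by
      simp only [Matrix.transpose_sub, Matrix.transpose_mul, hD, hE, hH, Matrix.mul_assoc]
    rw [alt2_colMat, pairing_eq_dotProduct hg, e, t, Matrix.mulVec_transpose,
      ← Matrix.mulVec_mulVec, ← Matrix.mulVec_mulVec, Matrix.dotProduct_mulVec z,
      Matrix.vecMul_transpose, dotProduct_comm, ← Matrix.dotProduct_mulVec]
  · simp [hHg]
  · rw [Matrix.mul_assoc, hM, ← Matrix.mul_assoc, hHg, Matrix.one_mul]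
  · rw [Matrix.mul_assoc, hN, ← Matrix.mul_assoc, hHg, Matrix.one_mul]
  · rw [Matrix.transpose_mul, Matrix.mul_assoc, Matrix.mul_assoc, hM, ← Matrix.mul_assoc Nᵀ, hN,
      ← Matrix.mul_assoc, ← Matrix.mul_assoc, hHg, Matrix.one_mul]
  · rw [Matrix.transpose_mul, Matrix.mul_assoc, Matrix.mul_assoc, hN, ← Matrix.mul_assoc Mᵀ, hM,
      ← Matrix.mul_assoc, ← Matrix.mul_assoc, hHg, Matrix.one_mul]

end Perp

/-! ### Differentiation of the alternating contraction -/

section AltDivergence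

set_option linter.unusedSectionVars false

variable {ι κ : Type*} [Fintype ι] [DecidableEq ι] [Fintype κ]

/-- If `T` is symmetric under the exchange of two lower indices, its alternating contraction
vanishes. -/
lemma alt_eq_zero_of_symm {s t : Fin 4} (h : s ≠ t) (T : (Fin 4 → ι) → (Fin 4 → ι) → ℝ)
    (hT : ∀ K I, T K (I ∘ Equiv.swap s t) = T K I) : alt T = 0 := by
  have := alt_swap_right h T
  simp only [hT] at this
  linarith

lemma alt_eq_neg_of_swap {s t : Fin 4} (h : s ≠ t) (T T' : (Fin 4 → ι) → (Fin 4 → ι) → ℝ)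
    (hT : ∀ K I, T K (I ∘ Equiv.swap s t) = T' K I) : alt T = - alt T' := by
  have := alt_swap_right h T
  simp only [hT] at this
  linarith

/-- The left side is the Leibniz rule, with `dw`, `dA`, `dV` given by structure equations. The terms
with `D` are symmetric in two alternated indices and vanish. The terms with `u` cancel in pairs, as
for a connection on the normal index. There remain the term `V α β * A β` of `dw`, which gives the
unweighted contraction, and the terms with `S`. -/
theorem alt_divergence (A : κ → Matrix ι ι ℝ) (w : κ → ι → ℝ) (V : Matrix κ κ ℝ) (hV : Vᵀ = V)
    (u : κ → κ → ι → ℝ) (S : κ → κ → Matrix ι ι ℝ) (D : κ → ι → ι → ι → ℝ)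
    (hD : ∀ α l i j, D α l i j = D α l j i)
    (dw : κ → ι → ι → ℝ) (dA : κ → ι → ι → ι → ℝ) (dV : κ → κ → ι → ℝ)
    (hdw : ∀ α k i, dw α k i = ∑ β, (V α β * A β k i - w β k * u β α i))
    (hdA : ∀ α l j i, dA α l j i = D α l i j + ∑ β, (- (A β l i * u α β j) - w β l * S β α i j))
    (hdV : ∀ α β i, dV α β i = ∑ l, (- (V α l * u l β i) - V l β * u l α i)) :
    alt (fun K I => ∑ α, ∑ μ, ∑ ν,
      (dw α (K 0) (I 0) * A α (K 1) (I 1) * A μ (K 2) (I 2) * A ν (K 3) (I 3) * V μ ν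
      + w α (K 0) * dA α (K 1) (I 1) (I 0) * A μ (K 2) (I 2) * A ν (K 3) (I 3) * V μ ν
      + w α (K 0) * A α (K 1) (I 1) * dA μ (K 2) (I 2) (I 0) * A ν (K 3) (I 3) * V μ ν
      + w α (K 0) * A α (K 1) (I 1) * A μ (K 2) (I 2) * dA ν (K 3) (I 3) (I 0) * V μ ν
      + w α (K 0) * A α (K 1) (I 1) * A μ (K 2) (I 2) * A ν (K 3) (I 3) * dV μ ν (I 0))) =
    ∑ α, ∑ β, V α β * ∑ μ, ∑ ν, V μ ν * alt4 ones (A β) (A α) (A μ) (A ν)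
      - ∑ μ, ∑ ν, V μ ν * ∑ α, ∑ β, (alt4 (S β α) (colMat (w α)) (colMat (w β)) (A μ) (A ν)
        + 2 * alt4 (S β μ) (colMat (w α)) (colMat (w β)) (A α) (A ν)) := by
  have hVs : ∀ μ ν, V μ ν = V ν μ := fun μ ν => by rw [← Matrix.transpose_apply V, hV]
  set Y : κ → κ → κ → κ → (ι → ℝ) → ℝ := fun a b c d p => alt fun K I =>
    w a (K 0) * p (I 0) * A b (K 1) (I 1) * A c (K 2) (I 2) * A d (K 3) (I 3) with hY
  set Z : κ → κ → κ → κ → Matrix ι ι ℝ → ℝ := fun a b c d p =>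
    alt4 p (colMat (w a)) (colMat (w b)) (A c) (A d) with hZ
  have s01 : ∀ I : Fin 4 → ι, (I ∘ Equiv.swap 0 1) 0 = I 1 ∧ (I ∘ Equiv.swap 0 1) 1 = I 0 ∧
      (I ∘ Equiv.swap 0 1) 2 = I 2 ∧ (I ∘ Equiv.swap 0 1) 3 = I 3 := fun I => ⟨rfl, rfl, rfl, rfl⟩
  have s02 : ∀ I : Fin 4 → ι, (I ∘ Equiv.swap 0 2) 0 = I 2 ∧ (I ∘ Equiv.swap 0 2) 1 = I 1 ∧
      (I ∘ Equiv.swap 0 2) 2 = I 0 ∧ (I ∘ Equiv.swap 0 2) 3 = I 3 := fun I => ⟨rfl, rfl, rfl, rfl⟩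
  have s03 : ∀ I : Fin 4 → ι, (I ∘ Equiv.swap 0 3) 0 = I 3 ∧ (I ∘ Equiv.swap 0 3) 1 = I 1 ∧
      (I ∘ Equiv.swap 0 3) 2 = I 2 ∧ (I ∘ Equiv.swap 0 3) 3 = I 0 := fun I => ⟨rfl, rfl, rfl, rfl⟩
  have s12 : ∀ I : Fin 4 → ι, (I ∘ Equiv.swap 1 2) 0 = I 0 ∧ (I ∘ Equiv.swap 1 2) 1 = I 2 ∧
      (I ∘ Equiv.swap 1 2) 2 = I 1 ∧ (I ∘ Equiv.swap 1 2) 3 = I 3 := fun I => ⟨rfl, rfl, rfl, rfl⟩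
  have s23 : ∀ I : Fin 4 → ι, (I ∘ Equiv.swap 2 3) 0 = I 0 ∧ (I ∘ Equiv.swap 2 3) 1 = I 1 ∧
      (I ∘ Equiv.swap 2 3) 2 = I 3 ∧ (I ∘ Equiv.swap 2 3) 3 = I 2 := fun I => ⟨rfl, rfl, rfl, rfl⟩
  have n01 : (0 : Fin 4) ≠ 1 := by decide
  have n02 : (0 : Fin 4) ≠ 2 := by decide
  have n03 : (0 : Fin 4) ≠ 3 := by decide
  -- the terms with third derivatives
  have c1 : ∀ α μ ν, alt (fun K I =>
      w α (K 0) * D α (K 1) (I 0) (I 1) * A μ (K 2) (I 2) * A ν (K 3) (I 3)) = 0 := fun α μ ν =>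
    alt_eq_zero_of_symm n01 _ fun K I => by simp only [s01, hD α (K 1) (I 1)]
  have c2 : ∀ α μ ν, alt (fun K I =>
      w α (K 0) * A α (K 1) (I 1) * D μ (K 2) (I 0) (I 2) * A ν (K 3) (I 3)) = 0 := fun α μ ν =>
    alt_eq_zero_of_symm n02 _ fun K I => by simp only [s02, hD μ (K 2) (I 2)]
  have c3 : ∀ α μ ν, alt (fun K I =>
      w α (K 0) * A α (K 1) (I 1) * A μ (K 2) (I 2) * D ν (K 3) (I 0) (I 3)) = 0 := fun α μ ν =>
    alt_eq_zero_of_symm n03 _ fun K I => by simp only [s03, hD ν (K 3) (I 3)]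
  -- the terms that cancel in pairs
  have y1 : ∀ α β μ ν, alt (fun K I => w α (K 0) * (A β (K 1) (I 0) * u α β (I 1)) *
      A μ (K 2) (I 2) * A ν (K 3) (I 3)) = - Y α β μ ν (u α β) := fun α β μ ν =>
    alt_eq_neg_of_swap n01 _ _ fun K I => by simp only [s01]; ring
  have y2 : ∀ α β μ ν, alt (fun K I => w α (K 0) * A α (K 1) (I 1) *
      (A β (K 2) (I 0) * u μ β (I 2)) * A ν (K 3) (I 3)) = - Y α α β ν (u μ β) := fun α β μ ν =>
    alt_eq_neg_of_swap n02 _ _ fun K I => by simp only [s02]; ring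
  have y3 : ∀ α β μ ν, alt (fun K I => w α (K 0) * A α (K 1) (I 1) * A μ (K 2) (I 2) *
      (A β (K 3) (I 0) * u ν β (I 3))) = - Y α α μ β (u ν β) := fun α β μ ν =>
    alt_eq_neg_of_swap n03 _ _ fun K I => by simp only [s03]; ring
  -- the remaining terms
  have z1 : ∀ α β μ ν, alt (fun K I => w α (K 0) * (w β (K 1) * S β α (I 0) (I 1)) *
      A μ (K 2) (I 2) * A ν (K 3) (I 3)) = Z α β μ ν (S β α) := fun α β μ ν => by
    rw [hZ]
    simp only [← alt_eq_alt4, Matrix.of_apply]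
    congr 1; ext K I; ring
  have z2 : ∀ α β μ ν, alt (fun K I => w α (K 0) * A α (K 1) (I 1) *
      (w β (K 2) * S β μ (I 0) (I 2)) * A ν (K 3) (I 3)) = Z α β α ν (S β μ) :=
    fun α β μ ν => by
      rw [← alt_swap 1 2, hZ]
      simp only [← alt_eq_alt4, Matrix.of_apply, s12]
      congr 1; ext K I; ring
  have z3 : ∀ α β μ ν, alt (fun K I => w α (K 0) * A α (K 1) (I 1) * A μ (K 2) (I 2) *
      (w β (K 3) * S β ν (I 0) (I 3))) = Z α β α μ (S β ν) := fun α β μ ν => by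
    rw [← z2, ← alt_swap 2 3]
    simp only [s23]
    congr 1; ext K I; ring
  have a1 : ∀ α β μ ν, alt (fun K I => A β (K 0) (I 0) * A α (K 1) (I 1) * A μ (K 2) (I 2) *
      A ν (K 3) (I 3)) = alt4 ones (A β) (A α) (A μ) (A ν) := fun α β μ ν => by
    rw [← alt_eq_alt4]
    simp only [Matrix.of_apply, one_mul]
  have expand : ∀ (K I : Fin 4 → ι) (α μ ν : κ),
      (dw α (K 0) (I 0) * A α (K 1) (I 1) * A μ (K 2) (I 2) * A ν (K 3) (I 3) * V μ ν
      + w α (K 0) * dA α (K 1) (I 1) (I 0) * A μ (K 2) (I 2) * A ν (K 3) (I 3) * V μ ν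
      + w α (K 0) * A α (K 1) (I 1) * dA μ (K 2) (I 2) (I 0) * A ν (K 3) (I 3) * V μ ν
      + w α (K 0) * A α (K 1) (I 1) * A μ (K 2) (I 2) * dA ν (K 3) (I 3) (I 0) * V μ ν
      + w α (K 0) * A α (K 1) (I 1) * A μ (K 2) (I 2) * A ν (K 3) (I 3) * dV μ ν (I 0)) =
      V μ ν * (w α (K 0) * D α (K 1) (I 0) (I 1) * A μ (K 2) (I 2) * A ν (K 3) (I 3))
      + V μ ν * (w α (K 0) * A α (K 1) (I 1) * D μ (K 2) (I 0) (I 2) * A ν (K 3) (I 3))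
      + V μ ν * (w α (K 0) * A α (K 1) (I 1) * A μ (K 2) (I 2) * D ν (K 3) (I 0) (I 3))
      + ∑ β, (V α β * V μ ν * (A β (K 0) (I 0) * A α (K 1) (I 1) * A μ (K 2) (I 2) *
          A ν (K 3) (I 3))
        - V μ ν * (w β (K 0) * u β α (I 0) * A α (K 1) (I 1) * A μ (K 2) (I 2) * A ν (K 3) (I 3))
        - V μ ν * (w α (K 0) * (A β (K 1) (I 0) * u α β (I 1)) * A μ (K 2) (I 2) *
          A ν (K 3) (I 3))
        - V μ ν * (w α (K 0) * A α (K 1) (I 1) * (A β (K 2) (I 0) * u μ β (I 2)) *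
          A ν (K 3) (I 3))
        - V μ ν * (w α (K 0) * A α (K 1) (I 1) * A μ (K 2) (I 2) *
          (A β (K 3) (I 0) * u ν β (I 3)))
        - V μ β * (w α (K 0) * u β ν (I 0) * A α (K 1) (I 1) * A μ (K 2) (I 2) * A ν (K 3) (I 3))
        - V β ν * (w α (K 0) * u β μ (I 0) * A α (K 1) (I 1) * A μ (K 2) (I 2) * A ν (K 3) (I 3))
        - V μ ν * (w α (K 0) * (w β (K 1) * S β α (I 0) (I 1)) * A μ (K 2) (I 2) *
          A ν (K 3) (I 3))
        - V μ ν * (w α (K 0) * A α (K 1) (I 1) * (w β (K 2) * S β μ (I 0) (I 2)) *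
          A ν (K 3) (I 3))
        - V μ ν * (w α (K 0) * A α (K 1) (I 1) * A μ (K 2) (I 2) *
          (w β (K 3) * S β ν (I 0) (I 3)))) := by
    intro K I α μ ν
    have hb : ∑ β, (V α β * V μ ν * (A β (K 0) (I 0) * A α (K 1) (I 1) * A μ (K 2) (I 2) *
          A ν (K 3) (I 3))
        - V μ ν * (w β (K 0) * u β α (I 0) * A α (K 1) (I 1) * A μ (K 2) (I 2) * A ν (K 3) (I 3))
        - V μ ν * (w α (K 0) * (A β (K 1) (I 0) * u α β (I 1)) * A μ (K 2) (I 2) *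
          A ν (K 3) (I 3))
        - V μ ν * (w α (K 0) * A α (K 1) (I 1) * (A β (K 2) (I 0) * u μ β (I 2)) *
          A ν (K 3) (I 3))
        - V μ ν * (w α (K 0) * A α (K 1) (I 1) * A μ (K 2) (I 2) *
          (A β (K 3) (I 0) * u ν β (I 3)))
        - V μ β * (w α (K 0) * u β ν (I 0) * A α (K 1) (I 1) * A μ (K 2) (I 2) * A ν (K 3) (I 3))
        - V β ν * (w α (K 0) * u β μ (I 0) * A α (K 1) (I 1) * A μ (K 2) (I 2) * A ν (K 3) (I 3))
        - V μ ν * (w α (K 0) * (w β (K 1) * S β α (I 0) (I 1)) * A μ (K 2) (I 2) *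
          A ν (K 3) (I 3))
        - V μ ν * (w α (K 0) * A α (K 1) (I 1) * (w β (K 2) * S β μ (I 0) (I 2)) *
          A ν (K 3) (I 3))
        - V μ ν * (w α (K 0) * A α (K 1) (I 1) * A μ (K 2) (I 2) *
          (w β (K 3) * S β ν (I 0) (I 3)))) =
        (∑ β, (V α β * A β (K 0) (I 0) - w β (K 0) * u β α (I 0))) * A α (K 1) (I 1) *
          A μ (K 2) (I 2) * A ν (K 3) (I 3) * V μ ν
        + w α (K 0) * (∑ β, (- (A β (K 1) (I 0) * u α β (I 1))
          - w β (K 1) * S β α (I 0) (I 1))) * A μ (K 2) (I 2) * A ν (K 3) (I 3) * V μ ν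
        + w α (K 0) * A α (K 1) (I 1) * (∑ β, (- (A β (K 2) (I 0) * u μ β (I 2))
          - w β (K 2) * S β μ (I 0) (I 2))) * A ν (K 3) (I 3) * V μ ν
        + w α (K 0) * A α (K 1) (I 1) * A μ (K 2) (I 2) * (∑ β, (- (A β (K 3) (I 0) * u ν β (I 3))
          - w β (K 3) * S β ν (I 0) (I 3))) * V μ ν
        + w α (K 0) * A α (K 1) (I 1) * A μ (K 2) (I 2) * A ν (K 3) (I 3) *
          ∑ l, (- (V μ l * u l ν (I 0)) - V l ν * u l μ (I 0)) := by
      simp only [Finset.sum_mul, Finset.mul_sum, ← Finset.sum_add_distrib]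
      exact Finset.sum_congr rfl fun β _ => by ring
    rw [hb, hdw, hdA, hdA, hdA, hdV]
    ring
  have rot : ∀ G : κ → κ → κ → κ → ℝ,
      ∑ α, ∑ μ, ∑ ν, ∑ β, G α β μ ν = ∑ α, ∑ β, ∑ μ, ∑ ν, G α β μ ν := fun G => by
    refine Finset.sum_congr rfl fun α _ => ?_
    rw [Finset.sum_comm]
    conv_rhs => rw [Finset.sum_comm]
    rw [Finset.sum_comm]
    refine Finset.sum_congr rfl fun μ _ => ?_
    rw [Finset.sum_comm]
  simp only [expand, alt_sum, alt_add, alt_sub, alt_const_mul, c1, c2, c3, y1, y2, y3, z1, z2, z3,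
    a1, mul_zero, zero_add]
  have hYf : ∀ a b c d p, alt (fun K I : Fin 4 → ι =>
      w a (K 0) * p (I 0) * A b (K 1) (I 1) * A c (K 2) (I 2) * A d (K 3) (I 3)) =
      Y a b c d p := fun _ _ _ _ _ => rfl
  simp only [hYf, Finset.sum_sub_distrib]
  -- The cancelling pairs: `w α` against `A α`, then each of `A μ` and `A ν` against the matching
  -- index of `V`.
  have e1 : ∑ α, ∑ μ, ∑ ν, ∑ β, V μ ν * Y β α μ ν (u β α) =
      ∑ α, ∑ μ, ∑ ν, ∑ β, V μ ν * Y α β μ ν (u α β) := by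
    rw [rot (fun α β μ ν => V μ ν * Y β α μ ν (u β α)),
      rot (fun α β μ ν => V μ ν * Y α β μ ν (u α β)), Finset.sum_comm]
  have e2 : ∑ α, ∑ μ, ∑ ν, ∑ β, V β ν * Y α α μ ν (u β μ) =
      ∑ α, ∑ μ, ∑ ν, ∑ β, V μ ν * Y α α β ν (u μ β) := by
    refine Finset.sum_congr rfl fun α _ => ?_
    rw [Finset.sum_comm]
    conv_rhs => rw [Finset.sum_comm]
    refine Finset.sum_congr rfl fun ν _ => ?_
    rw [Finset.sum_comm]
  have e3 : ∑ α, ∑ μ, ∑ ν, ∑ β, V μ β * Y α α μ ν (u β ν) =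
      ∑ α, ∑ μ, ∑ ν, ∑ β, V μ ν * Y α α μ β (u ν β) := by
    refine Finset.sum_congr rfl fun α _ => Finset.sum_congr rfl fun μ _ => ?_
    rw [Finset.sum_comm]
  -- By symmetry of `V` the derivatives of `A μ` and `A ν` contribute equally; hence the factor 2 in
  -- the statement.
  have e4 : ∑ α, ∑ μ, ∑ ν, ∑ β, V μ ν * Z α β α μ (S β ν) =
      ∑ α, ∑ μ, ∑ ν, ∑ β, V μ ν * Z α β α ν (S β μ) := by
    refine Finset.sum_congr rfl fun α _ => ?_
    rw [Finset.sum_comm]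
    refine Finset.sum_congr rfl fun μ _ => Finset.sum_congr rfl fun ν _ => ?_
    rw [hVs]
  have r1 : ∑ α, ∑ β, V α β * ∑ μ, ∑ ν, V μ ν * alt4 ones (A β) (A α) (A μ) (A ν) =
      ∑ α, ∑ μ, ∑ ν, ∑ β, V α β * V μ ν * alt4 ones (A β) (A α) (A μ) (A ν) := by
    rw [rot (fun α β μ ν => V α β * V μ ν * alt4 ones (A β) (A α) (A μ) (A ν))]
    simp only [Finset.mul_sum, mul_assoc]
  have r2 : ∑ μ, ∑ ν, V μ ν * ∑ α, ∑ β, (Z α β μ ν (S β α) + 2 * Z α β α ν (S β μ)) =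
      ∑ α, ∑ μ, ∑ ν, ∑ β, V μ ν * Z α β μ ν (S β α)
      + 2 * ∑ α, ∑ μ, ∑ ν, ∑ β, V μ ν * Z α β α ν (S β μ) := by
    have q : ∀ G : κ → κ → κ → κ → ℝ, ∑ μ, ∑ ν, V μ ν * ∑ α, ∑ β, G α β μ ν =
        ∑ α, ∑ μ, ∑ ν, ∑ β, V μ ν * G α β μ ν := fun G => by
      simp only [Finset.mul_sum]
      rw [Finset.sum_comm]
      conv_rhs => rw [Finset.sum_comm]; enter [2, μ]; rw [Finset.sum_comm]
      rw [Finset.sum_comm]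
    rw [q (fun α β μ ν => Z α β μ ν (S β α) + 2 * Z α β α ν (S β μ))]
    simp only [mul_add, Finset.sum_add_distrib, Finset.mul_sum]
    congr 1
    refine Finset.sum_congr rfl fun α _ => Finset.sum_congr rfl fun μ _ =>
      Finset.sum_congr rfl fun ν _ => Finset.sum_congr rfl fun β _ => by ring
  rw [r1, r2]
  simp only [mul_neg, Finset.sum_neg_distrib]
  linarith

end AltDivergence

/-! ### Partial derivatives of smooth functions -/

section Calculus

variable {n : ℕ}

lemma contDiff_pd {F : Type*} [NormedAddCommGroup F] [NormedSpace ℝ F] {h : Euc n → F}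
    (hh : ContDiff ℝ ∞ h) (i : Fin n) : ContDiff ℝ ∞ (pd i h) := by
  have : ContDiff ℝ ∞ (fderiv ℝ h) := hh.fderiv_right (m := ∞) (by simp)
  exact this.clm_apply contDiff_const

lemma pd_const (c : ℝ) (i : Fin n) (x : Euc n) : pd i (fun _ => c) x = 0 := by
  simp [pd]

lemma pd_add {a b : Euc n → ℝ} (ha : ContDiff ℝ ∞ a) (hb : ContDiff ℝ ∞ b) (i : Fin n)
    (x : Euc n) : pd i (fun y => a y + b y) x = pd i a x + pd i b x := by
  unfold pd
  rw [fderiv_fun_add (ha.differentiable (by simp) x) (hb.differentiable (by simp) x)]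
  rfl

lemma pd_sub {a b : Euc n → ℝ} (ha : ContDiff ℝ ∞ a) (hb : ContDiff ℝ ∞ b) (i : Fin n)
    (x : Euc n) : pd i (fun y => a y - b y) x = pd i a x - pd i b x := by
  unfold pd
  rw [fderiv_fun_sub (ha.differentiable (by simp) x) (hb.differentiable (by simp) x)]
  rfl

lemma pd_mul {a b : Euc n → ℝ} (ha : ContDiff ℝ ∞ a) (hb : ContDiff ℝ ∞ b) (i : Fin n)
    (x : Euc n) : pd i (fun y => a y * b y) x = pd i a x * b x + a x * pd i b x := by
  unfold pd
  rw [fderiv_fun_mul (ha.differentiable (by simp) x) (hb.differentiable (by simp) x)]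
  simp only [add_apply, smul_apply, smul_eq_mul]
  ring

lemma pd_const_mul {a : Euc n → ℝ} (ha : ContDiff ℝ ∞ a) (c : ℝ) (i : Fin n)
    (x : Euc n) : pd i (fun y => c * a y) x = c * pd i a x := by
  rw [pd_mul contDiff_const ha, pd_const]
  ring

lemma pd_sum {κ : Type*} {s : Finset κ} {a : κ → Euc n → ℝ} (ha : ∀ k, ContDiff ℝ ∞ (a k))
    (i : Fin n) (x : Euc n) : pd i (fun y => ∑ k ∈ s, a k y) x = ∑ k ∈ s, pd i (a k) x := by
  unfold pd
  rw [fderiv_fun_sum fun k _ => (ha k).differentiable (by simp) x]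
  simp

lemma pd_comm {F : Type*} [NormedAddCommGroup F] [NormedSpace ℝ F] {a : Euc n → F}
    (ha : ContDiff ℝ ∞ a) (i j : Fin n) (x : Euc n) :
    pd i (pd j a) x = pd j (pd i a) x := by
  have hs : IsSymmSndFDerivAt ℝ a x :=
    ha.contDiffAt.isSymmSndFDerivAt
      (by simpa using (WithTop.coe_le_coe.mpr le_top : (2 : WithTop ℕ∞) ≤ ∞))
  have hd : DifferentiableAt ℝ (fderiv ℝ a) x :=
    (ha.fderiv_right (m := ∞) (by simp)).differentiable (by simp) x
  have key : ∀ v w : Euc n, fderiv ℝ (fun y => fderiv ℝ a y v) x w =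
      fderiv ℝ (fderiv ℝ a) x w v := by
    intro v w
    rw [fderiv_clm_apply hd (differentiableAt_const v)]
    simp
  unfold pd
  rw [key, key]
  exact hs _ _

lemma pd_apply {ι : Type*} [Fintype ι] {h : Euc n → EuclideanSpace ℝ ι} (hh : ContDiff ℝ ∞ h)
    (i : Fin n) (x : Euc n) (k : ι) : pd i h x k = pd i (fun y => h y k) x := by
  unfold pd
  have h1 : (fun y => h y k) = (EuclideanSpace.proj k : EuclideanSpace ℝ ι →L[ℝ] ℝ) ∘ h := rfl
  rw [h1, fderiv_comp x (ContinuousLinearMap.differentiableAt _)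
    (hh.differentiable (by simp) x), ContinuousLinearMap.fderiv]
  rfl

lemma pd_coord (i k : Fin n) (x : Euc n) :
    pd i (fun y : Euc n => y k) x = if k = i then 1 else 0 := by
  unfold pd
  have h1 : (fun y : Euc n => y k) = (EuclideanSpace.proj k : Euc n →L[ℝ] ℝ) := rfl
  rw [h1, ContinuousLinearMap.fderiv]
  simp

lemma contDiff_coord {m : ℕ} {f : Euc n → Euc m} (hf : ContDiff ℝ ∞ f) (α : Fin m) :
    ContDiff ℝ ∞ (fun y => f y α) := by
  exact contDiff_euclidean.mp hf α

lemma pd_neg {a : Euc n → ℝ} (i : Fin n)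
    (x : Euc n) : pd i (fun y => - a y) x = - pd i a x := by
  unfold pd
  rw [fderiv_fun_neg]
  rfl

end Calculus

/-! ### Metric, normal frame and shape operators in terms of the derivatives of `f` -/

section Jets

variable {n m : ℕ}

/-- The Jacobian matrix `f^α_i`. -/
def jac (f : Euc n → Euc m) (x : Euc n) : Matrix (Fin m) (Fin n) ℝ :=
  Matrix.of fun α i => pd i (fun y => f y α) x

/-- The Hessian matrix `f^α_{ij}`. -/
def hess (f : Euc n → Euc m) (α : Fin m) (x : Euc n) : Matrix (Fin n) (Fin n) ℝ :=
  Matrix.of fun i j => pd i (pd j (fun y => f y α)) x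

variable {f : Euc n → Euc m}

lemma contDiff_jac (hf : ContDiff ℝ ∞ f) (α : Fin m) (i : Fin n) :
    ContDiff ℝ ∞ (fun x => jac f x α i) := contDiff_pd (contDiff_coord hf α) i

lemma contDiff_hess (hf : ContDiff ℝ ∞ f) (α : Fin m) (i j : Fin n) :
    ContDiff ℝ ∞ (fun x => hess f α x i j) := contDiff_pd (contDiff_pd (contDiff_coord hf α) j) i

lemma hess_transpose (hf : ContDiff ℝ ∞ f) (α : Fin m) (x : Euc n) :
    (hess f α x)ᵀ = hess f α x := by
  ext i j
  exact pd_comm (contDiff_coord hf α) _ _ _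

/-- In flat coordinates the Codazzi equation is just the symmetry of third derivatives. -/
lemma pd_hess_symm (hf : ContDiff ℝ ∞ f) (α : Fin m) (i j k : Fin n) (x : Euc n) :
    pd i (fun y => hess f α y k j) x = pd j (fun y => hess f α y k i) x := by
  have e : ∀ i j, (fun y => hess f α y i j) = pd j (pd i (fun y => f y α)) := fun i j => by
    ext y
    exact pd_comm (contDiff_coord hf α) _ _ _
  rw [e, e]
  exact pd_comm (contDiff_pd (contDiff_coord hf α) k) _ _ _

lemma contDiff_graphMap (hf : ContDiff ℝ ∞ f) : ContDiff ℝ ∞ (graphMap f) := by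
  rw [contDiff_euclidean]
  rintro (i | α)
  · exact contDiff_coord contDiff_id i
  · exact contDiff_coord hf α

lemma tang_eq (hf : ContDiff ℝ ∞ f) (i : Fin n) (x : Euc n) : tang f i x =
    WithLp.toLp 2 (Sum.elim (fun k => if k = i then 1 else 0) (fun α => jac f x α i)) := by
  ext (k | α)
  · rw [tang, pd_apply (contDiff_graphMap hf)]
    exact pd_coord i k x
  · rw [tang, pd_apply (contDiff_graphMap hf)]
    rfl

lemma contDiff_normalVec (hf : ContDiff ℝ ∞ f) (α : Fin m) : ContDiff ℝ ∞ (normalVec f α) := by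
  rw [contDiff_euclidean]
  rintro (i | β)
  · exact (contDiff_jac hf α i).neg
  · exact contDiff_const

lemma pd_normalVec (hf : ContDiff ℝ ∞ f) (α : Fin m) (i : Fin n) (x : Euc n) :
    pd i (normalVec f α) x = WithLp.toLp 2 (Sum.elim (fun k => - hess f α x i k) 0) := by
  ext (k | β)
  · rw [pd_apply (contDiff_normalVec hf α)]
    exact pd_neg i x
  · rw [pd_apply (contDiff_normalVec hf α)]
    exact pd_const _ i x

lemma graphMetric_eq (hf : ContDiff ℝ ∞ f) (x : Euc n) :
    graphMetric f x = 1 + (jac f x)ᵀ * jac f x := by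
  ext i j
  simp only [graphMetric, Matrix.of_apply, tang_eq hf, PiLp.inner_apply, Fintype.sum_sum_type,
    Sum.elim_inl, Sum.elim_inr, Matrix.add_apply, Matrix.mul_apply, Matrix.transpose_apply,
    Matrix.one_apply]
  congr 1
  · simp
  · exact Finset.sum_congr rfl fun α _ => by simp [mul_comm]

lemma matU_eq (x : Euc n) : matU f x = 1 + jac f x * (jac f x)ᵀ := by
  ext α β
  simp only [matU, Matrix.of_apply, normalVec, PiLp.inner_apply, Fintype.sum_sum_type,
    Sum.elim_inl, Sum.elim_inr, Matrix.add_apply, Matrix.mul_apply, Matrix.transpose_apply,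
    Matrix.one_apply]
  rw [add_comm]
  congr 1
  · simp [Pi.single_apply]
  · exact Finset.sum_congr rfl fun i _ => by simp [mul_comm, jac]

lemma shape_eq (hf : ContDiff ℝ ∞ f) (α : Fin m) (x : Euc n) :
    shape f α x = ginv (graphMetric f) x * hess f α x := by
  ext j i
  simp only [shape, Matrix.of_apply, Matrix.mul_apply]
  refine Finset.sum_congr rfl fun k _ => ?_
  congr 1
  rw [pd_normalVec hf, tang_eq hf]
  simp only [PiLp.inner_apply, Fintype.sum_sum_type]
  have hs : hess f α x i k = hess f α x k i := by
    rw [← Matrix.transpose_apply (hess f α x), hess_transpose hf]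
  simp [hs]

lemma graphMetric_posDef (hf : ContDiff ℝ ∞ f) (x : Euc n) : (graphMetric f x).PosDef := by
  rw [graphMetric_eq hf]
  refine Matrix.PosDef.add_posSemidef Matrix.PosDef.one ?_
  simpa using Matrix.posSemidef_conjTranspose_mul_self (jac f x)

lemma graphMetric_mul_ginv (hf : ContDiff ℝ ∞ f) (x : Euc n) :
    graphMetric f x * ginv (graphMetric f) x = 1 :=
  Matrix.mul_nonsing_inv _ (graphMetric_posDef hf x).det_pos.ne'.isUnit

lemma ginv_mul_graphMetric (hf : ContDiff ℝ ∞ f) (x : Euc n) :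
    ginv (graphMetric f) x * graphMetric f x = 1 :=
  Matrix.nonsing_inv_mul _ (graphMetric_posDef hf x).det_pos.ne'.isUnit

lemma graphMetric_transpose (hf : ContDiff ℝ ∞ f) (x : Euc n) :
    (graphMetric f x)ᵀ = graphMetric f x := by
  rw [graphMetric_eq hf]
  simp

lemma ginv_transpose (hf : ContDiff ℝ ∞ f) (x : Euc n) :
    (ginv (graphMetric f) x)ᵀ = ginv (graphMetric f) x := by
  rw [ginv, Matrix.transpose_nonsing_inv, graphMetric_transpose hf]

/-- `U⁻¹ = 1 - F g⁻¹ Fᵀ` for the Jacobian `F`. -/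
lemma matUinv_eq (hf : ContDiff ℝ ∞ f) (x : Euc n) :
    matUinv f x = 1 - jac f x * ginv (graphMetric f) x * (jac f x)ᵀ := by
  rw [matUinv, matU_eq]
  refine Matrix.inv_eq_right_inv ?_
  have h := graphMetric_mul_ginv hf x
  rw [graphMetric_eq hf] at h
  set F := jac f x
  set H := ginv (graphMetric f) x
  calc (1 + F * Fᵀ) * (1 - F * H * Fᵀ)
      = 1 + F * Fᵀ - F * ((1 + Fᵀ * F) * H) * Fᵀ := by
        simp only [Matrix.mul_sub, Matrix.mul_add, Matrix.add_mul, Matrix.mul_one,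
          Matrix.one_mul, Matrix.mul_assoc]
    _ = 1 := by rw [h, Matrix.mul_one, add_sub_cancel_right]

lemma matUinv_transpose (hf : ContDiff ℝ ∞ f) (x : Euc n) : (matUinv f x)ᵀ = matUinv f x := by
  rw [matUinv_eq hf]
  simp only [Matrix.transpose_sub, Matrix.transpose_one, Matrix.transpose_mul,
    Matrix.transpose_transpose, ginv_transpose hf, Matrix.mul_assoc]

end Jets

/-! ### Entrywise differentiation of matrix-valued functions -/

section MatrixCalculus

variable {n : ℕ} {ι κ l : Type*}

/-- The entrywise partial derivative of a matrix-valued function. -/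
def pdMat (i : Fin n) (M : Euc n → Matrix ι κ ℝ) (x : Euc n) : Matrix ι κ ℝ :=
  Matrix.of fun a b => pd i (fun y => M y a b) x

lemma pdMat_mul [Fintype κ] {M : Euc n → Matrix ι κ ℝ} {N : Euc n → Matrix κ l ℝ}
    (hM : ∀ a b, ContDiff ℝ ∞ fun y => M y a b) (hN : ∀ a b, ContDiff ℝ ∞ fun y => N y a b)
    (i : Fin n) (x : Euc n) :
    pdMat i (fun y => M y * N y) x = pdMat i M x * N x + M x * pdMat i N x := by
  ext a b
  simp only [pdMat, Matrix.of_apply, Matrix.add_apply, Matrix.mul_apply,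
    ← Finset.sum_add_distrib]
  rw [pd_sum fun k => (hM a k).mul (hN k b)]
  exact Finset.sum_congr rfl fun k _ => pd_mul (hM a k) (hN k b) i x

lemma pdMat_transpose (M : Euc n → Matrix ι κ ℝ) (i : Fin n) (x : Euc n) :
    pdMat i (fun y => (M y)ᵀ) x = (pdMat i M x)ᵀ := rfl

lemma pdMat_const_add {M : Euc n → Matrix ι κ ℝ} (C : Matrix ι κ ℝ)
    (hM : ∀ a b, ContDiff ℝ ∞ fun y => M y a b) (i : Fin n) (x : Euc n) :
    pdMat i (fun y => C + M y) x = pdMat i M x := by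
  ext a b
  simp only [pdMat, Matrix.of_apply, Matrix.add_apply]
  rw [pd_add contDiff_const (hM a b), pd_const, zero_add]

lemma pdMat_const_sub {M : Euc n → Matrix ι κ ℝ} (C : Matrix ι κ ℝ)
    (hM : ∀ a b, ContDiff ℝ ∞ fun y => M y a b) (i : Fin n) (x : Euc n) :
    pdMat i (fun y => C - M y) x = - pdMat i M x := by
  ext a b
  simp only [pdMat, Matrix.of_apply, Matrix.sub_apply, Matrix.neg_apply]
  rw [pd_sub contDiff_const (hM a b), pd_const, zero_sub]

lemma contDiff_matrix_mul [Fintype κ] {M : Euc n → Matrix ι κ ℝ} {N : Euc n → Matrix κ l ℝ}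
    (hM : ∀ a b, ContDiff ℝ ∞ fun y => M y a b) (hN : ∀ a b, ContDiff ℝ ∞ fun y => N y a b)
    (a : ι) (b : l) : ContDiff ℝ ∞ fun y => (M y * N y) a b := by
  simp only [Matrix.mul_apply]
  exact ContDiff.sum fun k _ => (hM a k).mul (hN k b)

lemma contDiff_det [Fintype ι] [DecidableEq ι] {M : Euc n → Matrix ι ι ℝ}
    (hM : ∀ a b, ContDiff ℝ ∞ fun y => M y a b) : ContDiff ℝ ∞ fun y => (M y).det := by
  simp only [Matrix.det_apply']
  exact ContDiff.sum fun σ _ => contDiff_const.mul (contDiff_prod fun a _ => hM _ _)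

/-- By Cramer's rule the entries are quotients of determinants. -/
lemma contDiff_matrix_inv [Fintype ι] [DecidableEq ι] {M : Euc n → Matrix ι ι ℝ}
    (hM : ∀ a b, ContDiff ℝ ∞ fun y => M y a b) (hd : ∀ y, (M y).det ≠ 0) (a b : ι) :
    ContDiff ℝ ∞ fun y => (M y)⁻¹ a b := by
  simp only [Matrix.inv_def, Matrix.smul_apply, smul_eq_mul, Ring.inverse_eq_inv',
    Matrix.adjugate_apply]
  refine ((contDiff_det hM).inv hd).mul (contDiff_det fun c d => ?_)
  simp only [Matrix.updateRow_apply]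
  split_ifs
  · exact contDiff_const
  · exact hM c d

lemma pdMat_one_eq_zero [DecidableEq ι] (i : Fin n) (x : Euc n) :
    pdMat i (fun _ => (1 : Matrix ι ι ℝ)) x = 0 := by
  ext a b
  exact pd_const _ i x

end MatrixCalculus

/-! ### Structure equations: derivatives of `∇f^α`, `U^{αβ}` and `A^α` -/

section GraphCalculus

variable {n m : ℕ} {f : Euc n → Euc m}

lemma contDiff_jac_transpose (hf : ContDiff ℝ ∞ f) (i : Fin n) (α : Fin m) :
    ContDiff ℝ ∞ fun x => (jac f x)ᵀ i α := contDiff_jac hf α i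

lemma contDiff_graphMetric (hf : ContDiff ℝ ∞ f) (i j : Fin n) :
    ContDiff ℝ ∞ fun x => graphMetric f x i j := by
  simp only [graphMetric_eq hf, Matrix.add_apply]
  exact contDiff_const.add (contDiff_matrix_mul (contDiff_jac_transpose hf)
    (fun a b => contDiff_jac hf a b) i j)

lemma contDiff_ginv (hf : ContDiff ℝ ∞ f) (i j : Fin n) :
    ContDiff ℝ ∞ fun x => ginv (graphMetric f) x i j :=
  contDiff_matrix_inv (contDiff_graphMetric hf) (fun y => (graphMetric_posDef hf y).det_pos.ne') i j

/-- The matrix of all gradients `∇f^α`, one in each column. -/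
def gradMat (f : Euc n → Euc m) (x : Euc n) : Matrix (Fin n) (Fin m) ℝ :=
  ginv (graphMetric f) x * (jac f x)ᵀ

lemma gradMat_apply (x : Euc n) (k : Fin n) (α : Fin m) : gradMat f x k α = gradf f α x k := rfl

lemma contDiff_gradMat (hf : ContDiff ℝ ∞ f) (k : Fin n) (α : Fin m) :
    ContDiff ℝ ∞ fun x => gradMat f x k α :=
  contDiff_matrix_mul (contDiff_ginv hf) (contDiff_jac_transpose hf) k α

lemma contDiff_gradf (hf : ContDiff ℝ ∞ f) (k : Fin n) (α : Fin m) :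
    ContDiff ℝ ∞ fun x => gradf f α x k := contDiff_gradMat hf k α

lemma contDiff_shape (hf : ContDiff ℝ ∞ f) (α : Fin m) (k l : Fin n) :
    ContDiff ℝ ∞ fun x => shape f α x k l := by
  simp only [shape_eq hf]
  exact contDiff_matrix_mul (contDiff_ginv hf) (contDiff_hess hf α) k l

lemma matUinv_eq_one_sub (hf : ContDiff ℝ ∞ f) (x : Euc n) :
    matUinv f x = 1 - jac f x * gradMat f x := by
  rw [matUinv_eq hf, gradMat, Matrix.mul_assoc]

lemma contDiff_matUinv (hf : ContDiff ℝ ∞ f) (α β : Fin m) :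
    ContDiff ℝ ∞ fun x => matUinv f x α β := by
  simp only [matUinv_eq_one_sub hf, Matrix.sub_apply]
  exact contDiff_const.sub (contDiff_matrix_mul (contDiff_jac hf) (contDiff_gradMat hf) α β)

/-- The covector `⟨A^α ∇f^β, ∂_i⟩`. -/
def hessGrad (f : Euc n → Euc m) (α β : Fin m) (x : Euc n) : Fin n → ℝ :=
  hess f α x *ᵥ gradf f β x

/-- The matrix of the bilinear form `⟨A^α ∂_i, A^β ∂_j⟩`. -/
def hessSq (f : Euc n → Euc m) (α β : Fin m) (x : Euc n) : Matrix (Fin n) (Fin n) ℝ :=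
  hess f α x * ginv (graphMetric f) x * hess f β x

lemma pdMat_jac (i : Fin n) (x : Euc n) :
    pdMat i (jac f) x = Matrix.of fun α k => hess f α x i k := rfl

/-- The columns of `pdMat i (jac f)` raised by the metric. -/
lemma ginv_mul_pdMat_jac (hf : ContDiff ℝ ∞ f) (i a : Fin n) (α : Fin m) (x : Euc n) :
    (ginv (graphMetric f) x * (pdMat i (jac f) x)ᵀ) a α = shape f α x a i := by
  rw [shape_eq hf]
  simp only [Matrix.mul_apply, Matrix.transpose_apply, pdMat_jac, Matrix.of_apply]
  refine Finset.sum_congr rfl fun k _ => ?_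
  rw [← Matrix.transpose_apply (hess f α x), hess_transpose hf]

lemma pdMat_jac_mul_gradMat (i : Fin n) (α β : Fin m) (x : Euc n) :
    (pdMat i (jac f) x * gradMat f x) α β = hessGrad f α β x i := rfl

lemma pdMat_graphMetric (hf : ContDiff ℝ ∞ f) (i : Fin n) (x : Euc n) :
    pdMat i (graphMetric f) x =
      (pdMat i (jac f) x)ᵀ * jac f x + (jac f x)ᵀ * pdMat i (jac f) x := by
  have e : graphMetric f = fun y => 1 + (jac f y)ᵀ * jac f y := funext (graphMetric_eq hf)
  rw [e, pdMat_const_add _ (contDiff_matrix_mul (contDiff_jac_transpose hf)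
    (contDiff_jac hf)), pdMat_mul (contDiff_jac_transpose hf) (contDiff_jac hf),
    pdMat_transpose]

/-- Differentiating `g⁻¹ g = 1` gives `-g⁻¹ (∂g) g⁻¹`. With `F` the Jacobian, `∂g = (∂F)ᵀ F + Fᵀ
∂F`, and `g⁻¹ Fᵀ` is the gradient matrix. -/
lemma pdMat_ginv (hf : ContDiff ℝ ∞ f) (i : Fin n) (x : Euc n) :
    pdMat i (ginv (graphMetric f)) x =
      - (ginv (graphMetric f) x * (pdMat i (jac f) x)ᵀ * (gradMat f x)ᵀ
        + gradMat f x * (ginv (graphMetric f) x * (pdMat i (jac f) x)ᵀ)ᵀ) := by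
  have h := pdMat_mul (contDiff_ginv hf) (contDiff_graphMetric hf) i x
  have e : (fun y => ginv (graphMetric f) y * graphMetric f y) = fun _ => 1 :=
    funext (ginv_mul_graphMetric hf)
  rw [e, pdMat_one_eq_zero] at h
  have h2 := congrArg (· * ginv (graphMetric f) x) h
  simp only [Matrix.zero_mul, Matrix.add_mul] at h2
  rw [Matrix.mul_assoc, graphMetric_mul_ginv hf, Matrix.mul_one] at h2
  rw [eq_neg_of_add_eq_zero_left h2.symm, pdMat_graphMetric hf]
  simp only [gradMat, Matrix.transpose_mul, Matrix.transpose_transpose, ginv_transpose hf,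
    Matrix.mul_add, Matrix.add_mul, Matrix.mul_assoc]

/-- The two terms beginning with `g⁻¹ (∂F)ᵀ` combine with the right factor `1 - F g⁻¹ Fᵀ = U⁻¹`. -/
lemma pdMat_gradMat (hf : ContDiff ℝ ∞ f) (i : Fin n) (x : Euc n) :
    pdMat i (gradMat f) x =
      (ginv (graphMetric f) x * (pdMat i (jac f) x)ᵀ) * matUinv f x
        - gradMat f x * (pdMat i (jac f) x * gradMat f x) := by
  have h := pdMat_mul (contDiff_ginv hf) (contDiff_jac_transpose hf) i x
  rw [pdMat_ginv hf, pdMat_transpose] at h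
  refine h.trans ?_
  rw [matUinv_eq hf]
  simp only [gradMat, Matrix.transpose_mul, Matrix.transpose_transpose, ginv_transpose hf,
    Matrix.mul_sub, Matrix.add_mul, Matrix.mul_one, Matrix.mul_assoc, Matrix.neg_mul]
  abel

/-- Together with `pd_matUinv` and `pd_shape` this supplies the structure equations of
`alt_divergence`, where `hessGrad` plays the role of `u`, `hessSq` that of `S` and `thirdUp` that of
`D`. -/
lemma pd_gradf (hf : ContDiff ℝ ∞ f) (α : Fin m) (k i : Fin n) (x : Euc n) :
    pd i (fun y => gradf f α y k) x =
      ∑ β, (matUinv f x α β * shape f β x k i - gradf f β x k * hessGrad f β α x i) := by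
  refine (congrFun (congrFun (pdMat_gradMat hf i x) k) α).trans ?_
  rw [Matrix.sub_apply, Matrix.mul_apply, Matrix.mul_apply, ← Finset.sum_sub_distrib]
  refine Finset.sum_congr rfl fun β _ => ?_
  rw [ginv_mul_pdMat_jac hf, pdMat_jac_mul_gradMat, gradMat_apply,
    ← Matrix.transpose_apply (matUinv f x), matUinv_transpose hf, mul_comm]

lemma pd_matUinv (hf : ContDiff ℝ ∞ f) (α β : Fin m) (i : Fin n) (x : Euc n) :
    pd i (fun y => matUinv f y α β) x =
      ∑ l, (- (matUinv f x α l * hessGrad f l β x i) - matUinv f x l β * hessGrad f l α x i) := by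
  have e : matUinv f = fun y => 1 - jac f y * gradMat f y := funext (matUinv_eq_one_sub hf)
  have h : pdMat i (matUinv f) x = - (matUinv f x * (pdMat i (jac f) x * gradMat f x)
      + (pdMat i (jac f) x * gradMat f x)ᵀ * matUinv f x) := by
    conv_lhs => rw [e]
    rw [pdMat_const_sub _ (contDiff_matrix_mul (contDiff_jac hf) (contDiff_gradMat hf)),
      pdMat_mul (contDiff_jac hf) (contDiff_gradMat hf), pdMat_gradMat hf]
    have t : (pdMat i (jac f) x * gradMat f x)ᵀ =
        jac f x * (ginv (graphMetric f) x * (pdMat i (jac f) x)ᵀ) := by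
      simp only [gradMat, Matrix.transpose_mul, Matrix.transpose_transpose, ginv_transpose hf,
        Matrix.mul_assoc]
    have s : jac f x * (gradMat f x * (pdMat i (jac f) x * gradMat f x)) =
        pdMat i (jac f) x * gradMat f x - matUinv f x * (pdMat i (jac f) x * gradMat f x) := by
      rw [matUinv_eq_one_sub hf, Matrix.sub_mul, Matrix.one_mul, ← Matrix.mul_assoc (jac f x),
        sub_sub_cancel]
    rw [t, Matrix.mul_sub, s]
    simp only [Matrix.mul_assoc]
    abel
  refine (congrFun (congrFun h α) β).trans ?_
  rw [Matrix.neg_apply, Matrix.add_apply, Matrix.mul_apply, Matrix.mul_apply,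
    ← Finset.sum_add_distrib, ← Finset.sum_neg_distrib]
  refine Finset.sum_congr rfl fun l _ => ?_
  rw [Matrix.transpose_apply, pdMat_jac_mul_gradMat, pdMat_jac_mul_gradMat]
  ring

/-- The third derivatives `f^α_{ijs}`, with one index raised. -/
def thirdUp (f : Euc n → Euc m) (x : Euc n) (α : Fin m) (l i j : Fin n) : ℝ :=
  ∑ s, ginv (graphMetric f) x l s * pd i (fun y => hess f α y s j) x

lemma thirdUp_symm (hf : ContDiff ℝ ∞ f) (x : Euc n) (α : Fin m) (l i j : Fin n) :
    thirdUp f x α l i j = thirdUp f x α l j i := by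
  unfold thirdUp
  exact Finset.sum_congr rfl fun s _ => by rw [pd_hess_symm hf]

lemma pd_shape (hf : ContDiff ℝ ∞ f) (α : Fin m) (l j i : Fin n) (x : Euc n) :
    pd i (fun y => shape f α y l j) x = thirdUp f x α l i j +
      ∑ β, (- (shape f β x l i * hessGrad f α β x j) - gradf f β x l * hessSq f β α x i j) := by
  have e : shape f α = fun y => ginv (graphMetric f) y * hess f α y := funext (shape_eq hf α)
  have h := pdMat_mul (contDiff_ginv hf) (contDiff_hess hf α) i x
  rw [← e, pdMat_ginv hf, add_comm] at h
  refine (congrFun (congrFun h l) j).trans ?_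
  rw [Matrix.add_apply, Matrix.neg_mul, Matrix.add_mul, Matrix.neg_apply, Matrix.add_apply]
  refine congrArg₂ (· + ·) rfl ?_
  rw [Matrix.mul_assoc (_ * _), Matrix.mul_assoc (gradMat f x), Matrix.mul_apply,
    Matrix.mul_apply, ← Finset.sum_add_distrib, ← Finset.sum_neg_distrib]
  refine Finset.sum_congr rfl fun β _ => ?_
  rw [ginv_mul_pdMat_jac hf]
  have a1 : ((gradMat f x)ᵀ * hess f α x) β j = hessGrad f α β x j := by
    simp only [Matrix.mul_apply, hessGrad, Matrix.mulVec, dotProduct, Matrix.transpose_apply,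
      gradMat_apply]
    refine Finset.sum_congr rfl fun k _ => ?_
    rw [← Matrix.transpose_apply (hess f α x), hess_transpose hf, mul_comm]
  have a2 : ((ginv (graphMetric f) x * (pdMat i (jac f) x)ᵀ)ᵀ * hess f α x) β j =
      hessSq f β α x i j := by
    rw [Matrix.transpose_mul, Matrix.transpose_transpose, ginv_transpose hf, hessSq]
    rfl
  rw [a1, a2, gradMat_apply]
  ring

end GraphCalculus

/-! ### Gauss equation and the curvature tensors of a graph -/

section Gauss

variable {n m : ℕ} {f : Euc n → Euc m}

lemma matUinv_comm (hf : ContDiff ℝ ∞ f) (x : Euc n) (α β : Fin m) :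
    matUinv f x α β = matUinv f x β α := by
  rw [← Matrix.transpose_apply (matUinv f x), matUinv_transpose hf]

lemma hess_comm (hf : ContDiff ℝ ∞ f) (α : Fin m) (x : Euc n) (i j : Fin n) :
    hess f α x i j = hess f α x j i := by
  rw [← Matrix.transpose_apply (hess f α x), hess_transpose hf]

lemma ginv_comm (hf : ContDiff ℝ ∞ f) (x : Euc n) (i j : Fin n) :
    ginv (graphMetric f) x i j = ginv (graphMetric f) x j i := by
  rw [← Matrix.transpose_apply (ginv (graphMetric f) x), ginv_transpose hf]

lemma pd_graphMetric (hf : ContDiff ℝ ∞ f) (i j k : Fin n) (x : Euc n) :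
    pd i (fun y => graphMetric f y j k) x =
      ∑ α, (hess f α x i j * jac f x α k + jac f x α j * hess f α x i k) := by
  refine (congrFun (congrFun (pdMat_graphMetric hf i x) j) k).trans ?_
  rw [Matrix.add_apply, Matrix.mul_apply, Matrix.mul_apply, ← Finset.sum_add_distrib]
  rfl

/-- Of the six products in the three derivatives of the metric, four cancel and the other two agree.
-/
lemma christoffel_eq (hf : ContDiff ℝ ∞ f) (k i j : Fin n) (x : Euc n) :
    christoffel (graphMetric f) k i j x = ∑ β, gradf f β x k * hess f β x i j := by
  have e : ∀ l, pd i (fun y => graphMetric f y j l) x + pd j (fun y => graphMetric f y i l) x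
      - pd l (fun y => graphMetric f y i j) x = 2 * ∑ β, hess f β x i j * jac f x β l := by
    intro l
    simp only [pd_graphMetric hf, ← Finset.sum_add_distrib, ← Finset.sum_sub_distrib,
      Finset.mul_sum]
    refine Finset.sum_congr rfl fun β _ => ?_
    rw [hess_comm hf β x j i, hess_comm hf β x l i, hess_comm hf β x l j]
    ring
  simp only [christoffel, e, gradf, Finset.sum_mul, Finset.mul_sum]
  rw [Finset.sum_comm]
  refine Finset.sum_congr rfl fun β _ => Finset.sum_congr rfl fun l _ => ?_
  simp only [jac, Matrix.of_apply]
  ring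

lemma pd_christoffel (hf : ContDiff ℝ ∞ f) (p i j l : Fin n) (x : Euc n) :
    pd i (christoffel (graphMetric f) p j l) x =
      ∑ β, ∑ γ, (matUinv f x β γ * shape f γ x p i * hess f β x j l
        - gradf f γ x p * hessGrad f γ β x i * hess f β x j l)
      + ∑ β, gradf f β x p * pd i (fun y => hess f β y j l) x := by
  have e : christoffel (graphMetric f) p j l =
      fun y => ∑ β, gradf f β y p * hess f β y j l := funext (christoffel_eq hf p j l)
  rw [e, pd_sum fun β => (contDiff_gradf hf p β).mul (contDiff_hess hf β j l),
    ← Finset.sum_add_distrib]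
  refine Finset.sum_congr rfl fun β _ => ?_
  rw [pd_mul (contDiff_gradf hf p β) (contDiff_hess hf β j l), pd_gradf hf, Finset.sum_mul]
  congr 1
  exact Finset.sum_congr rfl fun γ _ => by ring

lemma sum_christoffel_mul (hf : ContDiff ℝ ∞ f) (p i j l : Fin n) (x : Euc n) :
    ∑ q, christoffel (graphMetric f) p i q x * christoffel (graphMetric f) q j l x =
      ∑ β, ∑ γ, gradf f γ x p * hessGrad f γ β x i * hess f β x j l := by
  simp only [christoffel_eq hf, Finset.sum_mul_sum, hessGrad, Matrix.mulVec, dotProduct]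
  rw [Finset.sum_comm]
  conv_rhs => rw [Finset.sum_comm]
  refine Finset.sum_congr rfl fun γ _ => ?_
  rw [Finset.sum_comm]
  refine Finset.sum_congr rfl fun β _ => ?_
  rw [Finset.mul_sum, Finset.sum_mul]
  exact Finset.sum_congr rfl fun q _ => by ring

/-- The Gauss equation for the curvature operator. -/
lemma curvOp_eq (hf : ContDiff ℝ ∞ f) (i j l p : Fin n) (x : Euc n) :
    curvOp (graphMetric f) i j l p x = ∑ β, ∑ γ, matUinv f x β γ *
      (shape f γ x p i * hess f β x j l - shape f γ x p j * hess f β x i l) := by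
  have e : ∀ β, pd i (fun y => hess f β y j l) x = pd j (fun y => hess f β y i l) x := fun β => by
    have t : ∀ j, (fun y => hess f β y j l) = fun y => hess f β y l j := fun j => by
      ext y; exact hess_comm hf β y j l
    rw [t, t, pd_hess_symm hf]
  -- The products of Christoffel symbols cancel the `hessGrad` terms of their derivatives, and by
  -- `e` the third derivatives cancel as well. Only the terms with `U^{βγ}` survive.
  rw [curvOp, Finset.sum_sub_distrib, sum_christoffel_mul hf, sum_christoffel_mul hf,
    pd_christoffel hf, pd_christoffel hf]
  simp only [e, Finset.sum_sub_distrib, mul_sub]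
  have r : ∀ i j, ∑ β, ∑ γ, matUinv f x β γ * (shape f γ x p i * hess f β x j l) =
      ∑ β, ∑ γ, matUinv f x β γ * shape f γ x p i * hess f β x j l := fun i j => by
    simp only [mul_assoc]
  rw [r, r]
  ring

/-- The Gauss equation. -/
lemma riem_eq (hf : ContDiff ℝ ∞ f) (i j k l : Fin n) (x : Euc n) :
    riem (graphMetric f) i j k l x = ∑ μ, ∑ ν, matUinv f x μ ν *
      (hess f μ x i k * hess f ν x j l - hess f μ x i l * hess f ν x j k) := by
  have low : ∀ γ i, ∑ p, graphMetric f x k p * shape f γ x p i = hess f γ x k i := by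
    intro γ i
    rw [← Matrix.mul_apply, shape_eq hf, ← Matrix.mul_assoc, graphMetric_mul_ginv hf,
      Matrix.one_mul]
  have e : riem (graphMetric f) i j k l x = ∑ β, ∑ γ, matUinv f x β γ *
      ((∑ p, graphMetric f x k p * shape f γ x p i) * hess f β x j l
        - (∑ p, graphMetric f x k p * shape f γ x p j) * hess f β x i l) := by
    simp only [riem, curvOp_eq hf, Finset.mul_sum, Finset.sum_mul, ← Finset.sum_sub_distrib]
    rw [Finset.sum_comm]
    refine Finset.sum_congr rfl fun β _ => ?_
    rw [Finset.sum_comm]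
    refine Finset.sum_congr rfl fun γ _ => Finset.sum_congr rfl fun p _ => by ring
  rw [e]
  simp only [low, mul_sub, Finset.sum_sub_distrib]
  congr 1
  · rw [Finset.sum_comm]
    refine Finset.sum_congr rfl fun μ _ => Finset.sum_congr rfl fun ν _ => ?_
    rw [matUinv_comm hf, hess_comm hf μ x k i]
  · refine Finset.sum_congr rfl fun μ _ => Finset.sum_congr rfl fun ν _ => ?_
    rw [hess_comm hf ν x k j]
    ring

/-- The Ricci tensor of a graph in terms of second fundamental forms. -/
def ricMat (f : Euc n → Euc m) (x : Euc n) : Matrix (Fin n) (Fin n) ℝ :=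
  ∑ μ, ∑ ν, matUinv f x μ ν • ((ginv (graphMetric f) x * hess f μ x).trace • hess f ν x
    - hess f μ x * ginv (graphMetric f) x * hess f ν x)

lemma ric_eq (hf : ContDiff ℝ ∞ f) (j l : Fin n) (x : Euc n) :
    ric (graphMetric f) j l x = ricMat f x j l := by
  have e : ric (graphMetric f) j l x = ∑ μ, ∑ ν, matUinv f x μ ν *
      (∑ i, ∑ k, ginv (graphMetric f) x i k * hess f μ x i k * hess f ν x j l
        - ∑ i, ∑ k, ginv (graphMetric f) x i k * hess f μ x i l * hess f ν x j k) := by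
    simp only [ric, riem_eq hf, Finset.mul_sum, ← Finset.sum_sub_distrib]
    simp only [Finset.sum_comm (s := (Finset.univ : Finset (Fin n)))
      (t := (Finset.univ : Finset (Fin m)))]
    refine Finset.sum_congr rfl fun μ _ => Finset.sum_congr rfl fun ν _ =>
      Finset.sum_congr rfl fun i _ => Finset.sum_congr rfl fun k _ => by ring
  have t : ∀ μ, (ginv (graphMetric f) x * hess f μ x).trace =
      ∑ i, ∑ k, ginv (graphMetric f) x i k * hess f μ x i k := fun μ => by
    simp only [Matrix.trace, Matrix.diag, Matrix.mul_apply]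
    refine Finset.sum_congr rfl fun i _ => Finset.sum_congr rfl fun k _ => ?_
    rw [hess_comm hf μ x k i]
  have s : ∀ μ ν, (hess f ν x * ginv (graphMetric f) x * hess f μ x) j l =
      ∑ i, ∑ k, ginv (graphMetric f) x i k * hess f μ x i l * hess f ν x j k := fun μ ν => by
    simp only [Matrix.mul_apply, Finset.sum_mul]
    refine Finset.sum_congr rfl fun i _ => Finset.sum_congr rfl fun k _ => ?_
    rw [ginv_comm hf x k i]
    ring
  rw [e]
  simp only [ricMat, Matrix.sum_apply, Matrix.smul_apply, Matrix.sub_apply, smul_eq_mul, mul_sub,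
    Finset.sum_sub_distrib, ← s, t, Finset.sum_mul]
  congr 1
  rw [Finset.sum_comm]
  refine Finset.sum_congr rfl fun μ _ => Finset.sum_congr rfl fun ν _ => ?_
  rw [matUinv_comm hf]

lemma sum_raise_two (H R : Matrix (Fin n) (Fin n) ℝ) (hH : Hᵀ = H) (i j : Fin n) :
    ∑ a, ∑ b, H i a * H j b * R a b = (H * R * H) i j := by
  simp only [Matrix.mul_apply, Finset.sum_mul]
  rw [Finset.sum_comm]
  refine Finset.sum_congr rfl fun b _ => Finset.sum_congr rfl fun a _ => ?_
  rw [← Matrix.transpose_apply H b j, hH]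
  ring

lemma ricUp_eq (hf : ContDiff ℝ ∞ f) (i j : Fin n) (x : Euc n) :
    ricUp (graphMetric f) i j x =
      ricRaised (ginv (graphMetric f) x) (fun α => hess f α x) (matUinv f x) i j := by
  simp only [ricUp, ric_eq hf]
  rw [sum_raise_two _ _ (ginv_transpose hf x)]
  refine congrFun (congrFun ?_ i) j
  simp only [ricMat, ricRaised, Finset.mul_sum, Finset.sum_mul, Matrix.mul_sub, Matrix.sub_mul,
    Matrix.mul_smul, Matrix.smul_mul, Matrix.mul_assoc]
  rfl

lemma ricOp_eq (hf : ContDiff ℝ ∞ f) (x : Euc n) :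
    ricOp (graphMetric f) x = ∑ μ, ∑ ν, matUinv f x μ ν •
      ((shape f μ x).trace • shape f ν x - shape f μ x * shape f ν x) := by
  have e : ricOp (graphMetric f) x = ginv (graphMetric f) x * ricMat f x := by
    ext i j
    simp only [ricOp, Matrix.of_apply, Matrix.mul_apply, ric_eq hf]
  rw [e]
  simp only [ricMat, Finset.mul_sum, Matrix.mul_sub, Matrix.mul_smul, shape_eq hf,
    Matrix.mul_assoc]

lemma scal_eq (hf : ContDiff ℝ ∞ f) (x : Euc n) :
    scal (graphMetric f) x =
      scalAlg (ginv (graphMetric f) x) (fun α => hess f α x) (matUinv f x) := by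
  have e : scal (graphMetric f) x = (ricOp (graphMetric f) x).trace := by
    simp only [scal, ricOp, Matrix.trace, Matrix.diag, Matrix.of_apply]
    rw [Finset.sum_comm]
    refine Finset.sum_congr rfl fun i _ => Finset.sum_congr rfl fun j _ => ?_
    rw [ginv_comm hf]
  rw [e, ricOp_eq hf]
  simp only [scalAlg, Matrix.trace_sum, Matrix.trace_smul, Matrix.trace_sub, smul_eq_mul,
    shape_eq hf]

lemma sum_four_comm {ι κ : Type*} [Fintype ι] [Fintype κ] (F : ι → ι → ι → ι → κ → ℝ) :
    ∑ a, ∑ b, ∑ c, ∑ d, ∑ μ, F a b c d μ = ∑ μ, ∑ a, ∑ b, ∑ c, ∑ d, F a b c d μ :=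
  (Finset.sum_congr rfl fun _ _ => (Finset.sum_congr rfl fun _ _ => (Finset.sum_congr rfl
    fun _ _ => Finset.sum_comm).trans Finset.sum_comm).trans Finset.sum_comm).trans Finset.sum_comm

lemma riemUp_eq (hf : ContDiff ℝ ∞ f) (i j k l : Fin n) (x : Euc n) :
    riemUp (graphMetric f) i j k l x = ∑ μ, ∑ ν, matUinv f x μ ν *
      ((ginv (graphMetric f) x * hess f μ x * ginv (graphMetric f) x) i k *
        (ginv (graphMetric f) x * hess f ν x * ginv (graphMetric f) x) j l
      - (ginv (graphMetric f) x * hess f μ x * ginv (graphMetric f) x) i l *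
        (ginv (graphMetric f) x * hess f ν x * ginv (graphMetric f) x) j k) := by
  simp only [← sum_raise_two _ _ (ginv_transpose hf x)]
  set H := ginv (graphMetric f) x
  have e : riemUp (graphMetric f) i j k l x = ∑ μ, ∑ ν, matUinv f x μ ν *
      ∑ a, ∑ b, ∑ c, ∑ d, H i a * H j b * H k c * H l d *
        (hess f μ x a c * hess f ν x b d - hess f μ x a d * hess f ν x b c) := by
    simp only [riemUp, riem_eq hf, Finset.mul_sum]
    refine (sum_four_comm _).trans (Finset.sum_congr rfl fun μ _ => (sum_four_comm _).trans
      (Finset.sum_congr rfl fun ν _ => ?_))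
    refine
      Finset.sum_congr rfl fun a _ => Finset.sum_congr rfl fun b _ =>
      Finset.sum_congr rfl fun c _ => Finset.sum_congr rfl fun d _ => by ring
  rw [e]
  refine Finset.sum_congr rfl fun μ _ => Finset.sum_congr rfl fun ν _ => ?_
  refine congrArg (_ * ·) ?_
  simp only [mul_sub, Finset.sum_sub_distrib]
  have p : ∀ k l, ∑ a, ∑ b, ∑ c, ∑ d, H i a * H j b * H k c * H l d *
      (hess f μ x a c * hess f ν x b d) = (∑ a, ∑ b, H i a * H k b * hess f μ x a b) *
        ∑ a, ∑ b, H j a * H l b * hess f ν x a b := by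
    intro k l
    simp only [Finset.sum_mul_sum]
    refine Finset.sum_congr rfl fun a _ => Finset.sum_congr rfl fun b _ =>
      Finset.sum_congr rfl fun c _ => Finset.sum_congr rfl fun d _ => by ring
  rw [← p k l, ← p l k]
  refine congrArg (_ - ·) ?_
  refine Finset.sum_congr rfl fun a _ => Finset.sum_congr rfl fun b _ => ?_
  rw [Finset.sum_comm]
  refine Finset.sum_congr rfl fun c _ => Finset.sum_congr rfl fun d _ => by ring

lemma tensorP_eq (hf : ContDiff ℝ ∞ f) (i j k l : Fin n) (x : Euc n) :
    tensorP (graphMetric f) i j k l x =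
      tensorPAlg (ginv (graphMetric f) x) (fun α => hess f α x) (matUinv f x) i j k l := by
  simp only [tensorP, tensorPAlg, riemUp_eq hf, ricUp_eq hf, scal_eq hf]

lemma sum_tensorP (hf : ContDiff ℝ ∞ f) (α : Fin m) (X : Matrix (Fin n) (Fin n) ℝ) (x : Euc n) :
    ∑ i, ∑ j, ∑ k, ∑ l, tensorP (graphMetric f) i j k l x * (hess f α x j l * X k i) =
      ∑ μ, ∑ ν, matUinv f x μ ν * ((1 / 2) * alt4 ones (ginv (graphMetric f) x * X)
        (shape f α x) (shape f μ x) (shape f ν x)) := by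
  simp only [tensorP_eq hf, shape_eq hf]
  exact sum_tensorPAlg _ (fun α => hess f α x) _ (matUinv_transpose hf x) _ X
    (hess_transpose hf α x)

/-- Both `P` and the Gauss form of the curvature are antisymmetric in the last two indices, so the
two halves of the Gauss equation contribute equally. This factor 2 cancels the `1 / 2` of
`sum_tensorP`. -/
lemma L2_eq (hf : ContDiff ℝ ∞ f) (x : Euc n) :
    L2 (graphMetric f) x = ∑ α, ∑ β, matUinv f x α β * ∑ μ, ∑ ν, matUinv f x μ ν *
      alt4 ones (shape f β x) (shape f α x) (shape f μ x) (shape f ν x) := by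
  have sw : ∀ a b : Fin m, ∑ i, ∑ j, ∑ k, ∑ l, tensorP (graphMetric f) i j k l x *
      (hess f a x i l * hess f b x j k) = - ∑ i, ∑ j, ∑ k, ∑ l, tensorP (graphMetric f) i j k l x *
      (hess f b x j l * hess f a x k i) := by
    intro a b
    simp only [← Finset.sum_neg_distrib]
    refine Finset.sum_congr rfl fun i _ => Finset.sum_congr rfl fun j _ => ?_
    rw [Finset.sum_comm]
    refine Finset.sum_congr rfl fun k _ => Finset.sum_congr rfl fun l _ => ?_
    rw [tensorP_eq hf, tensorP_eq hf, tensorPAlg_swap_right, hess_comm hf a x i k]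
    ring
  have e : L2 (graphMetric f) x = ∑ β, ∑ α, matUinv f x β α * (2 *
      ∑ i, ∑ j, ∑ k, ∑ l, tensorP (graphMetric f) i j k l x *
        (hess f α x j l * hess f β x k i)) := by
    have c : ∀ β α, 2 * ∑ i, ∑ j, ∑ k, ∑ l, tensorP (graphMetric f) i j k l x *
        (hess f α x j l * hess f β x k i) = ∑ i, ∑ j, ∑ k, ∑ l, tensorP (graphMetric f) i j k l x *
        (hess f β x i k * hess f α x j l - hess f β x i l * hess f α x j k) := by
      intro β α
      simp only [mul_sub, Finset.sum_sub_distrib]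
      rw [sw, two_mul, sub_neg_eq_add]
      refine congrArg (· + _) ?_
      refine Finset.sum_congr rfl fun i _ => Finset.sum_congr rfl fun j _ =>
        Finset.sum_congr rfl fun k _ => Finset.sum_congr rfl fun l _ => ?_
      rw [hess_comm hf β x k i]
      ring
    simp only [c]
    simp only [L2, riem_eq hf, Finset.mul_sum]
    refine (sum_four_comm _).trans (Finset.sum_congr rfl fun μ _ => (sum_four_comm _).trans
      (Finset.sum_congr rfl fun ν _ => ?_))
    refine
      Finset.sum_congr rfl fun a _ => Finset.sum_congr rfl fun b _ =>
      Finset.sum_congr rfl fun c _ => Finset.sum_congr rfl fun d _ => by ring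
  rw [e, Finset.sum_comm]
  simp only [sum_tensorP hf, ← shape_eq hf]
  refine Finset.sum_congr rfl fun α _ => Finset.sum_congr rfl fun β _ => ?_
  rw [matUinv_comm hf, Finset.mul_sum]
  refine congrArg (_ * ·) (Finset.sum_congr rfl fun μ _ => ?_)
  rw [Finset.mul_sum]
  exact Finset.sum_congr rfl fun ν _ => by ring

end Gauss

/-! ### The flux field and its divergence -/

section FluxField

variable {n m : ℕ} {f : Euc n → Euc m}

/-- The vector field `P^{ijkl} ∂_l g_{jk}`. -/
def fluxField (g : Euc n → Matrix (Fin n) (Fin n) ℝ) (i : Fin n) (x : Euc n) : ℝ :=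
  ∑ j, ∑ k, ∑ l, tensorP g i j k l x * pd l (fun y => g y j k) x

/-- The product of second fundamental forms whose alternating contraction gives the flux field. -/
def fluxDensity (f : Euc n → Euc m) (x : Euc n) (K I : Fin 4 → Fin n) : ℝ :=
  ∑ α, ∑ μ, ∑ ν, gradf f α x (K 0) * shape f α x (K 1) (I 1) * shape f μ x (K 2) (I 2) *
    shape f ν x (K 3) (I 3) * matUinv f x μ ν

/-- In `∂_l g_{jk} = f^α_{lj} f^α_k + f^α_j f^α_{lk}` the second product is symmetric in `k, l` and
is killed by the antisymmetry of `P`. -/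
lemma fluxField_eq_sum (hf : ContDiff ℝ ∞ f) (i : Fin n) (x : Euc n) :
    fluxField (graphMetric f) i x = ∑ α, ∑ j, ∑ k, ∑ l, tensorP (graphMetric f) i j k l x *
      (hess f α x j l * jac f x α k) := by
  have z : ∀ α j, ∑ k, ∑ l, tensorP (graphMetric f) i j k l x *
      (jac f x α j * hess f α x l k) = 0 := by
    intro α j
    have h : ∑ k, ∑ l, tensorP (graphMetric f) i j k l x * (jac f x α j * hess f α x l k) =
        - ∑ k, ∑ l, tensorP (graphMetric f) i j k l x * (jac f x α j * hess f α x l k) := by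
      conv_lhs => rw [Finset.sum_comm]
      simp only [← Finset.sum_neg_distrib]
      refine Finset.sum_congr rfl fun k _ => Finset.sum_congr rfl fun l _ => ?_
      rw [tensorP_eq hf, tensorP_eq hf, tensorPAlg_swap_right, hess_comm hf α x k l]
      ring
    linarith
  have e : ∀ α, ∑ j, ∑ k, ∑ l, tensorP (graphMetric f) i j k l x *
      (hess f α x j l * jac f x α k) = ∑ j, ∑ k, ∑ l, tensorP (graphMetric f) i j k l x *
      (hess f α x l j * jac f x α k + jac f x α j * hess f α x l k) := by
    intro α
    simp only [mul_add, Finset.sum_add_distrib, z, add_zero]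
    refine Finset.sum_congr rfl fun j _ => ?_
    simp only [hess_comm hf α x j]
  simp only [e, fluxField, pd_graphMetric hf, Finset.mul_sum]
  conv_rhs => rw [Finset.sum_comm]
  refine Finset.sum_congr rfl fun j _ => ?_
  conv_rhs => rw [Finset.sum_comm]
  refine Finset.sum_congr rfl fun k _ => ?_
  rw [Finset.sum_comm]

lemma fluxField_eq (hf : ContDiff ℝ ∞ f) (i : Fin n) (x : Euc n) :
    fluxField (graphMetric f) i x =
      (1 / 2) * alt (fun K I => if I 0 = i then fluxDensity f x K I else 0) := by
  -- The free index becomes a summed one by inserting a matrix supported in column `i`, so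
  -- `sum_tensorP` applies. Raising its row index turns that column into `∇f^α`.
  have e : ∀ α, ∑ j, ∑ k, ∑ l, tensorP (graphMetric f) i j k l x *
      (hess f α x j l * jac f x α k) = ∑ i', ∑ j, ∑ k, ∑ l, tensorP (graphMetric f) i' j k l x *
      (hess f α x j l * (Matrix.of fun k i' => if i' = i then jac f x α k else 0) k i') := by
    intro α
    symm
    rw [Finset.sum_eq_single i]
    · simp
    · intro b _ hb
      simp [hb]
    · simp
  have c : ∀ α, ginv (graphMetric f) x *
      (Matrix.of fun k i' => if i' = i then jac f x α k else 0) =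
      Matrix.of fun k i' => if i' = i then gradf f α x k else 0 := by
    intro α
    ext k i'
    by_cases h : i' = i
    · simp [Matrix.mul_apply, h, gradf, jac]
    · simp [Matrix.mul_apply, h]
  rw [fluxField_eq_sum hf]
  simp only [e, sum_tensorP hf, c, ← alt_eq_alt4, ← alt_const_mul, ← alt_sum]
  congr 1
  ext K I
  by_cases h : I 0 = i
  · simp only [h, Matrix.of_apply, if_true, fluxDensity, Finset.mul_sum]
    refine Finset.sum_congr rfl fun α _ => Finset.sum_congr rfl fun μ _ =>
      Finset.sum_congr rfl fun ν _ => by ring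
  · simp [h]

lemma contDiff_fluxDensity (hf : ContDiff ℝ ∞ f) (K I : Fin 4 → Fin n) :
    ContDiff ℝ ∞ fun x => fluxDensity f x K I :=
  ContDiff.sum fun α _ => ContDiff.sum fun μ _ => ContDiff.sum fun ν _ =>
    ((((contDiff_gradf hf _ α).mul (contDiff_shape hf α _ _)).mul (contDiff_shape hf μ _ _)).mul
      (contDiff_shape hf ν _ _)).mul (contDiff_matUinv hf μ ν)

lemma contDiff_alt_ite {T : Euc n → (Fin 4 → Fin n) → (Fin 4 → Fin n) → ℝ}
    (hT : ∀ K I, ContDiff ℝ ∞ fun x => T x K I) (i : Fin n) :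
    ContDiff ℝ ∞ fun x => alt (fun K I => if I 0 = i then T x K I else 0) := by
  unfold alt
  refine ContDiff.sum fun K _ => ContDiff.sum fun I _ => contDiff_const.mul ?_
  change ContDiff ℝ ∞ fun x => if I 0 = i then T x K I else 0
  split_ifs
  · exact hT K I
  · exact contDiff_const

lemma contDiff_fluxField (hf : ContDiff ℝ ∞ f) (i : Fin n) :
    ContDiff ℝ ∞ (fluxField (graphMetric f) i) := by
  rw [show fluxField (graphMetric f) i = _ from funext (fluxField_eq hf i)]
  exact contDiff_const.mul (contDiff_alt_ite (contDiff_fluxDensity hf) i)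

/-- The delta is constant, so the divergence passes inside and differentiates in the direction of
the first lower index. -/
lemma sum_pd_alt_ite {T : Euc n → (Fin 4 → Fin n) → (Fin 4 → Fin n) → ℝ}
    (hT : ∀ K I, ContDiff ℝ ∞ fun x => T x K I) (x : Euc n) :
    ∑ i, pd i (fun y => alt (fun K I => if I 0 = i then T y K I else 0)) x =
      alt (fun K I => pd (I 0) (fun y => T y K I) x) := by
  have hs : ∀ i K I, ContDiff ℝ ∞ fun y => if (I : Fin 4 → Fin n) 0 = i then T y K I else 0 := by
    intro i K I
    split_ifs
    · exact hT K I
    · exact contDiff_const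
  have e : ∀ i, pd i (fun y => alt (fun K I => if I 0 = i then T y K I else 0)) x =
      ∑ K, ∑ I, kdelta K I * if I 0 = i then pd i (fun y => T y K I) x else 0 := by
    intro i
    unfold alt
    rw [pd_sum fun K => ContDiff.sum fun I _ => contDiff_const.mul (hs i K I)]
    refine Finset.sum_congr rfl fun K _ => ?_
    rw [pd_sum fun I => contDiff_const.mul (hs i K I)]
    refine Finset.sum_congr rfl fun I _ => ?_
    rw [pd_const_mul (hs i K I)]
    split_ifs
    · rfl
    · rw [pd_const]
  rw [Finset.sum_congr rfl fun i _ => e i, alt, Finset.sum_comm]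
  refine Finset.sum_congr rfl fun K _ => ?_
  rw [Finset.sum_comm]
  refine Finset.sum_congr rfl fun I _ => ?_
  rw [← Finset.mul_sum, Finset.sum_ite_eq]
  simp

lemma pd_fluxDensity (hf : ContDiff ℝ ∞ f) (K I : Fin 4 → Fin n) (i : Fin n) (x : Euc n) :
    pd i (fun y => fluxDensity f y K I) x = ∑ α, ∑ μ, ∑ ν,
      (pd i (fun y => gradf f α y (K 0)) x * shape f α x (K 1) (I 1) * shape f μ x (K 2) (I 2)
          * shape f ν x (K 3) (I 3) * matUinv f x μ ν
      + gradf f α x (K 0) * pd i (fun y => shape f α y (K 1) (I 1)) x * shape f μ x (K 2) (I 2)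
          * shape f ν x (K 3) (I 3) * matUinv f x μ ν
      + gradf f α x (K 0) * shape f α x (K 1) (I 1) * pd i (fun y => shape f μ y (K 2) (I 2)) x
          * shape f ν x (K 3) (I 3) * matUinv f x μ ν
      + gradf f α x (K 0) * shape f α x (K 1) (I 1) * shape f μ x (K 2) (I 2)
          * pd i (fun y => shape f ν y (K 3) (I 3)) x * matUinv f x μ ν
      + gradf f α x (K 0) * shape f α x (K 1) (I 1) * shape f μ x (K 2) (I 2)
          * shape f ν x (K 3) (I 3) * pd i (fun y => matUinv f y μ ν) x) := by
  have s1 := fun α => contDiff_gradf hf (K 0) α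
  have s2 := fun α => (s1 α).mul (contDiff_shape hf α (K 1) (I 1))
  have s3 := fun α μ => (s2 α).mul (contDiff_shape hf μ (K 2) (I 2))
  have s4 := fun α μ ν => (s3 α μ).mul (contDiff_shape hf ν (K 3) (I 3))
  have s5 := fun α μ ν => (s4 α μ ν).mul (contDiff_matUinv hf μ ν)
  unfold fluxDensity
  rw [pd_sum fun α => ContDiff.sum fun μ _ => ContDiff.sum fun ν _ => s5 α μ ν]
  refine Finset.sum_congr rfl fun α _ => ?_
  rw [pd_sum fun μ => ContDiff.sum fun ν _ => s5 α μ ν]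
  refine Finset.sum_congr rfl fun μ _ => ?_
  rw [pd_sum fun ν => s5 α μ ν]
  refine Finset.sum_congr rfl fun ν _ => ?_
  rw [pd_mul (s4 α μ ν) (contDiff_matUinv hf μ ν), pd_mul (s3 α μ) (contDiff_shape hf ν _ _),
    pd_mul (s2 α) (contDiff_shape hf μ _ _), pd_mul (s1 α) (contDiff_shape hf α _ _)]
  ring

/-- Half of `L₂^⊥`, summed over pairs of normal directions. -/
def halfPerp (f : Euc n → Euc m) (x : Euc n) : ℝ :=
  ∑ μ, ∑ ν, matUinv f x μ ν * ∑ α, ∑ γ, perpSummand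
    (pairing (graphMetric f x) (gradf f α x) (gradf f γ x)) (shape f α x) (shape f γ x)
    (shape f μ x) (shape f ν x)

lemma shape_selfAdjoint (hf : ContDiff ℝ ∞ f) (α : Fin m) (x : Euc n) :
    (shape f α x)ᵀ * graphMetric f x = graphMetric f x * shape f α x := by
  rw [shape_eq hf, Matrix.transpose_mul, ginv_transpose hf, hess_transpose hf, Matrix.mul_assoc,
    ginv_mul_graphMetric hf, ← Matrix.mul_assoc, graphMetric_mul_ginv hf, Matrix.mul_one,
    Matrix.one_mul]

lemma alt4_hessSq (hf : ContDiff ℝ ∞ f) (x : Euc n) (α β a b c d : Fin m) :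
    alt4 (hessSq f β α x) (colMat (gradf f a x)) (colMat (gradf f b x)) (shape f c x)
      (shape f d x) = rankOneExpansion (fun X Y =>
        pairing (graphMetric f x) (gradf f a x) (gradf f b x)
          (Y * (shape f α x * shape f β x - shape f β x * shape f α x) * X))
        (shape f c x) (shape f d x) := by
  rw [hessSq, alt4_rankOne (graphMetric_transpose hf x) (ginv_transpose hf x)
    (graphMetric_mul_ginv hf x) _ _ _ _ (hess_transpose hf α x) (hess_transpose hf β x)
    (shape_selfAdjoint hf c x) (shape_selfAdjoint hf d x)]
  simp only [shape_eq hf]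

/-- The Euclidean divergence of the flux field. -/
theorem sum_pd_fluxField (hf : ContDiff ℝ ∞ f) (x : Euc n) :
    ∑ i, pd i (fluxField (graphMetric f) i) x = (1 / 2) * L2 (graphMetric f) x + halfPerp f x := by
  have e : ∀ i, fluxField (graphMetric f) i = fun y =>
      (1 / 2) * alt (fun K I => if I 0 = i then fluxDensity f y K I else 0) :=
    fun i => funext (fluxField_eq hf i)
  simp only [e]
  simp only [pd_const_mul (contDiff_alt_ite (contDiff_fluxDensity hf) _), ← Finset.mul_sum]
  rw [sum_pd_alt_ite (contDiff_fluxDensity hf)]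
  simp only [pd_fluxDensity hf]
  rw [alt_divergence (fun α => shape f α x) (fun α => gradf f α x) (matUinv f x)
    (matUinv_transpose hf x) (fun α β => hessGrad f α β x) (fun α β => hessSq f α β x)
    (thirdUp f x) (thirdUp_symm hf x) (fun α k i => pd i (fun y => gradf f α y k) x)
    (fun α l j i => pd i (fun y => shape f α y l j) x)
    (fun μ ν i => pd i (fun y => matUinv f y μ ν) x)
    (fun α k i => pd_gradf hf α k i x) (fun α l j i => pd_shape hf α l j i x)
    (fun α β i => pd_matUinv hf α β i x)]
  -- The unweighted part is `L2`. For the rest, the `L₂^⊥` side is rewritten in the form that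
  -- differentiation produces, the two being equal by `sum_divSummand_eq`.
  rw [← L2_eq hf, halfPerp, ← sum_divSummand_eq _ (graphMetric_transpose hf x) _
    (fun μ => shape_selfAdjoint hf μ x) _ (matUinv_transpose hf x)]
  rw [mul_sub, sub_eq_add_neg]
  congr 1
  simp only [Finset.mul_sum, ← Finset.sum_neg_distrib, alt4_hessSq hf, divSummand]
  refine Finset.sum_congr rfl fun μ _ => Finset.sum_congr rfl fun ν _ =>
    Finset.sum_congr rfl fun α _ => Finset.sum_congr rfl fun γ _ => by ring

end FluxField

/-! ### Identification of `L2perp` -/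

section HalfPerp

variable {n m : ℕ} {f : Euc n → Euc m}

lemma gInner_mulVec (x : Euc n) (W : Matrix (Fin n) (Fin n) ℝ) (u v : Fin n → ℝ) :
    gInner f x (W *ᵥ u) v = pairing (graphMetric f x) u v W := rfl

lemma opT_eq (γ : Fin m) (x : Euc n) : opT f γ x = ∑ μ, ∑ ν, matUinv f x μ ν •
    opTSummand (shape f γ x) (shape f μ x) (shape f ν x) := rfl

/-- Each of `Rc`, `R` and `T^⊥` hides one sum over `U^{μν}`. Once these are pulled out, all lines of
the definition are sums of quartic expressions in shape operators with the same weight. -/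
lemma L2perp_eq (hf : ContDiff ℝ ∞ f) (x : Euc n) : L2perp f x = 2 * halfPerp f x := by
  have q : ∀ G : Fin m → Fin m → Fin m → Fin m → ℝ,
      ∑ α, ∑ γ, ∑ μ, ∑ ν, matUinv f x μ ν * G μ ν α γ =
        ∑ μ, ∑ ν, matUinv f x μ ν * ∑ α, ∑ γ, G μ ν α γ := by
    intro G
    simp only [Finset.mul_sum]
    refine ((Finset.sum_congr rfl fun α _ => Finset.sum_comm).trans Finset.sum_comm).trans
      (Finset.sum_congr rfl fun μ _ => ?_)
    exact (Finset.sum_congr rfl fun α _ => Finset.sum_comm).trans Finset.sum_comm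
  have e2 : ∀ α γ, (2 : ℝ) • (ricOp (graphMetric f) x * normalCurv f α γ x)
      + opT f γ x * shape f α x + shape f α x * opT f γ x = ∑ μ, ∑ ν, matUinv f x μ ν •
        ((2 : ℝ) • (((shape f μ x).trace • shape f ν x - shape f μ x * shape f ν x)
            * normalCurv f α γ x)
          + opTSummand (shape f γ x) (shape f μ x) (shape f ν x) * shape f α x
          + shape f α x * opTSummand (shape f γ x) (shape f μ x) (shape f ν x)) := by
    intro α γ
    simp only [ricOp_eq hf, opT_eq, Finset.sum_mul, Finset.mul_sum, Finset.smul_sum, smul_add,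
      ← Finset.sum_add_distrib, Matrix.smul_mul, Matrix.mul_smul]
    refine Finset.sum_congr rfl fun μ _ => Finset.sum_congr rfl fun ν _ => ?_
    rw [smul_comm (2 : ℝ)]
  have e4 : scal (graphMetric f) x = ∑ μ, ∑ ν, matUinv f x μ ν *
      ((shape f μ x).trace * (shape f ν x).trace - (shape f μ x * shape f ν x).trace) := by
    simp only [scal_eq hf, scalAlg, ← shape_eq hf]
  have e5 : ∀ G : Fin m → Fin m → ℝ, (1 / 2) * scal (graphMetric f) x * ∑ α, ∑ γ, G α γ =
      ∑ μ, ∑ ν, matUinv f x μ ν * ∑ α, ∑ γ, (1 / 2) * ((shape f μ x).trace * (shape f ν x).trace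
        - (shape f μ x * shape f ν x).trace) * G α γ := by
    intro G
    simp only [← Finset.mul_sum]
    rw [e4]
    generalize ∑ α, ∑ γ, G α γ = s
    simp only [Finset.mul_sum, Finset.sum_mul]
    exact Finset.sum_congr rfl fun μ _ => Finset.sum_congr rfl fun ν _ => by ring
  rw [L2perp, halfPerp, e5]
  congr 1
  simp only [gInner_mulVec, e2]
  simp only [opT_eq, Finset.smul_sum, smul_comm _ (matUinv f x _ _), map_sum,
    map_smul, smul_eq_mul, q]
  simp only [Finset.mul_sum, ← Finset.sum_add_distrib, ← Finset.sum_sub_distrib]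
  refine Finset.sum_congr rfl fun μ _ => Finset.sum_congr rfl fun ν _ =>
    Finset.sum_congr rfl fun α _ => Finset.sum_congr rfl fun γ _ => ?_
  simp only [perpSummand, normalCurv, map_smul, smul_eq_mul]
  ring

end HalfPerp

/-! ### The Ricci equation and flat normal bundles -/

section FlatNormal

variable {n m : ℕ} {f : Euc n → Euc m}

lemma inner_tang_normalVec (hf : ContDiff ℝ ∞ f) (i : Fin n) (α : Fin m) (x : Euc n) :
    inner ℝ (tang f i x) (normalVec f α x) = 0 := by
  rw [tang_eq hf]
  simp [normalVec, PiLp.inner_apply, Fintype.sum_sum_type, Pi.single_apply, jac]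

lemma normalVec_mem (hf : ContDiff ℝ ∞ f) (α : Fin m) (x : Euc n) :
    normalVec f α x ∈ (tangentSp f x)ᗮ := by
  rw [tangentSp, Submodule.mem_orthogonal]
  intro u hu
  induction hu using Submodule.span_induction with
  | mem u hu => obtain ⟨i, rfl⟩ := hu; exact inner_tang_normalVec hf i α x
  | zero => simp
  | add u v _ _ hu hv => rw [inner_add_left, hu, hv, add_zero]
  | smul c u _ hu => rw [inner_smul_left, hu, mul_zero]

lemma tang_mem (i : Fin n) (x : Euc n) : tang f i x ∈ tangentSp f x :=
  Submodule.subset_span ⟨i, rfl⟩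

lemma contDiff_tang (hf : ContDiff ℝ ∞ f) (i : Fin n) : ContDiff ℝ ∞ (tang f i) :=
  contDiff_pd (contDiff_graphMap hf) i

lemma pd_tang (hf : ContDiff ℝ ∞ f) (i j : Fin n) (x : Euc n) : pd i (tang f j) x =
    WithLp.toLp 2 (Sum.elim (fun _ => 0) (fun α => hess f α x i j)) := by
  ext (k | α)
  · rw [pd_apply (contDiff_tang hf j)]
    simp only [tang_eq hf]
    exact pd_const _ i x
  · rw [pd_apply (contDiff_tang hf j)]
    simp only [tang_eq hf]
    rfl

/-- The Weingarten formula for the normal frame. -/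
lemma normalConn_normalVec (hf : ContDiff ℝ ∞ f) (i : Fin n) (α : Fin m) (x : Euc n) :
    normalConn f i (normalVec f α) x =
      pd i (normalVec f α) x + ∑ p, shape f α x p i • tang f p x := by
  rw [normalConn]
  refine Submodule.eq_starProjection_of_mem_orthogonal' (z := - ∑ p, shape f α x p i • tang f p x)
    ?_ ?_ (by abel)
  · rw [tangentSp, Submodule.mem_orthogonal]
    intro u hu
    induction hu using Submodule.span_induction with
    | mem u hu =>
      obtain ⟨k, rfl⟩ := hu
      have h1 : ∑ p, shape f α x p i * graphMetric f x k p = hess f α x k i := by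
        have : graphMetric f x * shape f α x = hess f α x := by
          rw [shape_eq hf, ← Matrix.mul_assoc, graphMetric_mul_ginv hf, Matrix.one_mul]
        rw [← this, Matrix.mul_apply]
        exact Finset.sum_congr rfl fun p _ => mul_comm _ _
      have h2 : inner ℝ (tang f k x) (pd i (normalVec f α) x) = - hess f α x i k := by
        rw [pd_normalVec hf, tang_eq hf]
        simp [PiLp.inner_apply, Fintype.sum_sum_type]
      rw [inner_add_right, inner_sum, h2]
      simp only [inner_smul_right]
      rw [hess_comm hf, ← h1]
      simp [graphMetric]
    | zero => simp
    | add u v _ _ hu hv => rw [inner_add_left, hu, hv, add_zero]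
    | smul c u _ hu => rw [inner_smul_left, hu, mul_zero]
  · rw [Submodule.orthogonal_orthogonal]
    exact Submodule.neg_mem _ (Submodule.sum_mem _ fun p _ => Submodule.smul_mem _ _ (tang_mem p x))

lemma pd_add_sum_smul {F : Type*} [NormedAddCommGroup F] [NormedSpace ℝ F] {κ : Type*}
    [Fintype κ] {a : Euc n → F} {c : κ → Euc n → ℝ} {t : κ → Euc n → F} (ha : ContDiff ℝ ∞ a)
    (hc : ∀ p, ContDiff ℝ ∞ (c p)) (ht : ∀ p, ContDiff ℝ ∞ (t p)) (i : Fin n) (x : Euc n) :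
    pd i (fun y => a y + ∑ p, c p y • t p y) x =
      pd i a x + ∑ p, (c p x • pd i (t p) x + pd i (c p) x • t p x) := by
  have hc' := fun p => (hc p).differentiable (by simp) x
  have ht' := fun p => (ht p).differentiable (by simp) x
  unfold pd
  rw [fderiv_fun_add (ha.differentiable (by simp) x)
    (DifferentiableAt.fun_sum fun p _ => (hc' p).fun_smul (ht' p)),
    fderiv_fun_sum fun p _ => (hc' p).fun_smul (ht' p), add_apply, sum_apply]
  congr 1
  refine Finset.sum_congr rfl fun p _ => ?_
  rw [fderiv_fun_smul (hc' p) (ht' p)]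
  simp

/-- Pairing with the normal vector `η^β` removes the outer projection. In the derivative of the
Weingarten formula, tangent vectors pair to zero, so from the correction term only the derivatives
of the `∂_p` remain. -/
lemma inner_normalConn_normalConn (hf : ContDiff ℝ ∞ f) (i j : Fin n) (α β : Fin m) (x : Euc n) :
    inner ℝ (normalVec f β x) (normalConn f i (normalConn f j (normalVec f α)) x) =
      inner ℝ (normalVec f β x) (pd i (pd j (normalVec f α)) x) + hessSq f β α x i j := by
  have e : normalConn f j (normalVec f α) = fun y =>
      pd j (normalVec f α) y + ∑ p, shape f α y p j • tang f p y :=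
    funext (normalConn_normalVec hf j α)
  have h1 : ∀ p, inner ℝ (normalVec f β x) (pd i (tang f p) x) = hess f β x i p := by
    intro p
    rw [pd_tang hf]
    simp [normalVec, PiLp.inner_apply, Fintype.sum_sum_type, Pi.single_apply]
  have h2 : ∀ p, inner ℝ (normalVec f β x) (tang f p x) = 0 := fun p => by
    rw [real_inner_comm, inner_tang_normalVec hf]
  conv_lhs => rw [normalConn]
  rw [← Submodule.inner_starProjection_left_eq_right,
    Submodule.starProjection_eq_self_iff.mpr (normalVec_mem hf β x), e,
    pd_add_sum_smul (contDiff_pd (contDiff_normalVec hf α) j)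
      (fun p => contDiff_shape hf α p j) (fun p => contDiff_tang hf p), inner_add_right, inner_sum]
  congr 1
  simp only [inner_add_right, inner_smul_right, h1, h2, mul_zero, add_zero]
  rw [hessSq, Matrix.mul_assoc, ← shape_eq hf, Matrix.mul_apply]
  exact Finset.sum_congr rfl fun p _ => mul_comm _ _

/-- This is the Ricci equation: ordinary derivatives commute, so the curvature of the normal
connection on the frame `η^α` is the antisymmetric part of `hessSq`. Raising an index of that part
gives `R^⊥`. -/
lemma normalCurv_eq_zero (hf : ContDiff ℝ ∞ f) (h : FlatNormalBundle f) (α β : Fin m)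
    (x : Euc n) : normalCurv f α β x = 0 := by
  have hs : hessSq f β α x = hessSq f α β x := by
    ext i j
    have e := h (normalVec f α) ⟨contDiff_normalVec hf α, normalVec_mem hf α⟩ i j x
    have e2 := congrArg (fun v => inner ℝ (normalVec f β x) v) e
    simp only [inner_normalConn_normalConn hf, pd_comm (contDiff_normalVec hf α) i j] at e2
    have t : hessSq f β α x j i = hessSq f α β x i j := by
      rw [hessSq, hessSq, ← Matrix.transpose_apply (_ * _ * _)]
      simp only [Matrix.transpose_mul, hess_transpose hf, ginv_transpose hf, Matrix.mul_assoc]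
    rw [← t]
    linarith
  have e : normalCurv f α β x = ginv (graphMetric f) x * (hessSq f β α x - hessSq f α β x) := by
    simp only [normalCurv, shape_eq hf, hessSq, Matrix.mul_sub, Matrix.mul_assoc]
  rw [e, hs, sub_self, Matrix.mul_zero]

end FlatNormal

/-! ### Integration in polar coordinates -/

section PolarCoordinates

variable {n : ℕ}

/-- Integration in polar coordinates. -/
lemma integral_eq_integral_sphereIntegral [Nontrivial (Euc n)] {k : Euc n → ℝ} (hk : Integrable k) :
    ∫ x, k x = ∫ r in Set.Ioi (0 : ℝ), sphereIntegral r k := by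
  have hmp := (volume : Measure (Euc n)).measurePreserving_homeomorphUnitSphereProd
  have hemb := (homeomorphUnitSphereProd (Euc n)).measurableEmbedding
  have hg : ∀ x : ({0}ᶜ : Set (Euc n)), (fun p : Metric.sphere (0 : Euc n) 1 × Set.Ioi (0 : ℝ) =>
      k ((p.2 : ℝ) • (p.1 : Euc n))) (homeomorphUnitSphereProd (Euc n) x) = k x.1 := by
    intro x
    have := congrArg (Subtype.val) ((homeomorphUnitSphereProd (Euc n)).symm_apply_apply x)
    rw [homeomorphUnitSphereProd_symm_apply_coe] at this
    exact congrArg k this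
  have hint : Integrable (fun p : Metric.sphere (0 : Euc n) 1 × Set.Ioi (0 : ℝ) =>
      k ((p.2 : ℝ) • (p.1 : Euc n)))
      ((volume : Measure (Euc n)).toSphere.prod
        (Measure.volumeIoiPow (Module.finrank ℝ (Euc n) - 1))) := by
    rw [← hmp.integrable_comp_emb hemb]
    have : Integrable (fun x : ({0}ᶜ : Set (Euc n)) => k x.1)
        (Measure.comap Subtype.val (volume : Measure (Euc n))) :=
      (integrableOn_iff_comap_subtypeVal (measurableSet_singleton _).compl).mp hk.integrableOn
    refine this.congr (Eventually.of_forall fun x => (hg x).symm)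
  calc ∫ x, k x = ∫ x : ({0}ᶜ : Set (Euc n)), k x.1
        ∂((volume : Measure (Euc n)).comap Subtype.val) := by
        rw [integral_subtype_comap (measurableSet_singleton _).compl k, restrict_compl_singleton]
    _ = ∫ p : Metric.sphere (0 : Euc n) 1 × Set.Ioi (0 : ℝ), k ((p.2 : ℝ) • (p.1 : Euc n))
        ∂((volume : Measure (Euc n)).toSphere.prod
          (Measure.volumeIoiPow (Module.finrank ℝ (Euc n) - 1))) := by
        rw [← hmp.integral_comp hemb]
        exact integral_congr_ae (Eventually.of_forall fun x => (hg x).symm)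
    _ = ∫ r : Set.Ioi (0 : ℝ), (∫ w : Metric.sphere (0 : Euc n) 1, k ((r : ℝ) • (w : Euc n))
          ∂(volume : Measure (Euc n)).toSphere)
          ∂(Measure.volumeIoiPow (Module.finrank ℝ (Euc n) - 1)) := integral_prod_symm _ hint
    _ = _ := by
        simp only [Measure.volumeIoiPow, ENNReal.ofReal]
        rw [integral_withDensity_eq_integral_smul, integral_subtype_comap measurableSet_Ioi
          fun a : ℝ => Real.toNNReal (a ^ (Module.finrank ℝ (Euc n) - 1)) •
            ∫ w : Metric.sphere (0 : Euc n) 1, k (a • (w : Euc n))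
              ∂(volume : Measure (Euc n)).toSphere]
        · refine setIntegral_congr_fun measurableSet_Ioi fun r hr => ?_
          simp only [NNReal.smul_def, Real.coe_toNNReal _ (pow_nonneg (Set.mem_Ioi.mp hr).le _),
            sphereIntegral, finrank_euclideanSpace_fin, smul_eq_mul]
        · exact (measurable_subtype_coe.pow_const _).real_toNNReal

lemma continuous_sphereIntegral {k : Euc n → ℝ} (hk : Continuous k) :
    Continuous fun r => sphereIntegral r k := by
  unfold sphereIntegral
  refine (continuous_pow _).mul ?_
  have h := continuous_parametric_integral_of_continuous
    (μ := (volume : Measure (Euc n)).toSphere) (f := fun (r : ℝ)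
      (w : Metric.sphere (0 : Euc n) 1) => k (r • (w : Euc n)))
    (by unfold Function.uncurry; fun_prop) isCompact_univ
  simpa only [setIntegral_univ] using h

lemma sphereIntegral_const_mul (r c : ℝ) (k : Euc n → ℝ) :
    sphereIntegral r (fun x => c * k x) = c * sphereIntegral r k := by
  simp only [sphereIntegral, integral_const_mul]
  ring

lemma sphereIntegral_congr {r : ℝ} (hr : 0 ≤ r) {k k' : Euc n → ℝ}
    (h : ∀ x, ‖x‖ = r → k x = k' x) : sphereIntegral r k = sphereIntegral r k' := by
  unfold sphereIntegral
  congr 1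
  refine integral_congr_ae (Eventually.of_forall fun w => h _ ?_)
  rw [norm_smul, mem_sphere_zero_iff_norm.mp w.2, mul_one, Real.norm_of_nonneg hr]

lemma sphereIntegral_add (r : ℝ) {k k' : Euc n → ℝ} (hk : Continuous k) (hk' : Continuous k') :
    sphereIntegral r (fun x => k x + k' x) = sphereIntegral r k + sphereIntegral r k' := by
  unfold sphereIntegral
  rw [integral_add, mul_add]
  · exact Continuous.integrable_of_hasCompactSupport (by fun_prop)
      (HasCompactSupport.of_compactSpace _)
  · exact Continuous.integrable_of_hasCompactSupport (by fun_prop)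
      (HasCompactSupport.of_compactSpace _)

lemma integral_closedBall_eq [Nontrivial (Euc n)] {k : Euc n → ℝ} (hk : Continuous k) {r : ℝ}
    (hr : 0 ≤ r) :
    ∫ x in Metric.closedBall (0 : Euc n) r, k x = ∫ t in (0 : ℝ)..r, sphereIntegral t k := by
  have hi : IntegrableOn k (Metric.closedBall (0 : Euc n) r) :=
    hk.continuousOn.integrableOn_compact (isCompact_closedBall _ _)
  rw [← integral_indicator Metric.isClosed_closedBall.measurableSet,
    integral_eq_integral_sphereIntegral
      ((integrable_indicator_iff Metric.isClosed_closedBall.measurableSet).mpr hi),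
    intervalIntegral.integral_of_le hr, ← Set.Ioi_inter_Iic, ← setIntegral_indicator
      measurableSet_Iic]
  refine setIntegral_congr_fun measurableSet_Ioi fun t ht => ?_
  by_cases htr : t ≤ r
  · rw [Set.indicator_of_mem (Set.mem_Iic.mpr htr)]
    refine sphereIntegral_congr (Set.mem_Ioi.mp ht).le fun x hx => ?_
    exact Set.indicator_of_mem (by simpa [hx] using htr) _
  · rw [Set.indicator_of_notMem (by simpa using htr),
      sphereIntegral_congr (k' := fun _ => 0 * 0) (Set.mem_Ioi.mp ht).le fun x hx => ?_,
      sphereIntegral_const_mul, zero_mul]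
    rw [Set.indicator_of_notMem (by simpa [hx] using htr), zero_mul]

end PolarCoordinates

/-! ### The divergence theorem on balls -/

section Divergence

variable {n : ℕ}

lemma hasCompactSupport_comp_norm_sq {φ : ℝ → ℝ} {R : ℝ} (hφ : ∀ s, R ^ 2 ≤ s → φ s = 0) :
    HasCompactSupport fun x : Euc n => φ (‖x‖ ^ 2) := by
  refine HasCompactSupport.intro (isCompact_closedBall (0 : Euc n) |R|) fun x hx => hφ _ ?_
  rw [← sq_abs R]
  have : |R| < ‖x‖ := by simpa using hx
  gcongr

/-- Integration by parts against a radial cutoff function. -/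
lemma integral_radial_mul_div {V : Fin n → Euc n → ℝ} (hV : ∀ i, ContDiff ℝ ∞ (V i))
    {φ b : ℝ → ℝ} (hb : Continuous b) (hφ : ∀ s, HasDerivAt φ (b s) s) {R : ℝ}
    (hφR : ∀ s, R ^ 2 ≤ s → φ s = 0) (hbR : ∀ s, R ^ 2 ≤ s → b s = 0) :
    ∫ x : Euc n, (φ (‖x‖ ^ 2) * ∑ i, pd i (V i) x + 2 * b (‖x‖ ^ 2) * ∑ i, V i x * x i) = 0 := by
  have hφc : Continuous φ := continuous_iff_continuousAt.mpr fun s => (hφ s).continuousAt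
  have hVc : ∀ i, Continuous (V i) := fun i => (hV i).continuous
  have hpc : ∀ i, Continuous (pd i (V i)) := fun i => (contDiff_pd (hV i) i).continuous
  -- The cutoff is a function of `‖x‖ ^ 2` because the norm itself is not differentiable at the
  -- origin.
  have hd : ∀ x : Euc n, HasFDerivAt (fun x : Euc n => φ (‖x‖ ^ 2))
      (b (‖x‖ ^ 2) • ((2 : ℕ) • innerSL ℝ x)) x := fun x =>
    (hφ (‖x‖ ^ 2)).comp_hasFDerivAt x (hasStrictFDerivAt_norm_sq x).hasFDerivAt
  have hd' : ∀ (x : Euc n) i, fderiv ℝ (fun x : Euc n => φ (‖x‖ ^ 2)) x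
      (EuclideanSpace.single i 1) = 2 * b (‖x‖ ^ 2) * x i := by
    intro x i
    rw [(hd x).fderiv]
    simp [EuclideanSpace.inner_single_right]
    ring
  have sφ := hasCompactSupport_comp_norm_sq (n := n) hφR
  have sb := hasCompactSupport_comp_norm_sq (n := n) hbR
  have i1 : ∀ i, Integrable fun x : Euc n => φ (‖x‖ ^ 2) * pd i (V i) x := fun i =>
    Continuous.integrable_of_hasCompactSupport (by have := hpc i; fun_prop) sφ.mul_right
  have i2 : ∀ i, Integrable fun x : Euc n => 2 * b (‖x‖ ^ 2) * x i * V i x := fun i =>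
    Continuous.integrable_of_hasCompactSupport (by have := hVc i; fun_prop)
      (sb.mul_left.mul_right.mul_right)
  have i3 : ∀ i, Integrable fun x : Euc n => φ (‖x‖ ^ 2) * V i x := fun i =>
    Continuous.integrable_of_hasCompactSupport (by have := hVc i; fun_prop) sφ.mul_right
  have key : ∀ i, ∫ x : Euc n, φ (‖x‖ ^ 2) * pd i (V i) x =
      - ∫ x : Euc n, 2 * b (‖x‖ ^ 2) * x i * V i x := by
    intro i
    have := integral_mul_fderiv_eq_neg_fderiv_mul_of_integrable (μ := (volume : Measure (Euc n)))
      (f := fun x : Euc n => φ (‖x‖ ^ 2)) (g := V i) (v := EuclideanSpace.single i 1)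
      (by simpa only [hd'] using i2 i) (i1 i) (i3 i)
      (fun x _ => (hd x).differentiableAt) (fun x _ => (hV i).differentiable (by simp) x)
    simp only [hd'] at this
    exact this
  have e : ∀ x : Euc n, φ (‖x‖ ^ 2) * ∑ i, pd i (V i) x + 2 * b (‖x‖ ^ 2) * ∑ i, V i x * x i =
      ∑ i, (φ (‖x‖ ^ 2) * pd i (V i) x + 2 * b (‖x‖ ^ 2) * x i * V i x) := fun x => by
    rw [Finset.mul_sum, Finset.mul_sum, ← Finset.sum_add_distrib]
    exact Finset.sum_congr rfl fun i _ => by ring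
  simp only [e]
  have i4 : ∀ i, Integrable fun x : Euc n =>
      φ (‖x‖ ^ 2) * pd i (V i) x + 2 * b (‖x‖ ^ 2) * x i * V i x := fun i => (i1 i).add (i2 i)
  rw [integral_finsetSum _ fun i _ => i4 i]
  refine Finset.sum_eq_zero fun i _ => ?_
  rw [integral_add (i1 i) (i2 i), key, neg_add_cancel]

/-- The divergence theorem on balls, before dividing by the radius. -/
lemma sphereIntegral_eq_mul_integral_div [Nontrivial (Euc n)] {V : Fin n → Euc n → ℝ}
    (hV : ∀ i, ContDiff ℝ ∞ (V i))
    {r : ℝ} (hr : 0 ≤ r) : sphereIntegral r (fun x => ∑ i, V i x * x i) =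
      r * ∫ t in (0 : ℝ)..r, sphereIntegral t fun x => ∑ i, pd i (V i) x := by
  have hVc : ∀ i, Continuous (V i) := fun i => (hV i).continuous
  have hpc : ∀ i, Continuous (pd i (V i)) := fun i => (contDiff_pd (hV i) i).continuous
  have hXc : Continuous fun x : Euc n => ∑ i, V i x * x i := by fun_prop
  have hhc : Continuous fun x : Euc n => ∑ i, pd i (V i) x := by fun_prop
  set H : ℝ → ℝ := fun t => sphereIntegral t fun x => ∑ i, pd i (V i) x with hH
  set X : ℝ → ℝ := fun t => sphereIntegral t fun x => ∑ i, V i x * x i with hX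
  have hHc : Continuous H := continuous_sphereIntegral hhc
  have hXc' : Continuous X := continuous_sphereIntegral hXc
  set J : ℝ → ℝ := fun t => ∫ s in (0 : ℝ)..t, H s with hJ
  have hJd : ∀ t, HasDerivAt J (H t) t := fun t => hHc.integral_hasStrictDerivAt 0 t |>.hasDerivAt
  have hJc : Continuous J := continuous_iff_continuousAt.mpr fun t => (hJd t).continuousAt
  -- `X t` is `t` times the flux through the sphere and `J t` is the integral of the divergence over
  -- the ball, so `u` measures the failure of the theorem.
  set u : ℝ → ℝ := fun t => X t - t * J t with hu
  have huc : Continuous u := by fun_prop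
  by_contra hne
  have hur : u r ≠ 0 := sub_ne_zero.mpr hne
  set R := r + 1 with hR
  have hRpos : 0 < R := by linarith
  set b : ℝ → ℝ := fun s => u (√s) * max 0 (R ^ 2 - s) with hb
  have hbc : Continuous b := by fun_prop
  -- The choice of `b` makes `2 b(t²) u(t)` equal to `2 u(t)² (R² - t²)` on `[0, R]`. This is
  -- nonnegative, and positive at `t = r < R` if `u r ≠ 0`.
  have hbR : ∀ s, R ^ 2 ≤ s → b s = 0 := fun s hs => by
    simp only [hb, max_eq_left (sub_nonpos.mpr hs), mul_zero]
  set φ : ℝ → ℝ := fun s => ∫ t in (R ^ 2)..s, b t with hφ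
  have hφd : ∀ s, HasDerivAt φ (b s) s := fun s => (hbc.integral_hasStrictDerivAt _ s).hasDerivAt
  have hφc : Continuous φ := continuous_iff_continuousAt.mpr fun s => (hφd s).continuousAt
  have hφR : ∀ s, R ^ 2 ≤ s → φ s = 0 := fun s hs => by
    simp only [hφ]
    rw [intervalIntegral.integral_congr (g := fun _ => 0) fun t ht => hbR t ?_]
    · simp
    · rw [Set.uIcc_of_le hs] at ht
      exact ht.1
  -- the identity obtained from the cutoff
  have h1 : ∫ t in (0 : ℝ)..R, (φ (t ^ 2) * H t + 2 * b (t ^ 2) * X t) = 0 := by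
    have hint : Integrable fun x : Euc n =>
        φ (‖x‖ ^ 2) * ∑ i, pd i (V i) x + 2 * b (‖x‖ ^ 2) * ∑ i, V i x * x i :=
      Continuous.integrable_of_hasCompactSupport (by fun_prop)
        ((hasCompactSupport_comp_norm_sq hφR).mul_right.add
          (hasCompactSupport_comp_norm_sq hbR).mul_left.mul_right)
    refine Eq.trans ?_ (integral_radial_mul_div hV hbc hφd hφR hbR)
    rw [integral_eq_integral_sphereIntegral hint,
      intervalIntegral.integral_of_le hRpos.le]
    have e : ∀ t : ℝ, 0 ≤ t → sphereIntegral t (fun x : Euc n =>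
        φ (‖x‖ ^ 2) * ∑ i, pd i (V i) x + 2 * b (‖x‖ ^ 2) * ∑ i, V i x * x i) =
          φ (t ^ 2) * H t + 2 * b (t ^ 2) * X t := fun t ht => by
      rw [sphereIntegral_add _ (by fun_prop) (by fun_prop),
        sphereIntegral_congr (k := fun x : Euc n => φ (‖x‖ ^ 2) * ∑ i, pd i (V i) x)
          (k' := fun x => φ (t ^ 2) * ∑ i, pd i (V i) x) ht
          (fun x hx => by rw [hx]),
        sphereIntegral_congr (k := fun x : Euc n => 2 * b (‖x‖ ^ 2) * ∑ i, V i x * x i)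
          (k' := fun x => 2 * b (t ^ 2) * ∑ i, V i x * x i) ht
          (fun x hx => by rw [hx]), sphereIntegral_const_mul, sphereIntegral_const_mul]
    rw [setIntegral_congr_fun measurableSet_Ioi fun t ht => e t (Set.mem_Ioi.mp ht).le]
    refine (setIntegral_eq_of_subset_of_forall_sdiff_eq_zero measurableSet_Ioi
      Set.Ioc_subset_Ioi_self fun t ht => ?_).symm
    have htR : R ≤ t := by
      by_contra hlt
      exact ht.2 ⟨ht.1, (not_le.mp hlt).le⟩
    have : R ^ 2 ≤ t ^ 2 := by gcongr
    rw [hφR _ this, hbR _ this]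
    ring
  -- the identity obtained from the fundamental theorem of calculus
  have h2 : ∫ t in (0 : ℝ)..R, (2 * t * b (t ^ 2) * J t + φ (t ^ 2) * H t) = 0 := by
    have hd : ∀ t, HasDerivAt (fun t => φ (t ^ 2) * J t)
        (2 * t * b (t ^ 2) * J t + φ (t ^ 2) * H t) t := fun t => by
      have := ((hφd (t ^ 2)).comp t (hasDerivAt_pow 2 t)).mul (hJd t)
      refine this.congr_deriv ?_
      change b (t ^ 2) * ((2 : ℕ) * t ^ 1) * J t + φ (t ^ 2) * H t = _
      push_cast
      ring
    rw [intervalIntegral.integral_eq_sub_of_hasDerivAt (fun t _ => hd t)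
      (Continuous.intervalIntegrable (by fun_prop) _ _), hφR _ le_rfl]
    simp [hJ]
  -- Subtracting the two identities eliminates the terms with `φ`.
  have h3 : ∫ t in (0 : ℝ)..R, 2 * (u t ^ 2 * (R ^ 2 - t ^ 2)) = 0 := by
    have e : ∫ t in (0 : ℝ)..R, 2 * (u t ^ 2 * (R ^ 2 - t ^ 2)) =
        ∫ t in (0 : ℝ)..R, ((φ (t ^ 2) * H t + 2 * b (t ^ 2) * X t)
          - (2 * t * b (t ^ 2) * J t + φ (t ^ 2) * H t)) := by
      refine intervalIntegral.integral_congr fun t ht => ?_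
      rw [Set.uIcc_of_le hRpos.le] at ht
      have : t ^ 2 ≤ R ^ 2 := by have := ht.1; have := ht.2; gcongr
      simp only [hb, Real.sqrt_sq ht.1, max_eq_right (sub_nonneg.mpr this), hu]
      ring
    rw [e, intervalIntegral.integral_sub (Continuous.intervalIntegrable (by fun_prop) _ _)
      (Continuous.intervalIntegrable (by fun_prop) _ _), h1, h2, sub_zero]
  refine (intervalIntegral.integral_pos hRpos (by fun_prop) (fun t ht => ?_)
    ⟨r, ⟨hr, by linarith⟩, ?_⟩).ne' h3
  · have : t ^ 2 ≤ R ^ 2 := by have := ht.1; have := ht.2; gcongr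
    have := mul_nonneg (sq_nonneg (u t)) (sub_nonneg.mpr this)
    positivity
  · have : r ^ 2 < R ^ 2 := by gcongr; linarith
    have := mul_pos (pow_pos (abs_pos.mpr hur) 2) (sub_pos.mpr this)
    rw [sq_abs] at this
    positivity

/-- The divergence theorem on the closed ball of radius `r`. -/
lemma sphereIntegral_inner_normal [Nontrivial (Euc n)] {V : Fin n → Euc n → ℝ}
    (hV : ∀ i, ContDiff ℝ ∞ (V i))
    {r : ℝ} (hr : 0 < r) : sphereIntegral r (fun x => ∑ i, V i x * (r⁻¹ * x i)) =
      ∫ x in Metric.closedBall (0 : Euc n) r, ∑ i, pd i (V i) x := by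
  have hpc : ∀ i, Continuous (pd i (V i)) := fun i => (contDiff_pd (hV i) i).continuous
  have e : (fun x : Euc n => ∑ i, V i x * (r⁻¹ * x i)) =
      fun x => r⁻¹ * ∑ i, V i x * x i := funext fun x => by
    rw [Finset.mul_sum]
    exact Finset.sum_congr rfl fun i _ => by ring
  rw [e, sphereIntegral_const_mul, sphereIntegral_eq_mul_integral_div hV hr.le,
    integral_closedBall_eq (by fun_prop) hr.le, ← mul_assoc, inv_mul_cancel₀ hr.ne', one_mul]

end Divergence

/-! ### Uniform bounds for inverse matrices -/

section BoundedInverse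

variable {ι κ : Type*} [Fintype ι] [Fintype κ] [DecidableEq ι]

/-- If `B` is a symmetric inverse of `1 + Aᵀ A`, then the entries of `B` lie in `[-1, 1]`. -/
lemma abs_inv_one_add_le_one {A : Matrix κ ι ℝ} {B : Matrix ι ι ℝ} (hB : Bᵀ = B)
    (h : B * (1 + Aᵀ * A) = 1) (i j : ι) : |B i j| ≤ 1 := by
  have e : B = B * Bᵀ + (B * Aᵀ) * (B * Aᵀ)ᵀ := by
    calc B = B * (1 + Aᵀ * A) * Bᵀ := by rw [h, Matrix.one_mul, hB]
      _ = _ := by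
        rw [Matrix.mul_add, Matrix.add_mul, Matrix.mul_one, Matrix.transpose_mul,
          Matrix.transpose_transpose]
        simp only [Matrix.mul_assoc]
  -- By `e`, a diagonal entry is the sum of squares of its row plus further squares. Taking `j = i`
  -- then bounds the diagonal by 1, and with it every entry.
  have key : ∀ j, B i j ^ 2 ≤ B i i := fun j => by
    have h0 := congrFun (congrFun e i) i
    simp only [Matrix.add_apply, Matrix.mul_apply (M := B) (N := Bᵀ),
      Matrix.mul_apply (M := B * Aᵀ), Matrix.transpose_apply, ← sq] at h0
    have h1 : B i j ^ 2 ≤ ∑ k, B i k ^ 2 :=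
      Finset.single_le_sum (f := fun k => B i k ^ 2) (fun k _ => sq_nonneg _) (Finset.mem_univ j)
    have h2 : 0 ≤ ∑ k, (B * Aᵀ) i k ^ 2 := Finset.sum_nonneg fun k _ => sq_nonneg _
    linarith
  rw [← sq_le_one_iff_abs_le_one]
  have := key i
  have := key j
  nlinarith

end BoundedInverse

/-! ### Growth estimates for matrix expressions -/

section EntrywiseBigO

variable {X : Type*} {l : Filter X} {ι κ ρ : Type*} {φ ψ : X → ℝ}

/-- All entries of the matrix-valued function `M` are `O(φ)` along `l`. -/
def EntryBigO (l : Filter X) (M : X → Matrix ι κ ℝ) (φ : X → ℝ) : Prop :=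
  ∀ a b, (fun x => M x a b) =O[l] φ

lemma EntryBigO.mul [Fintype κ] {M : X → Matrix ι κ ℝ} {N : X → Matrix κ ρ ℝ}
    (hM : EntryBigO l M φ) (hN : EntryBigO l N ψ) :
    EntryBigO l (fun x => M x * N x) (fun x => φ x * ψ x) := fun a b => by
  simp only [Matrix.mul_apply]
  exact Asymptotics.IsBigO.fun_sum fun k _ => (hM a k).mul (hN k b)

lemma EntryBigO.mulVec [Fintype κ] {M : X → Matrix ι κ ℝ} {v : X → κ → ℝ}
    (hM : EntryBigO l M φ) (hv : ∀ k, (fun x => v x k) =O[l] ψ) (a : ι) :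
    (fun x => (M x *ᵥ v x) a) =O[l] (fun x => φ x * ψ x) := by
  simp only [Matrix.mulVec, dotProduct]
  exact Asymptotics.IsBigO.fun_sum fun k _ => (hM a k).mul (hv k)

lemma EntryBigO.add {M N : X → Matrix ι κ ℝ}
    (hM : EntryBigO l M φ) (hN : EntryBigO l N φ) :
    EntryBigO l (fun x => M x + N x) φ := fun a b => (hM a b).add (hN a b)

lemma EntryBigO.sub {M N : X → Matrix ι κ ℝ}
    (hM : EntryBigO l M φ) (hN : EntryBigO l N φ) :
    EntryBigO l (fun x => M x - N x) φ := fun a b => (hM a b).sub (hN a b)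

lemma EntryBigO.transpose {M : X → Matrix ι κ ℝ} (hM : EntryBigO l M φ) :
    EntryBigO l (fun x => (M x)ᵀ) φ := fun a b => hM b a

lemma EntryBigO.smul {c : X → ℝ} {M : X → Matrix ι κ ℝ} (hc : c =O[l] φ)
    (hM : EntryBigO l M ψ) : EntryBigO l (fun x => c x • M x) (fun x => φ x * ψ x) :=
  fun a b => hc.mul (hM a b)

lemma EntryBigO.const_smul (c : ℝ) {M : X → Matrix ι κ ℝ} (hM : EntryBigO l M φ) :
    EntryBigO l (fun x => c • M x) φ := fun a b => (hM a b).const_mul_left c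

lemma EntryBigO.trace [Fintype ι] {M : X → Matrix ι ι ℝ} (hM : EntryBigO l M φ) :
    (fun x => (M x).trace) =O[l] φ := by
  simp only [Matrix.trace, Matrix.diag_apply]
  exact Asymptotics.IsBigO.fun_sum fun k _ => hM k k

lemma EntryBigO.congr_right {M : X → Matrix ι κ ℝ} (hM : EntryBigO l M φ)
    (h : ∀ x, φ x = ψ x) : EntryBigO l M ψ := (funext h : φ = ψ) ▸ hM

lemma EntryBigO.pairing [Fintype ι] {g W : X → Matrix ι ι ℝ} {u v : X → ι → ℝ}
    (hg : EntryBigO l g fun _ => 1) (hW : EntryBigO l W φ) (hu : ∀ k, (fun x => u x k) =O[l] ψ)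
    (hv : ∀ k, (fun x => v x k) =O[l] ψ) :
    (fun x => pairing (g x) (u x) (v x) (W x)) =O[l] fun x => φ x * ψ x ^ 2 := by
  simp only [pairing_apply]
  refine Asymptotics.IsBigO.fun_sum fun i _ => Asymptotics.IsBigO.fun_sum fun j _ => ?_
  refine (((hg i j).mul (hW.mulVec hu i)).mul (hv j)).trans (Asymptotics.isBigO_of_le _ fun x => ?_)
  rw [one_mul, sq, mul_assoc]

/-- Every term is homogeneous of degree four in the matrices, traces included, and linear in each of
the two vectors. -/
lemma perpSummand_isBigO [Fintype ι] {g A C M N : X → Matrix ι ι ℝ} {u v : X → ι → ℝ}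
    (hg : EntryBigO l g fun _ => 1) (hA : EntryBigO l A φ) (hC : EntryBigO l C φ)
    (hM : EntryBigO l M φ) (hN : EntryBigO l N φ)
    (hu : ∀ k, (fun x => u x k) =O[l] ψ) (hv : ∀ k, (fun x => v x k) =O[l] ψ) :
    (fun x => perpSummand (pairing (g x) (u x) (v x)) (A x) (C x) (M x) (N x)) =O[l]
      fun x => φ x ^ 4 * ψ x ^ 2 := by
  have comm : ∀ {Y Z : X → Matrix ι ι ℝ}, EntryBigO l Y φ → EntryBigO l Z φ →
      EntryBigO l (fun x => Y x * Z x - Z x * Y x) fun x => φ x * φ x :=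
    fun hY hZ => (hY.mul hZ).sub (hZ.mul hY)
  have hT : EntryBigO l (fun x => opTSummand (C x) (M x) (N x)) fun x => φ x * (φ x * φ x) :=
    ((EntryBigO.smul hM.trace (comm hC hN)).add
      (((comm hM hC).mul hN).congr_right fun x => by ring)).add (hM.mul (comm hN hC))
  have h1 := EntryBigO.pairing (φ := fun x => φ x ^ 4) hg
    (((hM.mul (((hN.mul (comm hC hA)).add (((comm hC hN).mul hA).congr_right fun x => by ring)).sub
      (((comm hA hN).mul hC).congr_right fun x => by ring))).congr_right fun x => by ring).add
      ((EntryBigO.smul (hA.mul hM).trace (comm hN hC)).congr_right fun x => by ring)) hu hv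
  have h2 := EntryBigO.pairing (φ := fun x => φ x ^ 4) hg
    ((((((EntryBigO.smul hM.trace hN).sub (hM.mul hN)).mul (comm hC hA)).const_smul 2).congr_right
      fun x => by ring).add ((hT.mul hA).congr_right fun x => by ring) |>.add
      ((hA.mul hT).congr_right fun x => by ring)) hu hv
  have h3 := EntryBigO.pairing (φ := fun x => φ x ^ 4) hg
    ((EntryBigO.smul hA.trace hT).congr_right fun x => by ring) hu hv
  have h4 := ((hM.trace.mul hN.trace).sub (hM.mul hN).trace).mul
    (EntryBigO.pairing hg (comm hC hA) hu hv)
  refine ((h1.sub h2).add h3).add (((h4.const_mul_left (1 / 2)).congr_right fun x => ?_).congr_left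
    fun x => ?_)
  · ring
  · ring

end EntrywiseBigO

/-! ### Decay and integrability of the normal curvature term -/

section Decay

variable {n m : ℕ} {f : Euc n → Euc m} {τ : ℝ}

lemma abs_ginv_le_one (hf : ContDiff ℝ ∞ f) (x : Euc n) (i j : Fin n) :
    |ginv (graphMetric f) x i j| ≤ 1 :=
  abs_inv_one_add_le_one (A := jac f x) (ginv_transpose hf x)
    (by rw [← graphMetric_eq hf, ginv_mul_graphMetric hf]) i j

lemma abs_matUinv_le_one (hf : ContDiff ℝ ∞ f) (x : Euc n) (α β : Fin m) :
    |matUinv f x α β| ≤ 1 := by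
  refine abs_inv_one_add_le_one (A := (jac f x)ᵀ) (matUinv_transpose hf x) ?_ α β
  rw [Matrix.transpose_transpose, ← matU_eq, matUinv]
  refine Matrix.nonsing_inv_mul _ ?_
  have : (matU f x).PosDef := by
    rw [matU_eq]
    refine Matrix.PosDef.add_posSemidef Matrix.PosDef.one ?_
    simpa using Matrix.posSemidef_self_mul_conjTranspose (jac f x)
  exact this.det_pos.ne'.isUnit

lemma isBigO_one_of_abs_le_one {X : Type*} {l : Filter X} {a : X → ℝ} (h : ∀ x, |a x| ≤ 1) :
    a =O[l] fun _ => (1 : ℝ) :=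
  Asymptotics.isBigO_of_le _ fun x => by simpa using h x

namespace IsAsymptoticallyFlatMap

lemma jac_isBigO (hf : IsAsymptoticallyFlatMap f τ) :
    EntryBigO (Bornology.cobounded (Euc n)) (jac f) fun x => ‖x‖ ^ (-τ / 2) := fun α i => by
  refine Asymptotics.IsBigO.trans (Asymptotics.isBigO_of_le _ fun x => ?_) (hf.decay i i i α)
  have h1 := abs_nonneg (pd i (fun y => f y α) x)
  rw [Real.norm_eq_abs, Real.norm_eq_abs, abs_of_nonneg (a := _ + _) (by positivity), add_assoc]
  exact le_add_of_nonneg_right (by positivity)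

lemma hess_isBigO (hf : IsAsymptoticallyFlatMap f τ) (α : Fin m) :
    EntryBigO (Bornology.cobounded (Euc n)) (hess f α) fun x => ‖x‖ ^ (-τ / 2) * ‖x‖⁻¹ :=
    fun j i => by
  have h : (fun x => hess f α x j i * ‖x‖) =O[Bornology.cobounded (Euc n)]
      fun x => ‖x‖ ^ (-τ / 2) := by
    refine Asymptotics.IsBigO.trans (Asymptotics.isBigO_of_le _ fun x => ?_) (hf.decay i j i α)
    rw [Real.norm_eq_abs, Real.norm_eq_abs, abs_of_nonneg (a := _ + _) (by positivity), abs_mul,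
      abs_norm]
    change |pd j (pd i (fun y => f y α)) x| * ‖x‖ ≤ _
    have h1 := abs_nonneg (pd i (fun y => f y α) x)
    have h2 : 0 ≤ |pd i (pd j (pd i (fun y => f y α))) x| * ‖x‖ ^ 2 := by positivity
    linarith
  refine (h.mul (Asymptotics.isBigO_refl (fun x : Euc n => ‖x‖⁻¹) _)).congr' ?_ EventuallyEq.rfl
  filter_upwards [Bornology.eventually_ne_cobounded (0 : Euc n)] with x hx
  rw [mul_inv_cancel_right₀ (norm_ne_zero_iff.mpr hx)]

lemma order_pos (hf : IsAsymptoticallyFlatMap f τ) (hn : 5 ≤ n) : 0 < τ := by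
  have h := hf.order
  have : (5 : ℝ) ≤ n := by exact_mod_cast hn
  linarith

/-- Four shape operators of order `-(τ/2 + 1)` and two gradients of order `-τ/2` add up to `-(3τ +
4)`. The factors `g`, `g⁻¹` and `U⁻¹` stay bounded. -/
lemma halfPerp_isBigO (hf : IsAsymptoticallyFlatMap f τ) (hτ : 0 < τ) :
    halfPerp f =O[Bornology.cobounded (Euc n)] fun x => ‖x‖ ^ (-(3 * τ + 4)) := by
  set ψ : Euc n → ℝ := fun x => ‖x‖ ^ (-τ / 2) with hψ
  set φ : Euc n → ℝ := fun x => ‖x‖ ^ (-τ / 2) * ‖x‖⁻¹ with hφ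
  have ψ1 : ψ =O[Bornology.cobounded (Euc n)] fun _ => (1 : ℝ) := by
    refine Tendsto.isBigO_one (c := 0) ℝ ?_
    have := (tendsto_rpow_neg_atTop (half_pos hτ)).comp (tendsto_norm_cobounded_atTop (E := Euc n))
    refine this.congr fun x => ?_
    rw [hψ, Function.comp_apply, neg_div]
  have hg1 : EntryBigO (Bornology.cobounded (Euc n)) (ginv (graphMetric f)) fun _ => 1 :=
    fun a b => isBigO_one_of_abs_le_one fun x => abs_ginv_le_one hf.smooth x a b
  have hJ1 : EntryBigO (Bornology.cobounded (Euc n)) (jac f) fun _ => (1 : ℝ) :=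
    fun a b => (hf.jac_isBigO a b).trans ψ1
  have hg : EntryBigO (Bornology.cobounded (Euc n)) (graphMetric f) fun _ => 1 := by
    rw [show graphMetric f = fun y => 1 + (jac f y)ᵀ * jac f y from
      funext (graphMetric_eq hf.smooth)]
    exact EntryBigO.add (fun a b => Asymptotics.isBigO_const_const _ one_ne_zero _)
      ((hJ1.transpose.mul hJ1).congr_right fun _ => one_mul 1)
  have hA : ∀ α, EntryBigO (Bornology.cobounded (Euc n)) (shape f α) φ := fun α => by
    rw [show shape f α = fun x => ginv (graphMetric f) x * hess f α x from
      funext (shape_eq hf.smooth α)]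
    exact (hg1.mul (hf.hess_isBigO α)).congr_right fun x => one_mul _
  have hu : ∀ α k, (fun x => gradf f α x k) =O[Bornology.cobounded (Euc n)] ψ := fun α k =>
    (hg1.mulVec (fun i => hf.jac_isBigO α i) k).congr_right fun x => one_mul _
  have key : halfPerp f =O[Bornology.cobounded (Euc n)] fun x => φ x ^ 4 * ψ x ^ 2 := by
    refine Asymptotics.IsBigO.fun_sum fun μ _ => Asymptotics.IsBigO.fun_sum fun ν _ => ?_
    refine ((isBigO_one_of_abs_le_one fun x => abs_matUinv_le_one hf.smooth x μ ν).mul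
      (Asymptotics.IsBigO.fun_sum fun α _ => Asymptotics.IsBigO.fun_sum fun γ _ =>
        perpSummand_isBigO hg (hA α) (hA γ) (hA μ) (hA ν) (hu α) (hu γ))).congr_right
      fun x => one_mul _
  refine key.congr' EventuallyEq.rfl ?_
  filter_upwards [Bornology.eventually_ne_cobounded (0 : Euc n)] with x hx
  have hx' : 0 < ‖x‖ := norm_pos_iff.mpr hx
  simp only [hφ, hψ]
  rw [← Real.rpow_neg_one, ← Real.rpow_add hx', ← Real.rpow_mul_natCast hx'.le,
    ← Real.rpow_mul_natCast hx'.le, ← Real.rpow_add hx']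
  congr 1
  push_cast
  ring

end IsAsymptoticallyFlatMap

lemma continuous_halfPerp (hf : ContDiff ℝ ∞ f) : Continuous (halfPerp f) := by
  have hg : Continuous (graphMetric f) :=
    continuous_matrix fun i j => (contDiff_graphMetric hf i j).continuous
  have hA : ∀ α, Continuous (shape f α) := fun α =>
    continuous_matrix fun i j => (contDiff_shape hf α i j).continuous
  have hU : ∀ α β, Continuous fun x => matUinv f x α β := fun α β =>
    (contDiff_matUinv hf α β).continuous
  have hu : ∀ α, Continuous (gradf f α) := fun α =>
    continuous_pi fun k => (contDiff_gradf hf k α).continuous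
  have hp : ∀ (α γ) {W : Euc n → Matrix (Fin n) (Fin n) ℝ}, Continuous W →
      Continuous fun x => pairing (graphMetric f x) (gradf f α x) (gradf f γ x) (W x) :=
    fun α γ W hW => by
      simp only [pairing_apply]
      have h := fun i => (continuous_apply i).comp (hW.matrix_mulVec (hu α))
      exact continuous_finsetSum _ fun i _ => continuous_finsetSum _ fun j _ =>
        ((hg.matrix_elem i j).mul (h i)).mul ((continuous_apply j).comp (hu γ))
  unfold halfPerp perpSummand opTSummand
  refine continuous_finsetSum _ fun μ _ => continuous_finsetSum _ fun ν _ => (hU μ ν).mul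
    (continuous_finsetSum _ fun α _ => continuous_finsetSum _ fun γ _ => ?_)
  have := hA α
  have := hA γ
  have := hA μ
  have := hA ν
  exact (((hp α γ (by fun_prop)).sub (hp α γ (by fun_prop))).add (hp α γ (by fun_prop))).add
    (Continuous.mul (by fun_prop) (hp α γ (by fun_prop)))

lemma integrable_of_isBigO_norm_rpow {k : Euc n → ℝ} (hk : Continuous k) {s : ℝ} (hs : (n : ℝ) < s)
    (h : k =O[Bornology.cobounded (Euc n)] fun x => ‖x‖ ^ (-s)) : Integrable k := by
  have hs0 : 0 ≤ s := (Nat.cast_nonneg n).trans hs.le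
  have hi : Integrable fun x : Euc n => (1 + ‖x‖) ^ (-s) :=
    integrable_one_add_norm (by simpa using hs)
  refine hk.locallyIntegrable.integrable_of_isBigO_cocompact (g := fun x : Euc n =>
    (1 + ‖x‖) ^ (-s)) ?_ (hi.integrableAtFilter _)
  rw [← Metric.cobounded_eq_cocompact]
  -- The constant comes from `1 + ‖x‖ ≤ 2 ‖x‖` for `‖x‖ ≥ 1`.
  refine h.trans (Asymptotics.IsBigO.of_bound (2 ^ s) ?_)
  filter_upwards [tendsto_norm_cobounded_atTop.eventually_ge_atTop (1 : ℝ)] with x hx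
  rw [Real.norm_of_nonneg (by positivity), Real.norm_of_nonneg (by positivity),
    Real.rpow_neg (by positivity), Real.rpow_neg (by positivity), ← div_eq_mul_inv,
    inv_eq_one_div, div_le_div_iff₀ (by positivity) (by positivity), one_mul,
    ← Real.mul_rpow (by positivity) (by positivity)]
  exact Real.rpow_le_rpow (by positivity) (by linarith) hs0

/-- The condition `τ > (n - 4) / 3` is precisely `3τ + 4 > n`. -/
lemma IsAsymptoticallyFlatMap.integrable_halfPerp (hf : IsAsymptoticallyFlatMap f τ) (hn : 5 ≤ n) :
    Integrable (halfPerp f) :=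
  integrable_of_isBigO_norm_rpow (continuous_halfPerp hf.smooth)
    (by have := hf.order; linarith) (hf.halfPerp_isBigO (hf.order_pos hn))

end Decay

/-! ### Comparison of `μ_M` with Lebesgue measure -/

section Volume

variable {n m : ℕ} {f : Euc n → Euc m} {τ : ℝ}

lemma continuous_sqrt_det_graphMetric (hf : ContDiff ℝ ∞ f) :
    Continuous fun x => √(graphMetric f x).det :=
  (contDiff_det (contDiff_graphMetric hf)).continuous.sqrt

lemma sqrt_det_graphMetric_pos (hf : ContDiff ℝ ∞ f) (x : Euc n) :
    0 < √(graphMetric f x).det := Real.sqrt_pos.mpr (graphMetric_posDef hf x).det_pos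

lemma integral_riemVol (hf : ContDiff ℝ ∞ f) (k : Euc n → ℝ) :
    ∫ x, k x ∂(riemVol (graphMetric f)) = ∫ x, √(graphMetric f x).det * k x := by
  unfold riemVol ENNReal.ofReal
  rw [integral_withDensity_eq_integral_smul
    (continuous_sqrt_det_graphMetric hf).measurable.real_toNNReal]
  simp only [NNReal.smul_def, Real.coe_toNNReal _ (Real.sqrt_nonneg _), smul_eq_mul]

lemma integrable_riemVol_iff (hf : ContDiff ℝ ∞ f) (k : Euc n → ℝ) :
    Integrable k (riemVol (graphMetric f)) ↔
      Integrable fun x => √(graphMetric f x).det * k x := by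
  unfold riemVol ENNReal.ofReal
  rw [integrable_withDensity_iff_integrable_smul
    (continuous_sqrt_det_graphMetric hf).measurable.real_toNNReal]
  simp only [NNReal.smul_def, Real.coe_toNNReal _ (Real.sqrt_nonneg _), smul_eq_mul]

/-- The entries of `g⁻¹` lie in `[-1, 1]`, so the Leibniz formula bounds `1/G` by `n!`. Any uniform
bound suffices to pass from `μ_M` to `dx`. -/
lemma inv_sqrt_det_graphMetric_le (hf : ContDiff ℝ ∞ f) (x : Euc n) :
    (√(graphMetric f x).det)⁻¹ ≤ √(Nat.factorial n) := by
  rw [← Real.sqrt_inv]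
  refine Real.sqrt_le_sqrt ?_
  have h := Matrix.det_le (A := ginv (graphMetric f) x) (abv := AbsoluteValue.abs) (x := 1)
    fun i j => abs_ginv_le_one hf x i j
  rw [ginv, Matrix.det_nonsing_inv, Ring.inverse_eq_inv', Fintype.card_fin, one_pow,
    nsmul_one] at h
  exact (le_abs_self _).trans h

lemma integrable_of_integrable_riemVol (hf : ContDiff ℝ ∞ f) {k : Euc n → ℝ}
    (hk : Integrable k (riemVol (graphMetric f))) : Integrable k := by
  have h := ((integrable_riemVol_iff hf k).mp hk).bdd_mul
    (f := fun x => (√(graphMetric f x).det)⁻¹) (c := √(Nat.factorial n))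
    ((continuous_sqrt_det_graphMetric hf).inv₀ fun x =>
      (sqrt_det_graphMetric_pos hf x).ne').aestronglyMeasurable
    (Eventually.of_forall fun x => by
      rw [Real.norm_of_nonneg (inv_nonneg.mpr (Real.sqrt_nonneg _))]
      exact inv_sqrt_det_graphMetric_le hf x)
  refine h.congr (Eventually.of_forall fun x => ?_)
  exact inv_mul_cancel_left₀ (sqrt_det_graphMetric_pos hf x).ne' _

lemma sqrt_det_mul_mul_one_div (hf : ContDiff ℝ ∞ f) (c : ℝ) (x : Euc n) :
    √(graphMetric f x).det * (c * (1 / √(graphMetric f x).det)) = c := by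
  have := (sqrt_det_graphMetric_pos hf x).ne'
  field_simp

end Volume

/-! ### The mass as a bulk integral -/

section Mass

variable {n m : ℕ} {f : Euc n → Euc m} {τ : ℝ}

lemma tendsto_setIntegral_closedBall {k : Euc n → ℝ} (hk : Integrable k) :
    Tendsto (fun r => ∫ x in Metric.closedBall (0 : Euc n) r, k x) atTop (𝓝 (∫ x, k x)) := by
  have h := tendsto_setIntegral_of_monotone (μ := volume) (f := k)
    (fun r : ℝ => (Metric.isClosed_closedBall (x := (0 : Euc n)) (ε := r)).measurableSet)
    (fun _ _ h => Metric.closedBall_subset_closedBall h) hk.integrableOn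
  have e : ⋃ r : ℝ, Metric.closedBall (0 : Euc n) r = Set.univ :=
    Set.eq_univ_of_forall fun x => Set.mem_iUnion.mpr ⟨‖x‖, by simp⟩
  rwa [e, setIntegral_univ] at h

/-- The divergence theorem for the flux field, combined with the formula for its divergence; it is
exact at every radius. -/
lemma massFlux_eq [Nontrivial (Euc n)] (hf : ContDiff ℝ ∞ f) {r : ℝ} (hr : 0 < r) :
    massFlux (graphMetric f) r = c2 n * ∫ x in Metric.closedBall (0 : Euc n) r,
      (1 / 2) * (L2 (graphMetric f) x + L2perp f x) := by
  have e : (fun x : Euc n => ∑ i, ∑ j, ∑ k, ∑ l, tensorP (graphMetric f) i j k l x *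
      pd l (fun y => graphMetric f y j k) x * (r⁻¹ * x i)) =
        fun x => ∑ i, fluxField (graphMetric f) i x * (r⁻¹ * x i) := by
    funext x
    simp only [fluxField, Finset.sum_mul]
  rw [massFlux, e, sphereIntegral_inner_normal (fun i => contDiff_fluxField hf i) hr]
  congr 2
  funext x
  rw [sum_pd_fluxField hf, L2perp_eq hf]
  ring

lemma tendsto_massFlux [Nontrivial (Euc n)] (hf : ContDiff ℝ ∞ f)
    (hk : Integrable fun x => L2 (graphMetric f) x + L2perp f x) :
    Tendsto (massFlux (graphMetric f)) atTop
      (𝓝 ((1 / 2) * c2 n * ∫ x, (L2 (graphMetric f) x + L2perp f x))) := by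
  have h := (tendsto_setIntegral_closedBall (hk.const_mul (1 / 2))).const_mul (c2 n)
  rw [integral_const_mul, ← mul_assoc, mul_comm (c2 n)] at h
  refine h.congr' ?_
  filter_upwards [eventually_gt_atTop 0] with r hr
  exact (massFlux_eq hf hr).symm

lemma c2_nonneg (hn : 3 ≤ n) : 0 ≤ c2 n := by
  have h : (3 : ℝ) ≤ n := by exact_mod_cast hn
  have : 0 ≤ sphereArea n := measureReal_nonneg
  have h1 : 0 ≤ (n : ℝ) - 1 := by linarith
  have h2 : 0 ≤ (n : ℝ) - 2 := by linarith
  have h3 : 0 ≤ (n : ℝ) - 3 := by linarith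
  unfold c2
  positivity

lemma L2perp_eq_zero (hf : ContDiff ℝ ∞ f) (h : FlatNormalBundle f) (x : Euc n) :
    L2perp f x = 0 := by
  have e : ∀ α β, normalCurv f α β x = 0 := fun α β => normalCurv_eq_zero hf h α β x
  have eT : ∀ α, opT f α x = 0 := fun α => by simp [opT, e]
  simp [L2perp, e, eT, gInner]

lemma IsAsymptoticallyFlatMap.integrable_L2_add_L2perp (hf : IsAsymptoticallyFlatMap f τ)
    (hn : 5 ≤ n) (hL : Integrable (L2 (graphMetric f)) (riemVol (graphMetric f))) :
    Integrable fun x => L2 (graphMetric f) x + L2perp f x := by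
  simp only [L2perp_eq hf.smooth]
  exact (integrable_of_integrable_riemVol hf.smooth hL).add
    ((hf.integrable_halfPerp hn).const_mul 2)

end Mass

end GBC

end

theorem mainTheorem1 (n m : ℕ) (hn : 5 ≤ n) (τ : ℝ)
    (f : GBC.Euc n → GBC.Euc m) (hf : GBC.IsAsymptoticallyFlatMap f τ)
    (hL : MeasureTheory.Integrable (GBC.L2 (GBC.graphMetric f))
      (GBC.riemVol (GBC.graphMetric f))) :
    Filter.Tendsto (GBC.massFlux (GBC.graphMetric f)) Filter.atTop
        (nhds (GBC.gbcMass (GBC.graphMetric f))) ∧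
    MeasureTheory.Integrable
      (fun x => (GBC.L2 (GBC.graphMetric f) x + GBC.L2perp f x)
        * (1 / Real.sqrt (GBC.graphMetric f x).det))
      (GBC.riemVol (GBC.graphMetric f)) ∧
    GBC.gbcMass (GBC.graphMetric f) = (1 / 2) * GBC.c2 n *
      ∫ x, (GBC.L2 (GBC.graphMetric f) x + GBC.L2perp f x)
        * (1 / Real.sqrt (GBC.graphMetric f x).det) ∂(GBC.riemVol (GBC.graphMetric f)) ∧
    (GBC.FlatNormalBundle f → ∀ x, GBC.L2perp f x = 0) ∧
    (GBC.FlatNormalBundle f → (∀ x, 0 ≤ GBC.L2 (GBC.graphMetric f) x) →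
      0 ≤ GBC.gbcMass (GBC.graphMetric f)) := by
  -- It makes `Euc n` nontrivial, as polar coordinates require.
  have : NeZero n := ⟨by lia⟩
  have hint := hf.integrable_L2_add_L2perp hn hL
  have hlim := GBC.tendsto_massFlux hf.smooth hint
  -- `gbcMass` is a `limUnder`, so its value is known only through the convergence in `hlim`.
  have hmass : GBC.gbcMass (GBC.graphMetric f) = (1 / 2) * GBC.c2 n *
      ∫ x, (GBC.L2 (GBC.graphMetric f) x + GBC.L2perp f x) := hlim.limUnder_eq
  refine ⟨hmass ▸ hlim, ?_, ?_, fun h => GBC.L2perp_eq_zero hf.smooth h, fun h h0 => ?_⟩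
  · rw [GBC.integrable_riemVol_iff hf.smooth]
    -- The factor `1/√G` cancels the density of `μ_M`, leaving an integral with respect to `dx`.
    simpa only [GBC.sqrt_det_mul_mul_one_div hf.smooth] using hint
  · rw [GBC.integral_riemVol hf.smooth, hmass]
    simp only [GBC.sqrt_det_mul_mul_one_div hf.smooth]
  · rw [hmass]
    have h1 : 0 ≤ ∫ x, (GBC.L2 (GBC.graphMetric f) x + GBC.L2perp f x) :=
      MeasureTheory.integral_nonneg fun x => by
        rw [GBC.L2perp_eq_zero hf.smooth h, add_zero]
        exact h0 x
    have h2 := GBC.c2_nonneg (n := n) (by lia)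
    positivity
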